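/- Let $n\ge 0$, $\Xi=\mathbb R^n\times\mathbb R^n$ with symplectic form $\sigma((x,\xi),(y,\eta))=y\cdot\xi-x\cdot\eta$ and Haar measure $dX=(2\pi)^{-n}\,dx\,d\xi$. Put $e_X(Z)=e^{i\sigma(X,Z)}$, $\widehat g(Y)=\int_\Xi e^{-i\sigma(Y,Z)}g(Z)\,dZ$, and let $\langle\cdot,\cdot\rangle$ be the bilinear duality extending $\langle f,g\rangle=\int_\Xi f(X)g(X)\,dX$; similarly $\langle\!\langle\cdot,\cdot\rangle\!\rangle$ on $\Xi\times\Xi$. Let $\#$ be a bilinear composition law on the Schwartz space $\mathcal S(\Xi)$ such that: (A) $\#$ is associative and separately continuous, $\overline{f\# g}=\overline g\#\overline f$, and $\int_\Xi f\# g\,dX=\int_\Xi fg\,dX$ for all $f,g\in\mathcal S(\Xi)$. One then puts $\langle u\# f,k\rangle=\langle u,f\# k\rangle$ and $\langle f\# u,k\rangle=\langle u,k\# f\rangle$ for $u\in\mathcal S'(\Xi)$ and $f,k\in\mathcal S(\Xi)$. (B) $\mathcal S(\Xi)\#\mathcal S'(\Xi)\#\mathcal S(\Xi)\subset\mathcal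 S(\Xi)$. One then puts $\langle u\# f\# v,k\rangle=\langle u,f\# v\# k\rangle$ for $u,v\in\mathcal S'(\Xi)$ and $f,k\in\mathcal S(\Xi)$. (C) $\int_\Xi\langle e_{-Z}\# f\# e_Z,\,g\rangle\,dZ=\int_\Xi f\,dX\int_\Xi g\,dX$ for all $f,g\in\mathcal S(\Xi)$. Let $\mathbf N$ be the unique continuous linear map of $\mathcal S'(\Xi\times\Xi)$ into itself with $\langle\!\langle\mathbf N(f_1\otimes f_2),g_1\otimes g_2\rangle\!\rangle=\langle\widehat g_1\# f_1,\widehat g_2\# f_2\rangle$ for all $f_1,f_2,g_1,g_2\in\mathcal S(\Xi)$. Let $\mathbf M(F)=\mathbf N(F)\circ C$ with $C(X,Y)=(-X,X-Y)$, so that $[\mathbf M(f\otimes g)](X,Y)=\langle e_{-X}\# f,e_{X-Y}\# g\rangle$ for $f,g\in\mathcal S(\Xi)$. For $h\in\mathcal S(\Xi)\setminus\{0\}$ let $\mathbf M_h:\mathcal S'(\Xi)\to\mathcal S'(\Xi\times\Xi)$, $\mathbf M_h(f)=\mathbf M(f\otimes h)$. Let $(\mathfrak L,\|\cdot\|_{\mathfrak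 L})$ be a complex normed space continuously embedded in $\mathcal S'(\Xi\times\Xi)$, and let $h\in\mathcal S(\Xi)\setminus\{0\}$. 1. The vector space $\mathfrak L^{\mathbf M}_h:=\mathbf M_h^{-1}(\mathfrak L)\subset\mathcal S'(\Xi)$ is a normed space with the norm $\|f\|_{\mathfrak L^{\mathbf M}_h}:=\|\mathbf M_h(f)\|_{\mathfrak L}$. 2. If $\mathfrak L$ is a Banach space, then $\mathfrak L^{\mathbf M}_h$ is also a Banach space. -/

import Mathlib

open MeasureTheory
open scoped SchwartzMap FourierTransform ContDiff

noncomputable section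

namespace AbstractModulation

/-! ### Phase space, Haar measure, symplectic Fourier transform -/

/-- The phase space `Ξ = ℝⁿ × (ℝⁿ)'`. The point `X = (x, ξ)` has position coordinates
`x i = X (Sum.inl i)` and momentum coordinates `ξ i = X (Sum.inr i)`. -/
abbrev PhaseSpace (n : ℕ) : Type := EuclideanSpace ℝ (Fin n ⊕ Fin n)

/-- The symplectic form `σ((x, ξ), (y, η)) = y · ξ - x · η`. -/
def symplecticForm {n : ℕ} (X Y : PhaseSpace n) : ℝ :=
  ∑ i, Y (Sum.inl i) * X (Sum.inr i) - ∑ i, X (Sum.inl i) * Y (Sum.inr i)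

/-- The Haar measure `dX` on `Ξ`: Lebesgue measure times `(2π)⁻ⁿ`, the normalization for which the
symplectic Fourier transform is unitary and squares to one. -/
def phaseMeasure (n : ℕ) : Measure (PhaseSpace n) :=
  ENNReal.ofReal (((2 * Real.pi) ^ n)⁻¹) • (volume : Measure (PhaseSpace n))

instance (n : ℕ) : (phaseMeasure n).IsAddHaarMeasure := by
  unfold phaseMeasure
  refine Measure.IsAddHaarMeasure.smul _ ?_ ENNReal.ofReal_ne_top
  rw [Ne, ENNReal.ofReal_eq_zero, not_le]
  positivity

instance (n : ℕ) : ((phaseMeasure n).prod (phaseMeasure n)).IsAddHaarMeasure :=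
  Measure.prod.instIsAddHaarMeasure _ _

/-- The linear isomorphism `(y, η) ↦ (2π)⁻¹ (η, -y)` of `Ξ`. -/
def symplecticEquiv (n : ℕ) : PhaseSpace n ≃L[ℝ] PhaseSpace n :=
  LinearEquiv.toContinuousLinearEquiv
    { toFun := fun Y => WithLp.toLp 2
        (Sum.elim (fun i => (2 * Real.pi)⁻¹ * Y (Sum.inr i))
          (fun i => -((2 * Real.pi)⁻¹ * Y (Sum.inl i))))
      map_add' := fun Y Z => by
        ext (i | i) <;> simp <;> ring
      map_smul' := fun c Y => by
        ext (i | i) <;> simp <;> ring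
      invFun := fun W => WithLp.toLp 2
        (Sum.elim (fun i => -(2 * Real.pi * W (Sum.inr i)))
          (fun i => 2 * Real.pi * W (Sum.inl i)))
      left_inv := fun Y => by
        ext (i | i) <;> simp <;> field_simp
      right_inv := fun W => by
        ext (i | i) <;> simp <;> field_simp }

/-- The symplectic Fourier transform on `𝓢(Ξ)`; see `symplecticFourier_apply` for the formula. -/
def symplecticFourier (n : ℕ) : 𝓢(PhaseSpace n, ℂ) →L[ℂ] 𝓢(PhaseSpace n, ℂ) :=
  (((2 * Real.pi) ^ n)⁻¹ : ℂ) •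
    (SchwartzMap.compCLMOfContinuousLinearEquiv ℂ (symplecticEquiv n) ∘L
      SchwartzMap.fourierTransformCLM ℂ)

/-- `(𝔉 g)(Y) = ∫ e^{-iσ(Y,Z)} g(Z) dZ`. -/
theorem symplecticFourier_apply {n : ℕ} (g : 𝓢(PhaseSpace n, ℂ)) (Y : PhaseSpace n) :
    symplecticFourier n g Y =
      ∫ Z, Complex.exp (-(Complex.I * (symplecticForm Y Z : ℂ))) * g Z ∂(phaseMeasure n) := by
  have hker : ∀ Z : PhaseSpace n,
      2 * Real.pi * inner ℝ Z (symplecticEquiv n Y) = symplecticForm Y Z := by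
    intro Z
    have hsym : ∀ a, symplecticEquiv n Y a = Sum.elim (fun i => (2 * Real.pi)⁻¹ * Y (Sum.inr i))
        (fun i => -((2 * Real.pi)⁻¹ * Y (Sum.inl i))) a := fun a => rfl
    rw [PiLp.inner_apply, Fintype.sum_sum_type, mul_add, Finset.mul_sum, Finset.mul_sum,
      symplecticForm, sub_eq_add_neg, ← Finset.sum_neg_distrib]
    congr 1 <;> refine Finset.sum_congr rfl fun i _ => ?_ <;> simp [hsym] <;> field_simp
  have h1 : symplecticFourier n g Y =
      (((2 * Real.pi) ^ n)⁻¹ : ℂ) * 𝓕 (g : PhaseSpace n → ℂ) (symplecticEquiv n Y) := rfl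
  rw [h1, Real.fourier_eq', phaseMeasure, integral_smul_measure,
    ENNReal.toReal_ofReal (by positivity), Complex.real_smul]
  push_cast
  congr 1
  refine integral_congr_ae (Filter.Eventually.of_forall fun Z => ?_)
  simp only [smul_eq_mul]
  rw [← hker Z]
  congr 2
  push_cast
  ring

/-- The tempered distribution `e_X` given by the function `e_X(Z) = exp(iσ(X,Z))`, that is
`e_X = 𝔉 δ_X`; see `expDist_apply`. -/
def expDist {n : ℕ} (X : PhaseSpace n) : 𝓢'(PhaseSpace n, ℂ) :=
  PointwiseConvergenceCLM.precomp ℂ (symplecticFourier n) (TemperedDistribution.delta (-X))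

theorem expDist_apply {n : ℕ} (X : PhaseSpace n) (g : 𝓢(PhaseSpace n, ℂ)) :
    expDist X g =
      ∫ Z, Complex.exp (Complex.I * (symplecticForm X Z : ℂ)) * g Z ∂(phaseMeasure n) := by
  change symplecticFourier n g (-X) = _
  rw [symplecticFourier_apply]
  congr 1; ext Z; congr 2
  simp [symplecticForm, Finset.sum_neg_distrib]
  ring

/-! ### Tensor products -/

section Tensor

variable {n : ℕ}

theorem norm_iteratedFDeriv_comp_le {E E' V : Type} [NormedAddCommGroup E]
    [NormedSpace ℝ E] [NormedAddCommGroup E'] [NormedSpace ℝ E'] [NormedAddCommGroup V]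
    [NormedSpace ℝ V] (f : 𝓢(E', V)) (L : E →L[ℝ] E') (hL : ‖L‖ ≤ 1) (i : ℕ) (x : E) :
    ‖iteratedFDeriv ℝ i (fun p => f (L p)) x‖ ≤ ‖iteratedFDeriv ℝ i f (L x)‖ := by
  have h := L.iteratedFDeriv_comp_right (f.smooth i) x (le_refl (i : ℕ∞ω))
  change ‖iteratedFDeriv ℝ i (f ∘ L) x‖ ≤ _
  rw [h]
  refine (ContinuousMultilinearMap.norm_compContinuousLinearMap_le _ _).trans ?_
  refine mul_le_of_le_one_right (norm_nonneg _) ?_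
  exact Finset.prod_le_one (fun _ _ => norm_nonneg _) (fun _ _ => hL)

theorem tensor_decay_aux {a b c A B s t c₁ c₂ c₃ c₄ : ℝ} {k : ℕ} (hs : 0 ≤ s)
    (ht : 0 ≤ t) (ha : 0 ≤ a) (hb : 0 ≤ b) (hA : 0 ≤ A) (hc : 0 ≤ c)
    (haA : a ≤ A) (hbB : b ≤ B) (h₁ : s ^ k * A ≤ c₁) (h₂ : B ≤ c₂) (h₃ : A ≤ c₃)
    (h₄ : t ^ k * B ≤ c₄) :
    max s t ^ k * (c * a * b) ≤ c * (c₁ * c₂ + c₃ * c₄) := by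
  have h0 : max s t ^ k ≤ s ^ k + t ^ k := by
    have := pow_nonneg hs k
    have := pow_nonneg ht k
    rcases max_cases s t with ⟨h, -⟩ | ⟨h, -⟩ <;> rw [h] <;> linarith
  have hB : 0 ≤ B := hb.trans hbB
  have hsA : 0 ≤ s ^ k * A := by positivity
  have htB : 0 ≤ t ^ k * B := by positivity
  calc max s t ^ k * (c * a * b) ≤ (s ^ k + t ^ k) * (c * A * B) := by gcongr
    _ = c * ((s ^ k * A) * B + A * (t ^ k * B)) := by ring
    _ ≤ _ := by gcongr <;> linarith

theorem tensor_decay (f g : 𝓢(PhaseSpace n, ℂ)) (k m : ℕ) :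
    ∃ C : ℝ, ∀ p : PhaseSpace n × PhaseSpace n,
      ‖p‖ ^ k * ‖iteratedFDeriv ℝ m (fun p => f p.1 * g p.2) p‖ ≤ C := by
  have hf : ContDiff ℝ ∞ (fun p : PhaseSpace n × PhaseSpace n => f p.1) :=
    f.smooth'.comp contDiff_fst
  have hg : ContDiff ℝ ∞ (fun p : PhaseSpace n × PhaseSpace n => g p.2) :=
    g.smooth'.comp contDiff_snd
  refine ⟨∑ i ∈ Finset.range (m + 1), (m.choose i : ℝ) *
    (SchwartzMap.seminorm ℝ k i f * SchwartzMap.seminorm ℝ 0 (m - i) g +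
      SchwartzMap.seminorm ℝ 0 i f * SchwartzMap.seminorm ℝ k (m - i) g), fun p => ?_⟩
  have hm : (m : ℕ∞ω) ≤ ∞ := by exact_mod_cast le_top
  have h := norm_iteratedFDeriv_mul_le hf hg p hm
  refine (mul_le_mul_of_nonneg_left h (by positivity)).trans ?_
  rw [Finset.mul_sum]
  refine Finset.sum_le_sum fun i _ => ?_
  have h₁ : ‖iteratedFDeriv ℝ i (fun p : PhaseSpace n × PhaseSpace n => f p.1) p‖ ≤
      ‖iteratedFDeriv ℝ i f p.1‖ :=
    norm_iteratedFDeriv_comp_le f (ContinuousLinearMap.fst ℝ (PhaseSpace n) (PhaseSpace n))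
      (ContinuousLinearMap.norm_fst_le ℝ _ _) i p
  have h₂ : ‖iteratedFDeriv ℝ (m - i) (fun p : PhaseSpace n × PhaseSpace n => g p.2) p‖ ≤
      ‖iteratedFDeriv ℝ (m - i) g p.2‖ :=
    norm_iteratedFDeriv_comp_le g (ContinuousLinearMap.snd ℝ (PhaseSpace n) (PhaseSpace n))
      (ContinuousLinearMap.norm_snd_le ℝ _ _) (m - i) p
  rw [Prod.norm_def]
  exact tensor_decay_aux (norm_nonneg p.1) (norm_nonneg p.2) (norm_nonneg _) (norm_nonneg _)
    (norm_nonneg _) (Nat.cast_nonneg _) h₁ h₂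
    (f.le_seminorm ℝ k i p.1) (g.norm_iteratedFDeriv_le_seminorm ℝ (m - i) p.2)
    (f.norm_iteratedFDeriv_le_seminorm ℝ i p.1) (g.le_seminorm ℝ k (m - i) p.2)

/-- The elementary tensor `(f ⊗ g)(X, Y) = f(X) g(Y)` of Schwartz functions. -/
def tensor (f g : 𝓢(PhaseSpace n, ℂ)) : 𝓢(PhaseSpace n × PhaseSpace n, ℂ) where
  toFun := fun p => f p.1 * g p.2
  smooth' := (f.smooth'.comp contDiff_fst).mul (g.smooth'.comp contDiff_snd)
  decay' := tensor_decay f g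

@[simp] theorem tensor_apply (f g : 𝓢(PhaseSpace n, ℂ)) (X Y : PhaseSpace n) :
    tensor f g (X, Y) = f X * g Y := rfl

section Marginal

variable {V : Type} [NormedAddCommGroup V] [NormedSpace ℝ V]

abbrev schwartzBound (k m : ℕ) (F : 𝓢(PhaseSpace n × PhaseSpace n, V)) : ℝ :=
  2 ^ (k + (phaseMeasure n).integrablePower) *
    (Finset.Iic (k + (phaseMeasure n).integrablePower, m)).sup
      (fun q => SchwartzMap.seminorm ℝ (E := PhaseSpace n × PhaseSpace n) (F := V) q.1 q.2) F

theorem pow_mul_le (k m : ℕ) (F : 𝓢(PhaseSpace n × PhaseSpace n, V))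
    (x y : PhaseSpace n) :
    ‖x‖ ^ k * ‖iteratedFDeriv ℝ m F (x, y)‖ ≤
      schwartzBound k m F * (1 + ‖y‖) ^ (-((phaseMeasure n).integrablePower : ℝ)) := by
  have h := SchwartzMap.one_add_le_sup_seminorm_apply (𝕜 := ℝ)
    (m := (k + (phaseMeasure n).integrablePower, m)) (le_refl _) (le_refl _) F (x, y)
  have hy : 0 < 1 + ‖y‖ := by positivity
  rw [Real.rpow_neg hy.le, Real.rpow_natCast, ← div_eq_mul_inv, le_div_iff₀ (by positivity)]
  refine le_trans ?_ h
  have hx1 : ‖x‖ ≤ 1 + ‖(x, y)‖ := by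
    have := norm_fst_le (x, y)
    simp only at this; linarith
  have hy1 : 1 + ‖y‖ ≤ 1 + ‖(x, y)‖ := by
    have := norm_snd_le (x, y)
    simp only at this; linarith
  calc ‖x‖ ^ k * ‖iteratedFDeriv ℝ m F (x, y)‖ * (1 + ‖y‖) ^ (phaseMeasure n).integrablePower
      ≤ (1 + ‖(x, y)‖) ^ k * ‖iteratedFDeriv ℝ m F (x, y)‖ *
          (1 + ‖(x, y)‖) ^ (phaseMeasure n).integrablePower := by gcongr
    _ = _ := by rw [pow_add]; ring

theorem integrable_norm_iteratedFDeriv (m : ℕ)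
    (F : 𝓢(PhaseSpace n × PhaseSpace n, V)) (x : PhaseSpace n) :
    Integrable (fun y => ‖iteratedFDeriv ℝ m F (x, y)‖) (phaseMeasure n) := by
  refine (((phaseMeasure n).integrable_pow_neg_integrablePower).const_mul
    (schwartzBound 0 m F)).mono' ?_ (Filter.Eventually.of_forall fun y => ?_)
  · refine Continuous.aestronglyMeasurable ?_
    exact (((F.smooth m).continuous_iteratedFDeriv le_rfl).comp
      (Continuous.prodMk_right x)).norm
  · simpa using pow_mul_le 0 m F x y

theorem integrable_slice (F : 𝓢(PhaseSpace n × PhaseSpace n, V)) (x : PhaseSpace n) :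
    Integrable (fun y => F (x, y)) (phaseMeasure n) := by
  refine (integrable_norm_iff ?_).1 ?_
  · exact (F.continuous.comp (Continuous.prodMk_right x)).aestronglyMeasurable
  · simpa using integrable_norm_iteratedFDeriv 0 F x

def sliceDeriv (F : 𝓢(PhaseSpace n × PhaseSpace n, V)) :
    𝓢(PhaseSpace n × PhaseSpace n, PhaseSpace n →L[ℝ] V) :=
  SchwartzMap.postcompCLM (𝕜 := ℝ)
    ((ContinuousLinearMap.inl ℝ (PhaseSpace n) (PhaseSpace n)).precomp V)
    (SchwartzMap.fderivCLM ℝ (PhaseSpace n × PhaseSpace n) V F)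

theorem norm_sliceDeriv_le (m : ℕ) (F : 𝓢(PhaseSpace n × PhaseSpace n, V))
    (p : PhaseSpace n × PhaseSpace n) :
    ‖iteratedFDeriv ℝ m (sliceDeriv F) p‖ ≤ ‖iteratedFDeriv ℝ (m + 1) F p‖ := by
  rw [← norm_iteratedFDeriv_fderiv]
  have h := ContinuousLinearMap.norm_iteratedFDeriv_comp_left
    ((ContinuousLinearMap.inl ℝ (PhaseSpace n) (PhaseSpace n)).precomp V)
    (f := fderiv ℝ F) (x := p) (n := m)
    (((SchwartzMap.fderivCLM ℝ (PhaseSpace n × PhaseSpace n) V F).smooth m).contDiffAt) le_rfl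
  refine h.trans (mul_le_of_le_one_left (norm_nonneg _) ?_)
  refine ContinuousLinearMap.opNorm_le_bound _ zero_le_one fun A => ?_
  refine (ContinuousLinearMap.opNorm_comp_le _ _).trans ?_
  rw [mul_comm]
  exact mul_le_mul_of_nonneg_right (ContinuousLinearMap.norm_inl_le_one ℝ _ _) (norm_nonneg _)

theorem hasFDerivAt_marginal (F : 𝓢(PhaseSpace n × PhaseSpace n, V))
    (x : PhaseSpace n) :
    HasFDerivAt (fun x => ∫ y, F (x, y) ∂(phaseMeasure n))
      (∫ y, sliceDeriv F (x, y) ∂(phaseMeasure n)) x := by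
  refine hasFDerivAt_integral_of_dominated_of_fderiv_le (s := Set.univ)
    (bound := fun y => schwartzBound 0 0 (sliceDeriv F) *
      (1 + ‖y‖) ^ (-((phaseMeasure n).integrablePower : ℝ))) Filter.univ_mem
    (Filter.Eventually.of_forall fun x => (integrable_slice F x).1) (integrable_slice F x)
    (integrable_slice (sliceDeriv F) x).1
    (Filter.Eventually.of_forall fun y x _ => by simpa using pow_mul_le 0 0 (sliceDeriv F) x y)
    (((phaseMeasure n).integrable_pow_neg_integrablePower).const_mul _)
    (Filter.Eventually.of_forall fun y x _ => ?_)
  have h1 := F.hasFDerivAt (x, y)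
  have h2 : HasFDerivAt (fun x : PhaseSpace n => (x, y))
      (ContinuousLinearMap.inl ℝ (PhaseSpace n) (PhaseSpace n)) x :=
    hasFDerivAt_prodMk_left x y
  exact h1.comp x h2

theorem marginal_aux (m : ℕ) : ∀ {V : Type} [NormedAddCommGroup V] [NormedSpace ℝ V]
    (F : 𝓢(PhaseSpace n × PhaseSpace n, V)),
    ContDiff ℝ m (fun x => ∫ y, F (x, y) ∂(phaseMeasure n)) ∧
      ∀ x, ‖iteratedFDeriv ℝ m (fun x => ∫ y, F (x, y) ∂(phaseMeasure n)) x‖ ≤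
        ∫ y, ‖iteratedFDeriv ℝ m F (x, y)‖ ∂(phaseMeasure n) := by
  induction m with
  | zero =>
    intro V _ _ F
    refine ⟨?_, fun x => ?_⟩
    · rw [Nat.cast_zero, contDiff_zero]
      exact continuous_iff_continuousAt.2 fun x => (hasFDerivAt_marginal F x).continuousAt
    · simpa using norm_integral_le_integral_norm (μ := phaseMeasure n) (fun y => F (x, y))
  | succ m ih =>
    intro V _ _ F
    have hfd : fderiv ℝ (fun x => ∫ y, F (x, y) ∂(phaseMeasure n)) =
        fun x => ∫ y, sliceDeriv F (x, y) ∂(phaseMeasure n) :=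
      funext fun x => (hasFDerivAt_marginal F x).fderiv
    refine ⟨?_, fun x => ?_⟩
    · rw [Nat.cast_succ, contDiff_succ_iff_fderiv]
      refine ⟨fun x => (hasFDerivAt_marginal F x).differentiableAt, by simp, ?_⟩
      rw [hfd]
      exact (ih (sliceDeriv F)).1
    · rw [← norm_iteratedFDeriv_fderiv, hfd]
      exact ((ih (sliceDeriv F)).2 x).trans (integral_mono
        (integrable_norm_iteratedFDeriv m (sliceDeriv F) x)
        (integrable_norm_iteratedFDeriv (m + 1) F x) fun y => norm_sliceDeriv_le m F (x, y))

end Marginal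

/-- Partial integration `F ↦ ∫ F(·, Y) dY` as a continuous linear map `𝓢(Ξ × Ξ) → 𝓢(Ξ)`. -/
def marginalCLM (n : ℕ) : 𝓢(PhaseSpace n × PhaseSpace n, ℂ) →L[ℂ] 𝓢(PhaseSpace n, ℂ) :=
  SchwartzMap.mkCLM (fun F x => ∫ y, F (x, y) ∂(phaseMeasure n))
    (fun F G x => integral_add (integrable_slice F x) (integrable_slice G x))
    (fun a F x => integral_smul a _)
    (fun F => contDiff_infty.2 fun m => (marginal_aux m F).1)
    (by
      rintro ⟨k, m⟩
      refine ⟨Finset.Iic (k + (phaseMeasure n).integrablePower, m),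
        2 ^ (k + (phaseMeasure n).integrablePower) *
          ∫ y, (1 + ‖y‖) ^ (-((phaseMeasure n).integrablePower : ℝ)) ∂(phaseMeasure n),
        mul_nonneg (by positivity) (integral_nonneg fun y => by positivity), fun F x => ?_⟩
      have h := mul_le_mul_of_nonneg_left ((marginal_aux m F).2 x) (by positivity : 0 ≤ ‖x‖ ^ k)
      refine h.trans ?_
      rw [← integral_const_mul]
      refine (integral_mono ((integrable_norm_iteratedFDeriv m F x).const_mul _)
        (((phaseMeasure n).integrable_pow_neg_integrablePower).const_mul (schwartzBound k m F))
        fun y => pow_mul_le k m F x y).trans (le_of_eq ?_)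
      rw [integral_const_mul]
      have hs : (Finset.Iic (k + (phaseMeasure n).integrablePower, m)).sup
          (schwartzSeminormFamily ℂ (PhaseSpace n × PhaseSpace n) ℂ) F =
          (Finset.Iic (k + (phaseMeasure n).integrablePower, m)).sup
          (fun q => SchwartzMap.seminorm ℝ (E := PhaseSpace n × PhaseSpace n) (F := ℂ) q.1 q.2)
            F := by
        rw [Seminorm.finset_sup_apply, Seminorm.finset_sup_apply]
        rfl
      rw [hs]
      ring)

@[simp] theorem marginalCLM_apply (F : 𝓢(PhaseSpace n × PhaseSpace n, ℂ)) (X : PhaseSpace n) :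
    marginalCLM n F X = ∫ Y, F (X, Y) ∂(phaseMeasure n) := rfl

/-- The map `G ↦ ∫ G(·, Y) h(Y) dY` from `𝓢(Ξ × Ξ)` to `𝓢(Ξ)`. -/
def partialPairing (h : 𝓢(PhaseSpace n, ℂ)) :
    𝓢(PhaseSpace n × PhaseSpace n, ℂ) →L[ℂ] 𝓢(PhaseSpace n, ℂ) :=
  marginalCLM n ∘L SchwartzMap.smulLeftCLM ℂ (fun p => h p.2)

theorem partialPairing_apply (h : 𝓢(PhaseSpace n, ℂ))
    (G : 𝓢(PhaseSpace n × PhaseSpace n, ℂ)) (X : PhaseSpace n) :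
    partialPairing h G X = ∫ Y, h Y * G (X, Y) ∂(phaseMeasure n) := by
  have hg : Function.HasTemperateGrowth (fun p : PhaseSpace n × PhaseSpace n => h p.2) :=
    h.hasTemperateGrowth.comp
      (ContinuousLinearMap.snd ℝ (PhaseSpace n) (PhaseSpace n)).hasTemperateGrowth
  simp [partialPairing, SchwartzMap.smulLeftCLM_apply_apply hg]

/-- The localization map `J_h f = f ⊗ h` for `f ∈ 𝓢'(Ξ)` and `h ∈ 𝓢(Ξ)`:
`⟨f ⊗ h, G⟩ = ⟨f, ∫ G(·, Y) h(Y) dY⟩`. -/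
def tensorRight (h : 𝓢(PhaseSpace n, ℂ)) :
    𝓢'(PhaseSpace n, ℂ) →L[ℂ] 𝓢'(PhaseSpace n × PhaseSpace n, ℂ) :=
  PointwiseConvergenceCLM.precomp ℂ (partialPairing h)

end Tensor

/-! ### Composition laws -/

/-- Complex conjugation on `𝓢(Ξ)`. -/
def conj {n : ℕ} (f : 𝓢(PhaseSpace n, ℂ)) : 𝓢(PhaseSpace n, ℂ) :=
  SchwartzMap.postcompCLM (𝕜 := ℝ) (Complex.conjCLE : ℂ →L[ℝ] ℂ) f

@[simp] theorem conj_apply {n : ℕ} (f : 𝓢(PhaseSpace n, ℂ)) (X : PhaseSpace n) :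
    conj f X = (starRingEnd ℂ) (f X) := rfl

/-- A composition law `#` on `𝓢(Ξ)` of the kind considered here: `𝓢(Ξ)` is a `*`-algebra with the
separately continuous product `#` and with complex conjugation as involution, and
`∫ f # g = ∫ f g`. -/
structure CompositionLaw (n : ℕ) where
  /-- The bilinear product `#`. -/
  mul : 𝓢(PhaseSpace n, ℂ) →ₗ[ℂ] 𝓢(PhaseSpace n, ℂ) →ₗ[ℂ] 𝓢(PhaseSpace n, ℂ)
  assoc : ∀ f g h, mul (mul f g) h = mul f (mul g h)
  conj_mul : ∀ f g, conj (mul f g) = mul (conj g) (conj f)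
  continuous_left : ∀ f, Continuous fun g => mul f g
  continuous_right : ∀ g, Continuous fun f => mul f g
  integral_mul : ∀ f g, ∫ X, mul f g X ∂(phaseMeasure n) = ∫ X, f X * g X ∂(phaseMeasure n)

namespace CompositionLaw

variable {n : ℕ} (S : CompositionLaw n)

/-- `g ↦ f # g` as a continuous linear map. -/
def mulLeft (f : 𝓢(PhaseSpace n, ℂ)) : 𝓢(PhaseSpace n, ℂ) →L[ℂ] 𝓢(PhaseSpace n, ℂ) :=
  ⟨S.mul f, S.continuous_left f⟩

/-- `g ↦ g # f` as a continuous linear map. -/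
def mulRight (f : 𝓢(PhaseSpace n, ℂ)) : 𝓢(PhaseSpace n, ℂ) →L[ℂ] 𝓢(PhaseSpace n, ℂ) :=
  ⟨S.mul.flip f, S.continuous_right f⟩

/-- The product `u # f ∈ 𝓢'(Ξ)` for `u ∈ 𝓢'(Ξ)`, `f ∈ 𝓢(Ξ)`: `⟨u # f, k⟩ = ⟨u, f # k⟩`. -/
def distMul (u : 𝓢'(PhaseSpace n, ℂ)) (f : 𝓢(PhaseSpace n, ℂ)) : 𝓢'(PhaseSpace n, ℂ) :=
  PointwiseConvergenceCLM.precomp ℂ (S.mulLeft f) u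

/-- The product `f # u ∈ 𝓢'(Ξ)` for `f ∈ 𝓢(Ξ)`, `u ∈ 𝓢'(Ξ)`: `⟨f # u, k⟩ = ⟨u, k # f⟩`. -/
def mulDist (f : 𝓢(PhaseSpace n, ℂ)) (u : 𝓢'(PhaseSpace n, ℂ)) : 𝓢'(PhaseSpace n, ℂ) :=
  PointwiseConvergenceCLM.precomp ℂ (S.mulRight f) u

/-- The sandwich property: `𝓢(Ξ) # 𝓢'(Ξ) # 𝓢(Ξ) ⊆ 𝓢(Ξ)`. -/
def SandwichProperty : Prop :=
  ∀ (f : 𝓢(PhaseSpace n, ℂ)) (u : 𝓢'(PhaseSpace n, ℂ)) (g : 𝓢(PhaseSpace n, ℂ)),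
    ∃ k : 𝓢(PhaseSpace n, ℂ),
      SchwartzMap.toTemperedDistributionCLM (PhaseSpace n) ℂ (phaseMeasure n) k =
        S.distMul (S.mulDist f u) g

variable {S} in
/-- Under the sandwich property, the Schwartz function `f # u # g` for `f, g ∈ 𝓢(Ξ)`, `u ∈ 𝓢'(Ξ)`. -/
def SandwichProperty.sandwich (hB : S.SandwichProperty) (f : 𝓢(PhaseSpace n, ℂ))
    (u : 𝓢'(PhaseSpace n, ℂ)) (g : 𝓢(PhaseSpace n, ℂ)) : 𝓢(PhaseSpace n, ℂ) :=
  (hB f u g).choose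

variable {S} in
/-- Under the sandwich property, the pairing `⟨u # f # v, k⟩ = ⟨u, f # v # k⟩` for `u, v ∈ 𝓢'(Ξ)` and
`f, k ∈ 𝓢(Ξ)`. -/
def SandwichProperty.pairing (hB : S.SandwichProperty) (u : 𝓢'(PhaseSpace n, ℂ))
    (f : 𝓢(PhaseSpace n, ℂ)) (v : 𝓢'(PhaseSpace n, ℂ)) (k : 𝓢(PhaseSpace n, ℂ)) : ℂ :=
  u (hB.sandwich f v k)

variable {S} in
/-- The orthogonality property: with `Θ_Z(f) = e_{-Z} # f # e_Z`,
`∫∫ [Θ_Z(f)](Y) g(Y) dY dZ = ∫ f(Z) dZ ∫ g(Y) dY` for all `f, g ∈ 𝓢(Ξ)`, where the integral over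
`Y` is the pairing `⟨Θ_Z(f), g⟩` of `𝓢'(Ξ)` with `𝓢(Ξ)`. -/
def OrthogonalityProperty (hB : S.SandwichProperty) : Prop :=
  ∀ f g : 𝓢(PhaseSpace n, ℂ),
    ∫ Z, hB.pairing (expDist (-Z)) f (expDist Z) g ∂(phaseMeasure n) =
      (∫ Z, f Z ∂(phaseMeasure n)) * ∫ Y, g Y ∂(phaseMeasure n)

/-! ### The modulation mapping -/

/-- The property that characterizes the map `𝐍` on `𝓢'(Ξ × Ξ)`:
`⟪𝐍(f₁ ⊗ f₂), g₁ ⊗ g₂⟫ = ⟨ĝ₁ # f₁, ĝ₂ # f₂⟩` for all `f₁, f₂, g₁, g₂ ∈ 𝓢(Ξ)`. -/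
def IsNMap (T : 𝓢'(PhaseSpace n × PhaseSpace n, ℂ) →L[ℂ]
    𝓢'(PhaseSpace n × PhaseSpace n, ℂ)) : Prop :=
  ∀ f₁ f₂ g₁ g₂ : 𝓢(PhaseSpace n, ℂ),
    T (SchwartzMap.toTemperedDistributionCLM (PhaseSpace n × PhaseSpace n) ℂ
        ((phaseMeasure n).prod (phaseMeasure n)) (tensor f₁ f₂)) (tensor g₁ g₂) =
      ∫ X, S.mul (symplecticFourier n g₁) f₁ X * S.mul (symplecticFourier n g₂) f₂ X
        ∂(phaseMeasure n)

open Classical in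
/-- The map `𝐍`: the unique continuous linear map of `𝓢'(Ξ × Ξ)` into itself such that
`⟪𝐍(f₁ ⊗ f₂), g₁ ⊗ g₂⟫ = ⟨ĝ₁ # f₁, ĝ₂ # f₂⟩` (and `0` if there were no such map). -/
def nMap : 𝓢'(PhaseSpace n × PhaseSpace n, ℂ) →L[ℂ] 𝓢'(PhaseSpace n × PhaseSpace n, ℂ) :=
  if H : ∃ T, S.IsNMap T then H.choose else 0

end CompositionLaw

/-- The change of variables `C(X, Y) = (-X, X - Y)` of `Ξ × Ξ`. -/
def changeVar (n : ℕ) :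
    (PhaseSpace n × PhaseSpace n) ≃L[ℝ] (PhaseSpace n × PhaseSpace n) :=
  LinearEquiv.toContinuousLinearEquiv
    { toFun := fun p => (-p.1, p.1 - p.2)
      map_add' := fun p q => by ext <;> simp <;> ring
      map_smul' := fun c p => by ext <;> simp [mul_sub]
      invFun := fun p => (-p.1, -p.1 - p.2)
      left_inv := fun p => by ext <;> simp
      right_inv := fun p => by ext <;> simp }

/-- The map `𝐂 F = F ∘ C` on `𝓢'(Ξ × Ξ)`. As `C` preserves the measure,
`⟪𝐂 F, G⟫ = ⟪F, G ∘ C⁻¹⟫`. -/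
def changeVarDist (n : ℕ) :
    𝓢'(PhaseSpace n × PhaseSpace n, ℂ) →L[ℂ] 𝓢'(PhaseSpace n × PhaseSpace n, ℂ) :=
  PointwiseConvergenceCLM.precomp ℂ
    (SchwartzMap.compCLMOfContinuousLinearEquiv ℂ (changeVar n).symm)

namespace CompositionLaw

variable {n : ℕ} (S : CompositionLaw n)

/-- The modulation mapping `𝐌` on `𝓢'(Ξ × Ξ)`: `𝐌(F)` is `𝐍(F)` composed with the change of
variables `C`, so that `[𝐌(f ⊗ g)](X, Y) = ⟨e_{-X} # f, e_{X-Y} # g⟩`. -/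
def modulationMap :
    𝓢'(PhaseSpace n × PhaseSpace n, ℂ) →L[ℂ] 𝓢'(PhaseSpace n × PhaseSpace n, ℂ) :=
  changeVarDist n ∘L S.nMap

/-- The map `𝐌_h : 𝓢'(Ξ) → 𝓢'(Ξ × Ξ)`, `𝐌_h(f) = 𝐌(f ⊗ h)`. -/
def windowedMap (h : 𝓢(PhaseSpace n, ℂ)) :
    𝓢'(PhaseSpace n, ℂ) →L[ℂ] 𝓢'(PhaseSpace n × PhaseSpace n, ℂ) :=
  S.modulationMap ∘L tensorRight h

/-! ### The induced spaces -/

section Induced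

variable {𝔏 : Type*} [NormedAddCommGroup 𝔏] [NormedSpace ℂ 𝔏]

/-- The vector subspace `𝐌_h⁻¹(𝔏)` of `𝓢'(Ξ)`, where `𝔏` is regarded as a subspace of
`𝓢'(Ξ × Ξ)` through `ι`. -/
def inducedSubmodule (h : 𝓢(PhaseSpace n, ℂ))
    (ι : 𝔏 →L[ℂ] 𝓢'(PhaseSpace n × PhaseSpace n, ℂ)) : Submodule ℂ 𝓢'(PhaseSpace n, ℂ) :=
  (LinearMap.range ι.toLinearMap).comap (S.windowedMap h).toLinearMap

/-- The vector space `𝔏^𝐌_h = 𝐌_h⁻¹(𝔏)`, as a type on which we put the induced norm (and not the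
topology of `𝓢'(Ξ)`). -/
def InducedSpace (h : 𝓢(PhaseSpace n, ℂ))
    (ι : 𝔏 →L[ℂ] 𝓢'(PhaseSpace n × PhaseSpace n, ℂ)) : Type :=
  S.inducedSubmodule h ι

variable (h : 𝓢(PhaseSpace n, ℂ)) (ι : 𝔏 →L[ℂ] 𝓢'(PhaseSpace n × PhaseSpace n, ℂ))

instance : AddCommGroup (S.InducedSpace h ι) :=
  inferInstanceAs (AddCommGroup (S.inducedSubmodule h ι))

instance : Module ℂ (S.InducedSpace h ι) :=
  inferInstanceAs (Module ℂ (S.inducedSubmodule h ι))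

variable {S h ι} in
/-- The element of `𝔏` which is `𝐌_h f`, for `f ∈ 𝔏^𝐌_h`. -/
def InducedSpace.image (f : S.InducedSpace h ι) : 𝔏 :=
  Classical.choose (p := fun F : 𝔏 => ι F = S.windowedMap h f.1) f.2

variable {S h ι} in
theorem InducedSpace.image_spec (f : S.InducedSpace h ι) :
    ι f.image = S.windowedMap h f.1 :=
  Classical.choose_spec (p := fun F : 𝔏 => ι F = S.windowedMap h f.1) f.2

/-- The norm `‖f‖ = ‖𝐌_h f‖_𝔏` on `𝔏^𝐌_h`. -/
instance : Norm (S.InducedSpace h ι) where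
  norm f := ‖f.image‖

variable {S h ι} in
theorem InducedSpace.norm_eq (hι : Function.Injective ι) (f : S.InducedSpace h ι) (F : 𝔏)
    (hF : ι F = S.windowedMap h f.1) : ‖f‖ = ‖F‖ := by
  rw [← hι (f.image_spec.trans hF.symm)]
  rfl

end Induced

end CompositionLaw

end AbstractModulation

end

noncomputable section

namespace AbstractModulation

/-! ### Completeness of the Schwartz space -/

section Complete

open Filter Topology

variable {E F : Type*} [NormedAddCommGroup E] [NormedSpace ℝ E] [NormedAddCommGroup F]
  [NormedSpace ℝ F]

/-! Everything follows from one fact: `windowedMap h` has a continuous linear left inverse `R` on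
tempered distributions (`exists_windowedMap_leftInverse`). Injectivity of `𝐌_h` makes the induced
seminorm definite. Moreover `f ↦ 𝐌_h f` is an isometry onto the set of those `F` in `𝔏` with `𝐌_h (R
(ι F)) = ι F`. This set is closed because `ι`, `R` and `𝐌_h` are continuous, so completeness of `𝔏`
passes to the induced space (`isClosed_range_imageHom`).

The left inverse is built factor by factor. The change of variables is invertible, and `f ↦ f ⊗ h`
is undone by pairing the second variable with some `κ` such that `∫ h κ = 1`. The factor that
matters is `𝐍`. It is the transpose of `kernelOp ∘ doubleFourier` (`nMap_eq`), where `kernelOp`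
sends `a ⊗ b` to the integral kernel of `(f, g) ↦ ∫ a # f # b # g`. Both operators are involutions
of the Schwartz space on `Ξ × Ξ`.

That the kernel is a Schwartz function depending continuously on `(a, b)` comes from the sandwich
property and uniform boundedness (`exists_norm_weightedQuad_le`, `exists_weightedQuad_bound`). That
`kernelOp` is an involution comes from the orthogonality property. By Parseval, that property says
`∑ i, ∫ g # e_i # f # e_i = ∫ f * ∫ g` for the Hermite functions `e_i` (`hasSum_quad`). The matrix
of the square of `kernelOp` is a sum of exactly this form, after cyclic rotation under the integral
(`kernelOp_kernel`).

Hermite expansions take the place of abstract kernel theorems. A `RapidBasis` identifies a Schwartz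
space with a space of rapidly decreasing sequences, so a function is constructed from rapidly
decaying coefficients and a continuous operator from polynomially growing values on the basis.
Completeness of the Schwartz space is needed for these series to converge and for the Baire category
arguments. -/

theorem cauchySeq_seminorm {u : ℕ → 𝓢(E, F)} (hu : CauchySeq u) (k m : ℕ) {ε : ℝ} (hε : 0 < ε) :
    ∃ N, ∀ a ≥ N, ∀ b ≥ N, SchwartzMap.seminorm ℝ k m (u a - u b) < ε := by
  have h1 := cauchySeq_iff_tendsto.1 hu
  rw [uniformity_eq_comap_nhds_zero, tendsto_comap_iff] at h1
  have hc : Continuous (SchwartzMap.seminorm ℝ k m : Seminorm ℝ 𝓢(E, F)) :=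
    (schwartz_withSeminorms ℝ E F).continuous_seminorm (k, m)
  have h2 := (hc.tendsto 0).comp h1
  rw [map_zero] at h2
  have h3 := h2.eventually (gt_mem_nhds hε)
  obtain ⟨⟨a₀, b₀⟩, h⟩ := eventually_atTop.1 h3
  exact ⟨max a₀ b₀, fun a ha b hb => h (b, a) ⟨le_trans (le_max_left _ _) hb,
    le_trans (le_max_right _ _) ha⟩⟩

/-- Derivatives of every order converge uniformly, and uniform convergence of derivatives lets
differentiation pass to the limit. The limits therefore form a Taylor series of the order zero
limit. The weighted Cauchy estimates survive pointwise limits, which gives both the decay of the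
limit and convergence in every seminorm. -/
theorem exists_tendsto_of_cauchySeq [CompleteSpace F] {u : ℕ → 𝓢(E, F)} (hu : CauchySeq u) :
    ∃ f, Tendsto u atTop (𝓝 f) := by
  have hsub : ∀ (m a b : ℕ) (x : E), iteratedFDeriv ℝ m (u a - u b) x =
      iteratedFDeriv ℝ m (u a) x - iteratedFDeriv ℝ m (u b) x := fun m a b x =>
    iteratedFDeriv_sub_apply ((u a).smooth m).contDiffAt ((u b).smooth m).contDiffAt
  have hC : ∀ k m, ∀ ε > 0, ∃ N, ∀ a ≥ N, ∀ b ≥ N, ∀ x : E,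
      ‖x‖ ^ k * ‖iteratedFDeriv ℝ m (u a) x - iteratedFDeriv ℝ m (u b) x‖ < ε := by
    intro k m ε hε
    obtain ⟨N, hN⟩ := cauchySeq_seminorm hu k m hε
    refine ⟨N, fun a ha b hb x => lt_of_le_of_lt ?_ (hN a ha b hb)⟩
    rw [← hsub]
    exact (u a - u b).le_seminorm ℝ k m x
  have hU : ∀ m, UniformCauchySeqOn (fun a x => iteratedFDeriv ℝ m (u a) x) atTop Set.univ := by
    intro m
    rw [Metric.uniformCauchySeqOn_iff]
    intro ε hε
    obtain ⟨N, hN⟩ := hC 0 m ε hε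
    refine ⟨N, fun a ha b hb x _ => ?_⟩
    simpa [dist_eq_norm] using hN a ha b hb x
  have hl : ∀ m x, ∃ y, Tendsto (fun a => iteratedFDeriv ℝ m (u a) x) atTop (𝓝 y) := fun m x =>
    cauchySeq_tendsto_of_complete ((hU m).cauchySeq (Set.mem_univ x))
  choose g hg using hl
  have hgU : ∀ m, TendstoUniformly (fun a x => iteratedFDeriv ℝ m (u a) x) (g m) atTop := fun m =>
    tendstoUniformlyOn_univ.1 ((hU m).tendstoUniformlyOn_of_tendsto fun x _ => hg m x)
  have hT : HasFTaylorSeriesUpTo ∞ (fun x => (g 0 x).curry0) (fun x m => g m x) := by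
    refine ⟨fun x => rfl, fun m _ x => ?_, fun m _ => ?_⟩
    · refine hasFDerivAt_of_tendstoUniformly
        (f := fun a x => iteratedFDeriv ℝ m (u a) x)
        (f' := fun a x => (iteratedFDeriv ℝ (m + 1) (u a) x).curryLeft)
        (g' := fun x => (g (m + 1) x).curryLeft) (l := atTop) ?_ (fun a x => ?_) (hg m) x
      · exact (continuousMultilinearCurryLeftEquiv ℝ (fun _ : Fin (m + 1) => E)
          F).isometry.uniformContinuous.comp_tendstoUniformly (hgU (m + 1))
      · have := ((u a).smooth ⊤).ftaylorSeries.fderiv m (by exact_mod_cast ENat.natCast_lt_top m) x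
        exact this
    · exact (hgU m).continuous (Frequently.of_forall fun a =>
        ((u a).smooth m).continuous_iteratedFDeriv le_rfl)
  have hg' : ∀ m x, g m x = iteratedFDeriv ℝ m (fun x => (g 0 x).curry0) x := fun m x =>
    hT.eq_iteratedFDeriv (by exact_mod_cast le_top) x
  have hlim : ∀ k m, ∀ ε > 0, ∃ N, ∀ a ≥ N, ∀ x : E,
      ‖x‖ ^ k * ‖iteratedFDeriv ℝ m (u a) x - g m x‖ ≤ ε := by
    intro k m ε hε
    obtain ⟨N, hN⟩ := hC k m ε hε
    refine ⟨N, fun a ha x => ?_⟩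
    have h1 : Tendsto (fun b => ‖x‖ ^ k * ‖iteratedFDeriv ℝ m (u a) x -
        iteratedFDeriv ℝ m (u b) x‖) atTop
        (𝓝 (‖x‖ ^ k * ‖iteratedFDeriv ℝ m (u a) x - g m x‖)) :=
      ((tendsto_const_nhds.sub (hg m x)).norm).const_mul _
    exact le_of_tendsto h1 (eventually_atTop.2 ⟨N, fun b hb => (hN a ha b hb x).le⟩)
  let f : 𝓢(E, F) :=
    { toFun := fun x => (g 0 x).curry0
      smooth' := hT.contDiff
      decay' := by
        intro k m
        obtain ⟨N, hN⟩ := hlim k m 1 one_pos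
        refine ⟨SchwartzMap.seminorm ℝ k m (u N) + 1, fun x => ?_⟩
        rw [← hg' m x]
        have h1 := hN N le_rfl x
        have h2 := (u N).le_seminorm ℝ k m x
        have h3 : ‖g m x‖ ≤ ‖iteratedFDeriv ℝ m (u N) x‖ +
            ‖iteratedFDeriv ℝ m (u N) x - g m x‖ := by
          rw [norm_sub_rev]
          exact norm_le_norm_add_norm_sub' _ _
        have h4 := mul_le_mul_of_nonneg_left h3 (by positivity : 0 ≤ ‖x‖ ^ k)
        rw [mul_add] at h4
        linarith }
  refine ⟨f, ?_⟩
  rw [(schwartz_withSeminorms ℝ E F).tendsto_nhds_atTop]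
  rintro ⟨k, m⟩ ε hε
  -- Passing to the limit leaves only a weak inequality; halving `ε` restores the strict one.
  obtain ⟨N, hN⟩ := hlim k m (ε / 2) (by positivity)
  refine ⟨N, fun a ha => lt_of_le_of_lt ?_ (half_lt_self hε)⟩
  refine SchwartzMap.seminorm_le_bound ℝ k m _ (by positivity) fun x => ?_
  have h1 : iteratedFDeriv ℝ m (u a - f) x = iteratedFDeriv ℝ m (u a) x - g m x := by
    rw [hg' m x]
    exact iteratedFDeriv_sub_apply ((u a).smooth m).contDiffAt (f.smooth m).contDiffAt
  rw [h1]
  exact hN a ha x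

instance schwartz_isCountablyGenerated_uniformity :
    (uniformity 𝓢(E, F)).IsCountablyGenerated :=
  IsUniformAddGroup.uniformity_countably_generated

/-- Sequences suffice because countably many seminorms generate the uniformity. The same two facts
make the space Baire, hence barrelled. -/
instance schwartz_completeSpace [CompleteSpace F] : CompleteSpace 𝓢(E, F) :=
  UniformSpace.complete_of_cauchySeq_tendsto fun _ hu => exists_tendsto_of_cauchySeq hu

end Complete

/-! ### Bases of rapidly decreasing expansions -/

section RapidBasis

variable {E E' : Type*} [NormedAddCommGroup E] [NormedSpace ℝ E] [NormedAddCommGroup E']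
  [NormedSpace ℝ E']

theorem continuous_schwartzSeminorm (k m : ℕ) :
    Continuous (SchwartzMap.seminorm ℂ k m : Seminorm ℂ 𝓢(E, ℂ)) :=
  (schwartz_withSeminorms ℂ E ℂ).continuous_seminorm (k, m)

theorem continuous_finsetSup (s : Finset (ℕ × ℕ)) :
    Continuous (s.sup (schwartzSeminormFamily ℂ E ℂ) : Seminorm ℂ 𝓢(E, ℂ)) := by
  induction s using Finset.induction_on with
  | empty => rw [Finset.sup_empty]; exact continuous_const
  | insert a s _ ih =>
    rw [Finset.sup_insert]
    exact (continuous_schwartzSeminorm a.1 a.2).sup ih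

theorem continuous_of_seminorm_comp (T : 𝓢(E, ℂ) →ₗ[ℂ] 𝓢(E', ℂ))
    (h : ∀ p : Seminorm ℂ 𝓢(E', ℂ), Continuous p →
      ∃ q : Seminorm ℂ 𝓢(E, ℂ), Continuous q ∧ ∀ v, p (T v) ≤ q v) : Continuous T := by
  refine ((schwartz_withSeminorms ℂ E' ℂ).continuous_iff_continuous_comp T).2 fun i => ?_
  obtain ⟨q, hq, hle⟩ := h _ ((schwartz_withSeminorms ℂ E' ℂ).continuous_seminorm i)
  exact Seminorm.continuous_of_le hq hle

/-- Cauchy criterion: tails are small in any finite supremum of seminorms, and completeness then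
yields a sum. -/
theorem summable_of_summable_seminorm {J : Type*} {f : J → 𝓢(E, ℂ)}
    (h : ∀ p : Seminorm ℂ 𝓢(E, ℂ), Continuous p → Summable fun j => p (f j)) : Summable f := by
  rw [summable_iff_vanishing]
  intro U hU
  obtain ⟨⟨s, r⟩, hr, hsub⟩ := (schwartz_withSeminorms ℂ E ℂ).hasBasis_zero_ball.mem_iff.1 hU
  have h1 := h _ (continuous_finsetSup s)
  obtain ⟨t, ht⟩ := summable_iff_vanishing.1 h1 (Metric.ball 0 r) (Metric.ball_mem_nhds 0 hr)
  refine ⟨t, fun t' ht' => hsub ?_⟩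
  rw [Seminorm.mem_ball_zero]
  have h2 := ht t' ht'
  rw [mem_ball_zero_iff] at h2
  exact (Finset.le_sum_of_subadditive _ (map_zero _).le (map_add_le_add _) _ _).trans_lt
    ((le_abs_self _).trans_lt h2)

theorem seminorm_tsum_le {J : Type*} {f : J → 𝓢(E, ℂ)} {p : Seminorm ℂ 𝓢(E, ℂ)}
    (hp : Continuous p) (hf : Summable f) (hpf : Summable fun j => p (f j)) :
    p (∑' j, f j) ≤ ∑' j, p (f j) := by
  refine le_of_tendsto ((hp.tendsto _).comp hf.hasSum) (Filter.Eventually.of_forall fun s => ?_)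
  exact (Finset.le_sum_of_subadditive _ (map_zero _).le (map_add_le_add _) _ _).trans
    (hpf.sum_le_tsum _ fun j _ => apply_nonneg p _)

/-- A family `e` of Schwartz functions with biorthogonal functionals `coeff` and a weight `wt`,
which identifies the Schwartz space with the space of sequences decreasing faster than every power
of the weight. -/
structure RapidBasis (E : Type*) [NormedAddCommGroup E] [NormedSpace ℝ E] (J : Type*) where
  e : J → 𝓢(E, ℂ)
  coeff : J → 𝓢(E, ℂ) →L[ℂ] ℂ
  wt : J → ℝ
  one_le_wt : ∀ j, 1 ≤ wt j
  -- This is what lets a supremum bound on weighted coefficients control sums, at the cost of `D`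
  -- extra powers of the weight.
  exists_summable : ∃ D : ℕ, Summable fun j => (wt j ^ D)⁻¹
  coeff_self : ∀ j, coeff j (e j) = 1
  coeff_ne : ∀ i j, i ≠ j → coeff i (e j) = 0
  total : ∀ v, (∀ j, coeff j v = 0) → v = 0
  decay : ∀ N : ℕ, ∃ p : Seminorm ℂ 𝓢(E, ℂ), Continuous p ∧ ∀ j v, wt j ^ N * ‖coeff j v‖ ≤ p v
  growth : ∀ p : Seminorm ℂ 𝓢(E, ℂ), Continuous p →
    ∃ (C : ℝ) (M : ℕ), 0 ≤ C ∧ ∀ j, p (e j) ≤ C * wt j ^ M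

namespace RapidBasis

variable {J : Type*} (B : RapidBasis E J)

theorem wt_pos (j : J) : 0 < B.wt j := one_pos.trans_le (B.one_le_wt j)

/-- Of the `M + D` powers of the weight available in the coefficients, `M` absorb the growth of `f`
and `D` make the series converge. The exponent and constant do not depend on the coefficients, and
this uniformity later gives continuity of maps defined by series. -/
theorem exists_summable_seminorm {f : J → 𝓢(E', ℂ)} {p : Seminorm ℂ 𝓢(E', ℂ)} {C : ℝ} {M : ℕ}
    (hf : ∀ j, p (f j) ≤ C * B.wt j ^ M) :
    ∃ (N : ℕ) (K : ℝ), 0 ≤ K ∧ ∀ (a : J → ℂ) (A : ℝ), (∀ j, B.wt j ^ N * ‖a j‖ ≤ A) →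
      (Summable fun j => p (a j • f j)) ∧ ∑' j, p (a j • f j) ≤ K * A := by
  obtain ⟨D, hD⟩ := B.exists_summable
  refine ⟨M + D, |C| * ∑' j, (B.wt j ^ D)⁻¹, mul_nonneg (abs_nonneg C)
    (tsum_nonneg fun j => inv_nonneg.2 (pow_nonneg (B.wt_pos j).le _)), fun a A ha => ?_⟩
  have h1 : ∀ j, p (a j • f j) ≤ |C| * A * (B.wt j ^ D)⁻¹ := by
    intro j
    have hw := B.wt_pos j
    rw [map_smul_eq_mul, ← div_eq_mul_inv, le_div_iff₀ (by positivity)]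
    calc ‖a j‖ * p (f j) * B.wt j ^ D ≤ ‖a j‖ * (|C| * B.wt j ^ M) * B.wt j ^ D := by
          gcongr
          exact (hf j).trans (by gcongr; exact le_abs_self C)
      _ = |C| * (B.wt j ^ (M + D) * ‖a j‖) := by rw [pow_add]; ring
      _ ≤ |C| * A := by gcongr; exact ha j
  have h2 := hD.mul_left (|C| * A)
  have h3 : Summable fun j => p (a j • f j) :=
    Summable.of_nonneg_of_le (fun j => apply_nonneg p _) h1 h2
  refine ⟨h3, (h3.tsum_le_tsum h1 h2).trans (le_of_eq ?_)⟩
  rw [tsum_mul_left]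
  ring

/-- Polynomial growth of a family of Schwartz functions, with respect to all continuous
seminorms. -/
def PolyGrowth (f : J → 𝓢(E', ℂ)) : Prop :=
  ∀ p : Seminorm ℂ 𝓢(E', ℂ), Continuous p → ∃ (C : ℝ) (M : ℕ), 0 ≤ C ∧ ∀ j, p (f j) ≤ C * B.wt j ^ M

/-- Rapid decrease of a family of scalars. -/
def RapidDecay (a : J → ℂ) : Prop := ∀ N : ℕ, ∃ A : ℝ, ∀ j, B.wt j ^ N * ‖a j‖ ≤ A

theorem rapidDecay_coeff (v : 𝓢(E, ℂ)) : B.RapidDecay fun j => B.coeff j v := fun N =>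
  let ⟨p, _, hp⟩ := B.decay N
  ⟨p v, fun j => hp j v⟩

variable {B} in
theorem summable_seminorm_smul {a : J → ℂ} (ha : B.RapidDecay a) {f : J → 𝓢(E', ℂ)}
    (hf : B.PolyGrowth f) {p : Seminorm ℂ 𝓢(E', ℂ)} (hp : Continuous p) :
    Summable fun j => p (a j • f j) := by
  obtain ⟨C, M, -, hCM⟩ := hf p hp
  obtain ⟨N, K, -, h⟩ := B.exists_summable_seminorm hCM
  obtain ⟨A, hA⟩ := ha N
  exact (h a A hA).1

variable {B} in
theorem summable_smul {a : J → ℂ} (ha : B.RapidDecay a) {f : J → 𝓢(E', ℂ)}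
    (hf : B.PolyGrowth f) : Summable fun j => a j • f j :=
  summable_of_summable_seminorm fun _ hp => summable_seminorm_smul ha hf hp

theorem coeff_tsum {a : J → ℂ} (h : Summable fun j => a j • B.e j) (i : J) :
    B.coeff i (∑' j, a j • B.e j) = a i := by
  rw [(B.coeff i).map_tsum h, tsum_eq_single i]
  · rw [map_smul, B.coeff_self, smul_eq_mul, mul_one]
  · intro j hj
    rw [map_smul, B.coeff_ne i j hj.symm, smul_zero]

theorem ext {v w : 𝓢(E, ℂ)} (h : ∀ j, B.coeff j v = B.coeff j w) : v = w :=
  sub_eq_zero.1 <| B.total _ fun j => by rw [map_sub, h, sub_self]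

/-- Decay against growth makes the expansion converge to something; biorthogonality shows that it
has the coefficients of `v`, and totality identifies it with `v`. -/
theorem hasSum (v : 𝓢(E, ℂ)) : HasSum (fun j => B.coeff j v • B.e j) v := by
  have h := summable_smul (B.rapidDecay_coeff v) B.growth
  have h1 : ∑' j, B.coeff j v • B.e j = v := B.ext fun j => B.coeff_tsum h j
  have h2 := h.hasSum
  rwa [h1] at h2

variable {B} in
theorem exists_of_rapidDecay {a : J → ℂ} (ha : B.RapidDecay a) : ∃ v, ∀ j, B.coeff j v = a j :=
  ⟨_, B.coeff_tsum (summable_smul ha B.growth)⟩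

theorem hom_ext {W : Type*} [AddCommGroup W] [Module ℂ W] [TopologicalSpace W] [T2Space W]
    {T₁ T₂ : 𝓢(E, ℂ) →L[ℂ] W} (h : ∀ j, T₁ (B.e j) = T₂ (B.e j)) : T₁ = T₂ := by
  ext1 v
  have h1 := (B.hasSum v).mapL T₁
  have h2 := (B.hasSum v).mapL T₂
  simp only [map_smul, h] at h1 h2
  exact h1.unique h2

/-- Converse to `decay`: together they say that weighted suprema of coefficients define the
topology. -/
theorem seminorm_le_of_coeff {p : Seminorm ℂ 𝓢(E, ℂ)} (hp : Continuous p) :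
    ∃ (N : ℕ) (K : ℝ), 0 ≤ K ∧ ∀ (v : 𝓢(E, ℂ)) (A : ℝ),
      (∀ j, B.wt j ^ N * ‖B.coeff j v‖ ≤ A) → p v ≤ K * A := by
  obtain ⟨C, M, -, hCM⟩ := B.growth p hp
  obtain ⟨N, K, hK, h⟩ := B.exists_summable_seminorm hCM
  refine ⟨N, K, hK, fun v A hA => ?_⟩
  obtain ⟨h1, h2⟩ := h _ A hA
  have h3 := seminorm_tsum_le hp (B.hasSum v).summable h1
  rw [(B.hasSum v).tsum_eq] at h3
  exact h3.trans h2

variable {B} in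
-- Extend by linearity and infinite sums. Polynomial growth of the prescribed values is the only
-- obstruction, which is how operators on `𝓢(Ξ × Ξ)` will be produced.
theorem exists_extension {f : J → 𝓢(E', ℂ)} (hf : B.PolyGrowth f) :
    ∃ T : 𝓢(E, ℂ) →L[ℂ] 𝓢(E', ℂ), ∀ j, T (B.e j) = f j := by
  have hs : ∀ v, Summable fun j => B.coeff j v • f j := fun v =>
    summable_smul (B.rapidDecay_coeff v) hf
  let T : 𝓢(E, ℂ) →ₗ[ℂ] 𝓢(E', ℂ) :=
    { toFun := fun v => ∑' j, B.coeff j v • f j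
      map_add' := fun v w => by
        rw [← (hs v).tsum_add (hs w)]
        exact tsum_congr fun j => by rw [map_add, add_smul]
      map_smul' := fun c v => by
        rw [RingHom.id_apply, ← (hs v).tsum_const_smul]
        exact tsum_congr fun j => by rw [map_smul, smul_eq_mul, mul_smul] }
  have hT : Continuous T := by
    refine continuous_of_seminorm_comp T fun p hp => ?_
    obtain ⟨C, M, -, hCM⟩ := hf p hp
    obtain ⟨N, K, hK, h⟩ := B.exists_summable_seminorm hCM
    obtain ⟨q, hq, hqle⟩ := B.decay N
    refine ⟨K.toNNReal • q, ?_, fun v => ?_⟩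
    · exact hq.const_smul _
    · obtain ⟨h1, h2⟩ := h (fun j => B.coeff j v) (q v) fun j => hqle j v
      have h3 : (K.toNNReal • q) v = K * q v := by
        rw [smul_apply, NNReal.smul_def, Real.coe_toNNReal K hK, smul_eq_mul]
      rw [h3]
      exact (seminorm_tsum_le hp (hs v) h1).trans h2
  refine ⟨⟨T, hT⟩, fun i => ?_⟩
  change ∑' j, B.coeff j (B.e i) • f j = f i
  rw [tsum_eq_single i]
  · rw [B.coeff_self, one_smul]
  · intro j hj
    rw [B.coeff_ne j i hj, zero_smul]

end RapidBasis

end RapidBasis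

/-! ### The Gaussian -/

section Gaussian

variable {E : Type} [NormedAddCommGroup E] [InnerProductSpace ℝ E]

theorem hasTemperateGrowth_fderiv {V : Type} [NormedAddCommGroup V] [NormedSpace ℝ V] {g : E → V}
    (hg : g.HasTemperateGrowth) : (fderiv ℝ g).HasTemperateGrowth := by
  refine ⟨hg.1.fderiv_right (by simp), fun m => ?_⟩
  obtain ⟨k, C, h⟩ := hg.2 (m + 1)
  exact ⟨k, C, fun x => by rw [norm_iteratedFDeriv_fderiv]; exact h x⟩

/-- The exponential series bounds `(1 + t) ^ N` by `N! * exp (1 + t)`, and `1 + t - t ^ 2 / 2 = 3 /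
2 - (t - 1) ^ 2 / 2` stays below `2`. -/
theorem one_add_pow_mul_exp_le (N : ℕ) {t : ℝ} (ht : 0 ≤ t) :
    (1 + t) ^ N * Real.exp (-(t ^ 2 / 2)) ≤ N.factorial * Real.exp 2 := by
  have h1 := Real.pow_div_factorial_le_exp (x := 1 + t) (by positivity) N
  rw [div_le_iff₀ (by positivity)] at h1
  calc (1 + t) ^ N * Real.exp (-(t ^ 2 / 2))
      ≤ Real.exp (1 + t) * N.factorial * Real.exp (-(t ^ 2 / 2)) := by gcongr
    _ = N.factorial * Real.exp (1 + t + -(t ^ 2 / 2)) := by rw [Real.exp_add (1 + t)]; ring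
    _ ≤ _ := by
      gcongr
      nlinarith [sq_nonneg (t - 1)]

theorem hasFDerivAt_exp_neg_norm_sq (x : E) :
    HasFDerivAt (fun x : E => Real.exp (-(‖x‖ ^ 2 / 2)))
      (-(Real.exp (-(‖x‖ ^ 2 / 2)) • innerSL ℝ x)) x := by
  have h1 := ((hasStrictFDerivAt_norm_sq x).hasFDerivAt.const_mul (1 / 2 : ℝ)).neg.exp
  convert h1 using 1
  · ext y; simp; ring_nf
  · ext y
    have h2 : (2 : ℝ)⁻¹ * ‖x‖ ^ 2 = ‖x‖ ^ 2 / 2 := by ring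
    simp [h2]

theorem contDiff_exp_neg_norm_sq : ContDiff ℝ ∞ fun x : E => Real.exp (-(‖x‖ ^ 2 / 2)) :=
  (((contDiff_norm_sq ℝ).div_const 2).neg).exp

/-- Differentiating Gaussian times `g` gives Gaussian times `Dg - x ⊗ g`, again of temperate growth
but with values in a larger space. Hence the induction on `m` must quantify over all `V` and all
`g`. -/
theorem exp_neg_norm_sq_smul_decay (k m : ℕ) : ∀ {V : Type} [NormedAddCommGroup V]
    [NormedSpace ℝ V] (g : E → V), g.HasTemperateGrowth → ∃ C : ℝ, ∀ x,
      ‖x‖ ^ k * ‖iteratedFDeriv ℝ m (fun x => Real.exp (-(‖x‖ ^ 2 / 2)) • g x) x‖ ≤ C := by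
  induction m with
  | zero =>
    intro V _ _ g hg
    obtain ⟨l, C, h⟩ := hg.2 0
    refine ⟨|C| * ((k + l).factorial * Real.exp 2), fun x => ?_⟩
    have h1 := h x
    rw [norm_iteratedFDeriv_zero] at h1 ⊢
    rw [norm_smul, Real.norm_of_nonneg (Real.exp_nonneg _)]
    have hx := norm_nonneg x
    calc ‖x‖ ^ k * (Real.exp (-(‖x‖ ^ 2 / 2)) * ‖g x‖)
        ≤ (1 + ‖x‖) ^ k * (Real.exp (-(‖x‖ ^ 2 / 2)) * (|C| * (1 + ‖x‖) ^ l)) := by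
          gcongr
          · linarith
          · exact h1.trans (by gcongr; exact le_abs_self C)
      _ = |C| * ((1 + ‖x‖) ^ (k + l) * Real.exp (-(‖x‖ ^ 2 / 2))) := by rw [pow_add]; ring
      _ ≤ _ := mul_le_mul_of_nonneg_left (one_add_pow_mul_exp_le _ hx) (abs_nonneg C)
  | succ m ih =>
    intro V _ _ g hg
    have hg1 : (fun x => fderiv ℝ g x -
        ContinuousLinearMap.smulRightL ℝ E V (innerSL ℝ x) (g x)).HasTemperateGrowth := by
      refine (hasTemperateGrowth_fderiv hg).sub ?_
      exact (ContinuousLinearMap.smulRightL ℝ E V).bilinear_hasTemperateGrowth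
        (innerSL ℝ).hasTemperateGrowth hg
    obtain ⟨C, hC⟩ := ih _ hg1
    refine ⟨C, fun x => ?_⟩
    rw [← norm_iteratedFDeriv_fderiv]
    convert hC x using 4
    ext1 x
    have h1 := (hasFDerivAt_exp_neg_norm_sq x).smul
      ((hg.1.differentiable (by simp)) x).hasFDerivAt
    refine h1.fderiv.trans ?_
    ext y
    simp [smul_sub, smul_smul]
    abel

/-- The Gaussian `exp (-‖x‖² / 2)`. -/
def gaussian (E : Type) [NormedAddCommGroup E] [InnerProductSpace ℝ E] : 𝓢(E, ℂ) where
  toFun x := Real.exp (-(‖x‖ ^ 2 / 2)) • (1 : ℂ)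
  smooth' := contDiff_exp_neg_norm_sq.smul contDiff_const
  decay' k m := exp_neg_norm_sq_smul_decay k m _ (Function.HasTemperateGrowth.const 1)

theorem gaussian_apply (x : E) : gaussian E x = (Real.exp (-(‖x‖ ^ 2 / 2)) : ℂ) := by
  change Real.exp (-(‖x‖ ^ 2 / 2)) • (1 : ℂ) = _
  rw [Complex.real_smul, mul_one]

theorem hasFDerivAt_gaussian (x : E) : HasFDerivAt (gaussian E)
    ((-(Real.exp (-(‖x‖ ^ 2 / 2)) • innerSL ℝ x)).smulRight (1 : ℂ)) x :=
  (hasFDerivAt_exp_neg_norm_sq x).smul_const (1 : ℂ)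

end Gaussian

/-! ### Ladder operators -/

section Ladder

variable {ι V : Type*} [DecidableEq ι] [AddCommGroup V] [Module ℂ V]

/-- Commuting raising operators and a vacuum vector, with lowering operators satisfying the
canonical commutation relations. -/
structure LadderSystem (ι V : Type*) [DecidableEq ι] [AddCommGroup V] [Module ℂ V] where
  raise : ι → Module.End ℂ V
  lower : ι → Module.End ℂ V
  vac : V
  commute : ∀ i k, Commute (raise i) (raise k)
  -- The factor `2` is the commutator of `x + ∂` with `x - ∂`.
  lower_raise : ∀ i k v, lower i (raise k v) = raise k (lower i v) + if i = k then (2 : ℂ) • v else 0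
  lower_vac : ∀ i, lower i vac = 0

namespace LadderSystem

variable (L : LadderSystem ι V)

theorem pairwise_commute : Pairwise fun i k => ∀ x y : Multiplicative ℕ,
    Commute (powersHom _ (L.raise i) x) (powersHom _ (L.raise k) y) := fun i k _ x y => by
  simp only [powersHom_apply]
  exact (L.commute i k).pow_pow _ _

variable [Fintype ι]

/-- The product of powers of the raising operators as a homomorphism on multi-indices. -/
def raiseHom : (ι → Multiplicative ℕ) →* Module.End ℂ V :=
  MonoidHom.noncommPiCoprod (fun i => powersHom _ (L.raise i)) L.pairwise_commute

/-- The state with occupation numbers `j`, not normalized. -/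
def state (j : ι → ℕ) : V := L.raiseHom (fun i => Multiplicative.ofAdd (j i)) L.vac

theorem state_zero : L.state 0 = L.vac := by
  have : (fun i : ι => Multiplicative.ofAdd ((0 : ι → ℕ) i)) = 1 := rfl
  rw [state, this, map_one, Module.End.one_apply]

theorem state_add_single (j : ι → ℕ) (i : ι) :
    L.state (j + Pi.single i 1) = L.raise i (L.state j) := by
  have h : (fun k => Multiplicative.ofAdd ((j + Pi.single i 1 : ι → ℕ) k)) =
      Pi.mulSingle i (Multiplicative.ofAdd 1) * fun k => Multiplicative.ofAdd (j k) := by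
    ext k
    by_cases hk : k = i
    · subst hk; simp [add_comm]
    · simp [hk]
  have h2 : L.raiseHom (Pi.mulSingle i (Multiplicative.ofAdd 1)) = L.raise i := by
    refine (MonoidHom.noncommPiCoprod_mulSingle _ i _).trans ?_
    simp
  rw [state, h, map_mul, Module.End.mul_apply, h2, state]

theorem induction_multiIndex {P : (ι → ℕ) → Prop} (h0 : P 0)
    (h1 : ∀ j i, P j → P (j + Pi.single i 1)) (j : ι → ℕ) : P j := by
  induction hn : ∑ i, j i generalizing j with
  | zero =>
    have : j = 0 := funext fun i => by simpa using (Finset.sum_eq_zero_iff.1 hn) i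
    rw [this]; exact h0
  | succ s ih =>
    obtain ⟨i, -, hi⟩ : ∃ i ∈ Finset.univ, j i ≠ 0 := by
      by_contra! h
      rw [Finset.sum_eq_zero h] at hn
      omega
    have hj : j = (j - Pi.single i 1) + Pi.single i 1 := by
      ext k
      by_cases hk : k = i
      · subst hk; simp; omega
      · simp [hk]
    rw [hj] at hn ⊢
    refine h1 _ _ (ih _ ?_)
    simp only [Pi.add_apply, Finset.sum_add_distrib] at hn
    have : ∑ k, (Pi.single i 1 : ι → ℕ) k = 1 := by simp
    omega

theorem lower_state (j : ι → ℕ) (i : ι) :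
    L.lower i (L.state (j + Pi.single i 1)) = (2 * (j i + 1) : ℂ) • L.state j ∧
      (j i = 0 → L.lower i (L.state j) = 0) := by
  -- The occupation operator has eigenvalue `2 * j i`. Adding a quantum in direction `i` raises it
  -- by `2`; adding one in another direction leaves it unchanged because the raising operators
  -- commute. Annihilation at `j i = 0` is carried through the same induction.
  have key : ∀ j : ι → ℕ, L.raise i (L.lower i (L.state j)) = (2 * j i : ℂ) • L.state j ∧
      (j i = 0 → L.lower i (L.state j) = 0) := by
    intro j
    induction j using induction_multiIndex with
    | h0 => simp [state_zero, lower_vac]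
    | h1 j k ih =>
      rw [state_add_single, lower_raise]
      by_cases hk : i = k
      · subst hk
        simp only [if_true, ih.1, Pi.add_apply, Pi.single_eq_same, map_add, map_smul]
        refine ⟨?_, by omega⟩
        rw [← add_smul]
        push_cast
        ring_nf
      · simp only [hk, if_false, add_zero]
        have hc : L.raise i (L.raise k (L.lower i (L.state j))) =
            L.raise k (L.raise i (L.lower i (L.state j))) :=
          congrArg (fun T : Module.End ℂ V => T (L.lower i (L.state j))) (L.commute i k)
        refine ⟨?_, fun h => ?_⟩
        · rw [hc, ih.1, map_smul]
          simp [hk]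
        · rw [ih.2 (by simpa [hk] using h), map_zero]
  refine ⟨?_, (key j).2⟩
  rw [state_add_single, lower_raise, (key j).1, if_pos rfl, ← add_smul]
  ring_nf

theorem raise_lower_state (j : ι → ℕ) (i : ι) :
    L.raise i (L.lower i (L.state j)) = (2 * j i : ℂ) • L.state j := by
  rcases Nat.eq_zero_or_pos (j i) with h | h
  · rw [(L.lower_state j i).2 h, h]; simp
  · have hj : j = (j - Pi.single i 1) + Pi.single i 1 := by
      ext k
      by_cases hk : k = i
      · subst hk; simp; omega
      · simp [hk]
    rw [hj, (L.lower_state _ i).1, map_smul, ← state_add_single]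
    congr 2
    simp

end LadderSystem

end Ladder

/-! ### The harmonic oscillator on the Schwartz space -/

section Oscillator

open LineDeriv

variable {E : Type} [NormedAddCommGroup E] [InnerProductSpace ℝ E] [FiniteDimensional ℝ E]
  [MeasurableSpace E] [BorelSpace E] {ι : Type} [Fintype ι] [DecidableEq ι]

/-- Multiplication by the linear function `⟨v, ·⟩`. -/
def posOp (v : E) : 𝓢(E, ℂ) →L[ℂ] 𝓢(E, ℂ) :=
  SchwartzMap.smulLeftCLM ℂ fun x => ((inner ℝ v x : ℝ) : ℂ)

/-- The derivative in the direction `v`. -/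
def derOp (v : E) : 𝓢(E, ℂ) →L[ℂ] 𝓢(E, ℂ) := lineDerivOpCLM ℂ 𝓢(E, ℂ) v

omit [FiniteDimensional ℝ E] [MeasurableSpace E] [BorelSpace E] in
@[simp] theorem posOp_apply (v : E) (f : 𝓢(E, ℂ)) (x : E) :
    posOp v f x = (inner ℝ v x : ℝ) * f x := by
  rw [posOp, SchwartzMap.smulLeftCLM_apply_apply (by fun_prop), smul_eq_mul]

omit [FiniteDimensional ℝ E] [MeasurableSpace E] [BorelSpace E] in
theorem derOp_apply (v : E) (f : 𝓢(E, ℂ)) (x : E) : derOp v f x = fderiv ℝ f x v := rfl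

omit [FiniteDimensional ℝ E] [MeasurableSpace E] [BorelSpace E] in
theorem posOp_comm (v w : E) (f : 𝓢(E, ℂ)) : posOp v (posOp w f) = posOp w (posOp v f) := by
  ext x
  simp only [posOp_apply]
  ring

omit [FiniteDimensional ℝ E] [MeasurableSpace E] [BorelSpace E] in
theorem derOp_posOp (v w : E) (f : 𝓢(E, ℂ)) :
    derOp v (posOp w f) = posOp w (derOp v f) + ((inner ℝ w v : ℝ) : ℂ) • f := by
  ext x
  have h1 : HasFDerivAt (fun x : E => ((inner ℝ w x : ℝ) : ℂ))
      (Complex.ofRealCLM.comp (innerSL ℝ w)) x :=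
    (Complex.ofRealCLM.comp (innerSL ℝ w)).hasFDerivAt
  have h2 := h1.mul (f.hasFDerivAt x)
  have h3 : (posOp w f : E → ℂ) = (fun x : E => ((inner ℝ w x : ℝ) : ℂ)) * f := by
    ext y; simp
  rw [derOp_apply, h3, h2.fderiv]
  simp [derOp_apply, mul_comm]

/-- Directional derivatives are Fourier multipliers, whose composition multiplies symbols. -/
theorem derOp_comm (v w : E) (f : 𝓢(E, ℂ)) : derOp v (derOp w f) = derOp w (derOp v f) := by
  simp only [derOp, lineDerivOpCLM_apply, SchwartzMap.lineDeriv_eq_fourierMultiplierCLM, map_smul]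
  rw [SchwartzMap.fourierMultiplierCLM_fourierMultiplierCLM_apply (by fun_prop) (by fun_prop),
    SchwartzMap.fourierMultiplierCLM_fourierMultiplierCLM_apply (by fun_prop) (by fun_prop),
    mul_comm (fun x : E => inner ℝ x v)]

theorem integral_derOp_mul (μ : Measure E) [μ.IsAddHaarMeasure] (v : E) (f g : 𝓢(E, ℂ)) :
    ∫ x, derOp v f x * g x ∂μ = -∫ x, f x * derOp v g x ∂μ := by
  have := SchwartzMap.integral_mul_lineDerivOp_right_eq_neg_left (μ := μ) f g v
  rw [eq_neg_iff_add_eq_zero, add_comm, ← eq_neg_iff_add_eq_zero]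
  exact this

omit [FiniteDimensional ℝ E] [BorelSpace E] in
theorem integral_posOp_mul (μ : Measure E) (v : E) (f g : 𝓢(E, ℂ)) :
    ∫ x, posOp v f x * g x ∂μ = ∫ x, f x * posOp v g x ∂μ := by
  congr 1
  ext x
  simp only [posOp_apply]
  ring

theorem integrable_mul (μ : Measure E) [μ.IsAddHaarMeasure] (f g : 𝓢(E, ℂ)) :
    Integrable (fun x => f x * g x) μ := by
  have := (SchwartzMap.pairing (ContinuousLinearMap.mul ℂ ℂ) f g).integrable (μ := μ)
  exact this

/-- The functional `f ↦ ∫ f g` on the Schwartz space. -/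
def integralMul (μ : Measure E) [μ.IsAddHaarMeasure] (g : 𝓢(E, ℂ)) : 𝓢(E, ℂ) →L[ℂ] ℂ :=
  SchwartzMap.integralCLM ℂ μ ∘L SchwartzMap.pairing (ContinuousLinearMap.mul ℂ ℂ) g

theorem integralMul_apply (μ : Measure E) [μ.IsAddHaarMeasure] (f g : 𝓢(E, ℂ)) :
    integralMul μ g f = ∫ x, f x * g x ∂μ := by
  change ∫ x, g x * f x ∂μ = _
  simp only [mul_comm]

theorem integralMul_comm (μ : Measure E) [μ.IsAddHaarMeasure] (f g : 𝓢(E, ℂ)) :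
    integralMul μ g f = integralMul μ f g := by
  simp only [integralMul_apply, mul_comm]

theorem integralMul_smul (μ : Measure E) [μ.IsAddHaarMeasure] (c : ℂ) (f g : 𝓢(E, ℂ)) :
    integralMul μ (c • g) f = c * integralMul μ g f := by
  rw [integralMul_comm, map_smul, integralMul_comm, smul_eq_mul]

omit [FiniteDimensional ℝ E] [MeasurableSpace E] [BorelSpace E] in
theorem derOp_gaussian (v : E) : derOp v (gaussian E) = -posOp v (gaussian E) := by
  ext x
  rw [derOp_apply, (hasFDerivAt_gaussian x).fderiv]
  simp [gaussian_apply, real_inner_comm, mul_comm]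

variable (b : OrthonormalBasis ι ℝ E)

/-- The ladder system of the harmonic oscillator: `x_i ∓ ∂_i` and the Gaussian. -/
def oscillator : LadderSystem ι 𝓢(E, ℂ) where
  raise i := (posOp (b i) - derOp (b i) : 𝓢(E, ℂ) →L[ℂ] 𝓢(E, ℂ)).toLinearMap
  lower i := (posOp (b i) + derOp (b i) : 𝓢(E, ℂ) →L[ℂ] 𝓢(E, ℂ)).toLinearMap
  vac := gaussian E
  commute i k := by
    ext1 f
    simp only [Module.End.mul_apply, ContinuousLinearMap.coe_coe, sub_apply, map_sub, posOp_comm (b i),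
      derOp_comm (b i), derOp_posOp, real_inner_comm (b i)]
    abel
  lower_raise i k f := by
    simp only [ContinuousLinearMap.coe_coe, sub_apply, add_apply, map_sub, map_add,
      posOp_comm (b i), derOp_comm (b i), derOp_posOp, real_inner_comm (b i),
      b.inner_eq_ite]
    by_cases h : i = k
    · simp only [h, if_true, Complex.ofReal_one, one_smul, two_smul]
      abel
    · simp only [h, if_false, Complex.ofReal_zero, zero_smul]
      abel
  lower_vac i := by simp [derOp_gaussian]

/-- The unnormalized Hermite functions. -/
def hermiteState (j : ι → ℕ) : 𝓢(E, ℂ) := (oscillator b).state j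

theorem hermiteState_zero : hermiteState b 0 = gaussian E := (oscillator b).state_zero

theorem hermiteState_add_single (j : ι → ℕ) (i : ι) : hermiteState b (j + Pi.single i 1) =
    posOp (b i) (hermiteState b j) - derOp (b i) (hermiteState b j) :=
  (oscillator b).state_add_single j i

theorem lower_hermiteState (j : ι → ℕ) (i : ι) :
    posOp (b i) (hermiteState b (j + Pi.single i 1)) +
      derOp (b i) (hermiteState b (j + Pi.single i 1)) = (2 * (j i + 1) : ℂ) • hermiteState b j :=
  ((oscillator b).lower_state j i).1

theorem lower_hermiteState_of_eq_zero {j : ι → ℕ} {i : ι} (h : j i = 0) :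
    posOp (b i) (hermiteState b j) + derOp (b i) (hermiteState b j) = 0 :=
  ((oscillator b).lower_state j i).2 h

variable (μ : Measure E) [μ.IsAddHaarMeasure]

/-- Integration by parts flips the sign of the derivative, so raising and lowering are transposes
for the bilinear pairing. -/
theorem integralMul_raise (i : ι) (f g : 𝓢(E, ℂ)) :
    integralMul μ g ((oscillator b).raise i f) = integralMul μ ((oscillator b).lower i g) f := by
  change integralMul μ g (posOp (b i) f - derOp (b i) f) =
    integralMul μ (posOp (b i) g + derOp (b i) g) f
  rw [map_sub, integralMul_comm μ f, map_add, integralMul_comm μ _ f, integralMul_comm μ _ f]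
  simp only [integralMul_apply, integral_posOp_mul, integral_derOp_mul, sub_neg_eq_add]

/-- The occupation operator in a direction where `j` and `l` differ is symmetric, with the distinct
eigenvalues `2 * j i` and `2 * l i` on the two states. -/
theorem integralMul_hermiteState_ne {j l : ι → ℕ} (h : j ≠ l) :
    integralMul μ (hermiteState b l) (hermiteState b j) = 0 := by
  obtain ⟨i, hi⟩ := Function.ne_iff.1 h
  have h1 := integralMul_raise b μ i ((oscillator b).lower i (hermiteState b j)) (hermiteState b l)
  rw [integralMul_comm μ _ ((oscillator b).lower i (hermiteState b l)), ← integralMul_raise,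
    hermiteState, hermiteState, LadderSystem.raise_lower_state, LadderSystem.raise_lower_state,
    map_smul, map_smul, integralMul_comm, ← sub_eq_zero, ← sub_smul, smul_eq_zero] at h1
  rw [hermiteState, hermiteState, integralMul_comm]
  refine h1.resolve_left fun h2 => hi ?_
  have h3 : (j i : ℂ) = l i := by linear_combination h2 / 2
  exact_mod_cast h3

theorem integralMul_hermiteState_succ (j : ι → ℕ) (i : ι) :
    integralMul μ (hermiteState b (j + Pi.single i 1)) (hermiteState b (j + Pi.single i 1)) =
      (2 * (j i + 1) : ℂ) * integralMul μ (hermiteState b j) (hermiteState b j) := by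
  have h1 := integralMul_raise b μ i (hermiteState b j) (hermiteState b (j + Pi.single i 1))
  have h2 : (oscillator b).lower i (hermiteState b (j + Pi.single i 1)) =
      (2 * (j i + 1) : ℂ) • hermiteState b j := lower_hermiteState b j i
  rw [h2, integralMul_smul] at h1
  rw [← h1]
  congr 1
  exact hermiteState_add_single b j i

/-- The pairing carries no complex conjugation, so positivity is not automatic. It starts from a
positive Gaussian integral, and each raising step multiplies by `2 * (j i + 1)`. -/
theorem exists_normSq_hermiteState (j : ι → ℕ) : ∃ w : ℝ, 0 < w ∧
    integralMul μ (hermiteState b j) (hermiteState b j) = w := by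
  induction j using LadderSystem.induction_multiIndex with
  | h0 =>
    refine ⟨∫ x, Real.exp (-(‖x‖ ^ 2 / 2)) * Real.exp (-(‖x‖ ^ 2 / 2)) ∂μ, ?_, ?_⟩
    · refine integral_pos_of_integrable_nonneg_nonzero (x := 0) ?_ ?_ ?_ ?_
      · fun_prop
      · have := (integrable_mul μ (gaussian E) (gaussian E)).re
        simp only [gaussian_apply, ← Complex.ofReal_mul] at this
        exact this
      · intro x; positivity
      · positivity
    · rw [hermiteState_zero, integralMul_apply, ← integral_complex_ofReal]
      simp only [gaussian_apply, Complex.ofReal_mul]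
  | h1 j i ih =>
    obtain ⟨w, hw, h⟩ := ih
    refine ⟨2 * (j i + 1) * w, by positivity, ?_⟩
    rw [integralMul_hermiteState_succ, h]
    push_cast
    ring

/-- The squared norm of `hermiteState b j` in `L²(μ)`. -/
def hermiteNormSq (j : ι → ℕ) : ℝ := (exists_normSq_hermiteState b μ j).choose

theorem hermiteNormSq_pos (j : ι → ℕ) : 0 < hermiteNormSq b μ j :=
  (exists_normSq_hermiteState b μ j).choose_spec.1

theorem integralMul_hermiteState_self (j : ι → ℕ) :
    integralMul μ (hermiteState b j) (hermiteState b j) = hermiteNormSq b μ j :=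
  (exists_normSq_hermiteState b μ j).choose_spec.2

theorem hermiteNormSq_succ (j : ι → ℕ) (i : ι) :
    hermiteNormSq b μ (j + Pi.single i 1) = 2 * (j i + 1) * hermiteNormSq b μ j := by
  have := integralMul_hermiteState_succ b μ j i
  rw [integralMul_hermiteState_self, integralMul_hermiteState_self] at this
  exact_mod_cast this

/-- The Hermite functions, normalized in `L²(μ)`. -/
def hermite (j : ι → ℕ) : 𝓢(E, ℂ) := ((√(hermiteNormSq b μ j))⁻¹ : ℂ) • hermiteState b j

theorem hermiteState_eq (j : ι → ℕ) :
    hermiteState b j = (√(hermiteNormSq b μ j) : ℂ) • hermite b μ j := by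
  have h : (√(hermiteNormSq b μ j) : ℂ) ≠ 0 := by
    exact_mod_cast (Real.sqrt_pos.2 (hermiteNormSq_pos b μ j)).ne'
  rw [hermite, smul_smul, mul_inv_cancel₀ h, one_smul]

theorem integralMul_hermite_self (j : ι → ℕ) :
    integralMul μ (hermite b μ j) (hermite b μ j) = 1 := by
  have h := (Real.sqrt_pos.2 (hermiteNormSq_pos b μ j)).ne'
  have h2 : (hermiteNormSq b μ j : ℂ) = (√(hermiteNormSq b μ j) : ℂ) * √(hermiteNormSq b μ j) := by
    exact_mod_cast (Real.mul_self_sqrt (hermiteNormSq_pos b μ j).le).symm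
  have h3 : (√(hermiteNormSq b μ j) : ℂ) ≠ 0 := by exact_mod_cast h
  rw [hermite, integralMul_smul, map_smul, integralMul_hermiteState_self, h2, smul_eq_mul]
  field_simp

theorem integralMul_hermite_ne {j l : ι → ℕ} (h : j ≠ l) :
    integralMul μ (hermite b μ l) (hermite b μ j) = 0 := by
  rw [hermite, hermite, integralMul_smul, map_smul, integralMul_hermiteState_ne b μ h]
  simp

theorem raise_hermite (j : ι → ℕ) (i : ι) :
    posOp (b i) (hermite b μ j) - derOp (b i) (hermite b μ j) =
      (√(2 * (j i + 1)) : ℂ) • hermite b μ (j + Pi.single i 1) := by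
  have h := (Real.sqrt_pos.2 (hermiteNormSq_pos b μ j)).ne'
  have h3 : (√(hermiteNormSq b μ j) : ℂ) ≠ 0 := by exact_mod_cast h
  have h4 : (√(2 * (j i + 1)) : ℂ) ≠ 0 := by
    exact_mod_cast (Real.sqrt_pos.2 (by positivity : (0 : ℝ) < 2 * (j i + 1))).ne'
  rw [hermite, map_smul, map_smul, ← smul_sub, ← hermiteState_add_single, hermite,
    hermiteNormSq_succ, Real.sqrt_mul (by positivity : (0 : ℝ) ≤ 2 * ((j i : ℝ) + 1)), smul_smul]
  congr 1
  generalize √(2 * ((j i : ℝ) + 1)) = a at *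
  push_cast
  field_simp

theorem lower_hermite (j : ι → ℕ) (i : ι) :
    posOp (b i) (hermite b μ (j + Pi.single i 1)) + derOp (b i) (hermite b μ (j + Pi.single i 1)) =
      (√(2 * (j i + 1)) : ℂ) • hermite b μ j := by
  have h := (Real.sqrt_pos.2 (hermiteNormSq_pos b μ j)).ne'
  have h3 : (√(hermiteNormSq b μ j) : ℂ) ≠ 0 := by exact_mod_cast h
  have h4 : (√(2 * (j i + 1)) : ℂ) ≠ 0 := by
    exact_mod_cast (Real.sqrt_pos.2 (by positivity : (0 : ℝ) < 2 * (j i + 1))).ne'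
  have h5 : (2 * (j i + 1) : ℂ) = (√(2 * (j i + 1)) : ℂ) * √(2 * (j i + 1)) := by
    exact_mod_cast (Real.mul_self_sqrt (by positivity : (0 : ℝ) ≤ 2 * (j i + 1))).symm
  rw [hermite, map_smul, map_smul, ← smul_add, lower_hermiteState, hermite,
    hermiteNormSq_succ, Real.sqrt_mul (by positivity), smul_smul, smul_smul]
  congr 1
  rw [h5]
  generalize √(2 * ((j i : ℝ) + 1)) = a at *
  push_cast
  field_simp

theorem lower_hermite_of_eq_zero {j : ι → ℕ} {i : ι} (h : j i = 0) :
    posOp (b i) (hermite b μ j) + derOp (b i) (hermite b μ j) = 0 := by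
  rw [hermite, map_smul, map_smul, ← smul_add, lower_hermiteState_of_eq_zero b h, smul_zero]

/-- Reality is what makes the bilinear pairing against a Hermite function agree with the `L²` inner
product. -/
theorem im_hermiteState (j : ι → ℕ) (x : E) : (hermiteState b j x).im = 0 := by
  induction j using LadderSystem.induction_multiIndex generalizing x with
  | h0 => rw [hermiteState_zero, gaussian_apply, Complex.ofReal_im]
  | h1 j i ih =>
    have h1 := Complex.imCLM.hasFDerivAt.comp x ((hermiteState b j).hasFDerivAt x)
    have h2 : Complex.imCLM ∘ hermiteState b j = fun _ => (0 : ℝ) := funext ih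
    rw [h2] at h1
    have h3 := congrArg (fun T => T (b i)) (h1.unique (hasFDerivAt_const (0 : ℝ) x))
    have h4 : (derOp (b i) (hermiteState b j) x).im = 0 := h3
    rw [hermiteState_add_single]
    simp [h4, ih x]

theorem im_hermite (j : ι → ℕ) (x : E) : (hermite b μ j x).im = 0 := by
  rw [hermite, ← Complex.ofReal_inv]
  simp [im_hermiteState b j x]

theorem norm_toLp_hermite (j : ι → ℕ) : ‖(hermite b μ j).toLp 2 μ‖ = 1 := by
  have h1 := SchwartzMap.inner_toL2_toL2_eq (hermite b μ j) (hermite b μ j) μ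
  have h2 : ∀ x, inner ℂ (hermite b μ j x) (hermite b μ j x) = hermite b μ j x * hermite b μ j x := by
    intro x
    rw [RCLike.inner_apply, Complex.conj_eq_iff_im.2 (im_hermite b μ j x)]
  simp only [h2] at h1
  rw [← integralMul_apply, integralMul_hermite_self, inner_self_eq_norm_sq_to_K] at h1
  have h3 : ‖(hermite b μ j).toLp 2 μ‖ ^ 2 = 1 := Complex.ofReal_injective (by simpa using h1)
  exact (pow_eq_one_iff_of_nonneg (norm_nonneg _) two_ne_zero).1 h3

theorem norm_integralMul_hermite_le (j : ι → ℕ) (f : 𝓢(E, ℂ)) :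
    ‖integralMul μ (hermite b μ j) f‖ ≤ ‖f.toLp 2 μ‖ := by
  have h1 := SchwartzMap.inner_toL2_toL2_eq (hermite b μ j) f μ
  have h2 : ∀ x, inner ℂ (hermite b μ j x) (f x) = f x * hermite b μ j x := by
    intro x
    rw [RCLike.inner_apply, Complex.conj_eq_iff_im.2 (im_hermite b μ j x)]
  simp only [h2] at h1
  rw [integralMul_apply, ← h1]
  refine (norm_inner_le_norm _ _).trans ?_
  rw [norm_toLp_hermite, one_mul]

end Oscillator

/-! ### Growth of the Hermite functions -/

section Growth

open LineDeriv

variable {E : Type} [NormedAddCommGroup E] [InnerProductSpace ℝ E] [FiniteDimensional ℝ E]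
  [MeasurableSpace E] [BorelSpace E] {ι : Type} [Fintype ι] [DecidableEq ι]
  (b : OrthonormalBasis ι ℝ E) (μ : Measure E) [μ.IsAddHaarMeasure]

/-- The weight `1 + |j|` of a multi-index. -/
def multiWeight (j : ι → ℕ) : ℝ := 1 + ∑ i, (j i : ℝ)

omit [DecidableEq ι] in
theorem one_le_multiWeight (j : ι → ℕ) : 1 ≤ multiWeight j :=
  le_add_of_nonneg_right (Finset.sum_nonneg fun _ _ => Nat.cast_nonneg _)

omit [DecidableEq ι] in
theorem apply_le_multiWeight (j : ι → ℕ) (i : ι) : (j i : ℝ) + 1 ≤ multiWeight j := by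
  rw [multiWeight, add_comm]
  gcongr
  exact Finset.single_le_sum (f := fun i => (j i : ℝ)) (fun _ _ => Nat.cast_nonneg _)
    (Finset.mem_univ i)

theorem multiWeight_add_single (j : ι → ℕ) (i : ι) :
    multiWeight (j + Pi.single i 1) = multiWeight j + 1 := by
  have h : ∀ k, (((j + Pi.single i 1 : ι → ℕ) k : ℕ) : ℝ) = j k + (Pi.single i 1 : ι → ℝ) k := by
    intro k
    by_cases hk : k = i
    · subst hk; simp
    · simp [hk]
  simp only [multiWeight, h, Finset.sum_add_distrib, Finset.sum_pi_single', Finset.mem_univ, if_true]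
  ring

/-- A seminorm which grows polynomially on the Hermite functions. -/
def PolyOnHermite (p : Seminorm ℂ 𝓢(E, ℂ)) : Prop :=
  ∃ (C : ℝ) (M : ℕ), 0 ≤ C ∧ ∀ j : ι → ℕ, p (hermite b μ j) ≤ C * multiWeight j ^ M

/-- An operator on the Schwartz space which preserves `PolyOnHermite`. -/
def Tame (T : 𝓢(E, ℂ) →L[ℂ] 𝓢(E, ℂ)) : Prop :=
  ∀ p : Seminorm ℂ 𝓢(E, ℂ), PolyOnHermite b μ p → PolyOnHermite b μ (p.comp T.toLinearMap)

variable {b μ}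

theorem PolyOnHermite.of_le {p q : Seminorm ℂ 𝓢(E, ℂ)} (hq : PolyOnHermite b μ q) (C : ℝ)
    (h : ∀ f, p f ≤ C * q f) : PolyOnHermite b μ p := by
  obtain ⟨C', M, hC', h'⟩ := hq
  refine ⟨|C| * C', M, by positivity, fun j => (h _).trans ?_⟩
  rw [mul_assoc]
  exact mul_le_mul (le_abs_self C) (h' j) (apply_nonneg q _) (abs_nonneg C)

theorem PolyOnHermite.add {p q : Seminorm ℂ 𝓢(E, ℂ)} (hp : PolyOnHermite b μ p)
    (hq : PolyOnHermite b μ q) : PolyOnHermite b μ (p + q) := by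
  obtain ⟨C, M, hC, h⟩ := hp
  obtain ⟨C', M', hC', h'⟩ := hq
  refine ⟨C + C', M + M', by positivity, fun j => ?_⟩
  have hw := one_le_multiWeight j
  have h1 : multiWeight j ^ M ≤ multiWeight j ^ (M + M') := by gcongr; omega
  have h2 : multiWeight j ^ M' ≤ multiWeight j ^ (M + M') := by gcongr; omega
  calc p (hermite b μ j) + q (hermite b μ j) ≤ C * multiWeight j ^ M + C' * multiWeight j ^ M' :=
        add_le_add (h j) (h' j)
    _ ≤ C * multiWeight j ^ (M + M') + C' * multiWeight j ^ (M + M') := by gcongr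
    _ = _ := by ring

theorem PolyOnHermite.zero : PolyOnHermite b μ 0 :=
  ⟨0, 0, le_rfl, fun j => by simp⟩

theorem PolyOnHermite.sum {κ : Type*} (s : Finset κ) {p : κ → Seminorm ℂ 𝓢(E, ℂ)}
    (hp : ∀ k, PolyOnHermite b μ (p k)) : PolyOnHermite b μ (∑ k ∈ s, p k) :=
  Finset.sum_induction _ _ (fun _ _ => PolyOnHermite.add) PolyOnHermite.zero fun k _ => hp k

theorem Tame.id : Tame b μ (ContinuousLinearMap.id ℂ 𝓢(E, ℂ)) := fun _ hp => hp

theorem Tame.comp {S T : 𝓢(E, ℂ) →L[ℂ] 𝓢(E, ℂ)} (hS : Tame b μ S) (hT : Tame b μ T) :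
    Tame b μ (S ∘L T) := fun p hp => hT _ (hS p hp)

theorem Tame.add {S T : 𝓢(E, ℂ) →L[ℂ] 𝓢(E, ℂ)} (hS : Tame b μ S) (hT : Tame b μ T) :
    Tame b μ (S + T) := fun p hp =>
  ((hS p hp).add (hT p hp)).of_le 1 fun f => by rw [one_mul]; exact map_add_le_add p _ _

theorem Tame.smul {T : 𝓢(E, ℂ) →L[ℂ] 𝓢(E, ℂ)} (hT : Tame b μ T) (c : ℂ) : Tame b μ (c • T) :=
  fun p hp => (hT p hp).of_le ‖c‖ fun f => (map_smul_eq_mul p c (T f)).le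

theorem Tame.sum {κ : Type*} (s : Finset κ) {T : κ → 𝓢(E, ℂ) →L[ℂ] 𝓢(E, ℂ)}
    (hT : ∀ k, Tame b μ (T k)) : Tame b μ (∑ k ∈ s, T k) :=
  Finset.sum_induction _ _ (fun _ _ => Tame.add)
    (fun p _ => PolyOnHermite.zero.of_le 0 fun f => by simp) fun k _ => hT k

theorem Tame.pow {T : 𝓢(E, ℂ) →L[ℂ] 𝓢(E, ℂ)} (hT : Tame b μ T) (m : ℕ) : Tame b μ (T ^ m) := by
  induction m with
  | zero => exact Tame.id
  | succ m ih => rw [pow_succ]; exact ih.comp hT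

/-- The operator shifts the index by one and multiplies by `√(2 * (j i + 1))`. With `w` the weight,
this factor is at most `2 * w` and `(w + 1) ^ M ≤ (2 * w) ^ M`, so the degree of a polynomial bound
rises by one. -/
theorem tame_raise (i : ι) : Tame b μ (posOp (b i) - derOp (b i)) := by
  rintro p ⟨C, M, hC, h⟩
  refine ⟨2 * C * 2 ^ M, M + 1, by positivity, fun j => ?_⟩
  have hw := one_le_multiWeight j
  have h1 : √(2 * ((j i : ℝ) + 1)) ≤ 2 * multiWeight j := by
    rw [Real.sqrt_le_iff]
    refine ⟨by positivity, ?_⟩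
    nlinarith [apply_le_multiWeight j i]
  have h2 : (posOp (b i) - derOp (b i) : 𝓢(E, ℂ) →L[ℂ] 𝓢(E, ℂ)).toLinearMap (hermite b μ j) =
      (√(2 * (j i + 1)) : ℂ) • hermite b μ (j + Pi.single i 1) := raise_hermite b μ j i
  rw [Seminorm.comp_apply, h2, map_smul_eq_mul, Complex.norm_real,
    Real.norm_of_nonneg (Real.sqrt_nonneg _)]
  calc √(2 * ((j i : ℝ) + 1)) * p (hermite b μ (j + Pi.single i 1))
      ≤ 2 * multiWeight j * (C * (2 * multiWeight j) ^ M) := by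
        gcongr
        refine (h _).trans ?_
        rw [multiWeight_add_single]
        gcongr
        linarith
    _ = _ := by rw [mul_pow, pow_succ]; ring

theorem tame_lower (i : ι) : Tame b μ (posOp (b i) + derOp (b i)) := by
  rintro p ⟨C, M, hC, h⟩
  refine ⟨2 * C, M + 1, by positivity, fun j => ?_⟩
  rcases Nat.eq_zero_or_pos (j i) with h0 | h0
  · have h2 : (posOp (b i) + derOp (b i) : 𝓢(E, ℂ) →L[ℂ] 𝓢(E, ℂ)).toLinearMap (hermite b μ j) = 0 :=
      lower_hermite_of_eq_zero b μ h0
    have hw := one_le_multiWeight j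
    rw [Seminorm.comp_apply, h2, map_zero]
    positivity
  · obtain ⟨j, rfl⟩ : ∃ l, j = l + Pi.single i 1 := ⟨j - Pi.single i 1, by
      ext k
      by_cases hk : k = i
      · subst hk; simp; omega
      · simp [hk]⟩
    have h2 : (posOp (b i) + derOp (b i) : 𝓢(E, ℂ) →L[ℂ] 𝓢(E, ℂ)).toLinearMap
        (hermite b μ (j + Pi.single i 1)) = (√(2 * (j i + 1)) : ℂ) • hermite b μ j :=
      lower_hermite b μ j i
    have hw := one_le_multiWeight j
    have h1 : √(2 * ((j i : ℝ) + 1)) ≤ 2 * multiWeight j := by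
      rw [Real.sqrt_le_iff]
      refine ⟨by positivity, ?_⟩
      nlinarith [apply_le_multiWeight j i]
    rw [Seminorm.comp_apply, h2, map_smul_eq_mul, Complex.norm_real,
      Real.norm_of_nonneg (Real.sqrt_nonneg _), multiWeight_add_single]
    calc √(2 * ((j i : ℝ) + 1)) * p (hermite b μ j)
        ≤ 2 * multiWeight j * (C * multiWeight j ^ M) := by
          gcongr
          exact h _
      _ = 2 * C * multiWeight j ^ (M + 1) := by rw [pow_succ]; ring
      _ ≤ _ := by gcongr; linarith

theorem tame_posOp (i : ι) : Tame b μ (posOp (b i)) := by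
  have h := ((tame_raise (b := b) (μ := μ) i).add (tame_lower i)).smul (1 / 2)
  convert h using 1
  ext f x
  simp
  ring

theorem tame_derOp (i : ι) : Tame b μ (derOp (b i)) := by
  have h := ((tame_lower (b := b) (μ := μ) i).add ((tame_raise i).smul (-1))).smul (1 / 2)
  convert h using 1
  ext f x
  simp
  ring

-- Haar measures are proportional. This bridges the normalization by `μ` and Plancherel, which is
-- used with `volume`.
omit [DecidableEq ι] in
theorem exists_toLp_volume_le : ∃ C : ℝ, ∀ f : 𝓢(E, ℂ), ‖f.toLp 2 volume‖ ≤ C * ‖f.toLp 2 μ‖ := by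
  have h := Measure.isAddLeftInvariant_eq_smul (volume : Measure E) μ
  set c := Measure.addHaarScalarFactor (volume : Measure E) μ
  refine ⟨((c : ENNReal) ^ (1 / (2 : ENNReal)).toReal).toReal, fun f => ?_⟩
  have h1 : (volume : Measure E) = (c : ENNReal) • μ := h
  rw [SchwartzMap.norm_toLp, SchwartzMap.norm_toLp, h1,
    eLpNorm_smul_measure_of_ne_top (by simp), smul_eq_mul, ENNReal.toReal_mul]

variable (b) in
/-- The operator `1 - Δ / (4π²)`. -/
def besselOp : 𝓢(E, ℂ) →L[ℂ] 𝓢(E, ℂ) :=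
  ContinuousLinearMap.id ℂ _ + (-((2 * (Real.pi : ℂ)) ^ 2)⁻¹) • ∑ i, derOp (b i) ∘L derOp (b i)

omit [DecidableEq ι] in
theorem fourier_derOp (v : E) (f : 𝓢(E, ℂ)) (ξ : E) :
    𝓕 (derOp v f) ξ = 2 * Real.pi * Complex.I * (inner ℝ ξ v : ℝ) * 𝓕 f ξ := by
  have h : derOp v f = ∂_{v} f := rfl
  rw [h, SchwartzMap.fourier_lineDerivOp_eq, smul_apply,
    SchwartzMap.smulLeftCLM_apply_apply (by fun_prop), smul_eq_mul, Complex.real_smul]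
  ring

omit [DecidableEq ι] in
theorem fourier_besselOp (f : 𝓢(E, ℂ)) (ξ : E) :
    𝓕 (besselOp b f) ξ = (1 + ‖ξ‖ ^ 2 : ℝ) * 𝓕 f ξ := by
  have h1 : besselOp b f = f + (-((2 * (Real.pi : ℂ)) ^ 2)⁻¹) • ∑ i, derOp (b i) (derOp (b i) f) := by
    simp [besselOp]
  have h2 : ∀ g, SchwartzMap.fourierTransformCLM ℂ g = 𝓕 g := fun g : 𝓢(E, ℂ) => rfl
  rw [h1, ← h2, map_add, map_smul, map_sum]
  simp only [h2, add_apply, smul_apply, _root_.sum_apply, fourier_derOp]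
  have h3 : ∑ i, 2 * (Real.pi : ℂ) * Complex.I * (inner ℝ ξ (b i) : ℝ) *
      (2 * Real.pi * Complex.I * (inner ℝ ξ (b i) : ℝ) * 𝓕 f ξ) =
      -((2 * Real.pi) ^ 2 * ((‖ξ‖ ^ 2 : ℝ) : ℂ) * 𝓕 f ξ) := by
    rw [← b.sum_sq_inner_left ξ, Complex.ofReal_sum, Finset.mul_sum, Finset.sum_mul,
      ← Finset.sum_neg_distrib]
    refine Finset.sum_congr rfl fun i _ => ?_
    push_cast
    linear_combination (4 * (Real.pi : ℂ) ^ 2 * (inner ℝ ξ (b i) : ℝ) ^ 2 * 𝓕 f ξ) * Complex.I_sq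
  rw [h3]
  have hpi : (Real.pi : ℂ) ≠ 0 := by exact_mod_cast Real.pi_ne_zero
  rw [smul_eq_mul]
  push_cast
  field_simp

omit [DecidableEq ι] in
theorem fourier_besselOp_pow (f : 𝓢(E, ℂ)) (K : ℕ) (ξ : E) :
    𝓕 ((besselOp b ^ K) f) ξ = ((1 + ‖ξ‖ ^ 2) ^ K : ℝ) * 𝓕 f ξ := by
  induction K with
  | zero => simp
  | succ K ih =>
    have h : (besselOp b ^ (K + 1)) f = besselOp b ((besselOp b ^ K) f) := by
      rw [pow_succ']; rfl
    rw [h, fourier_besselOp, ih, pow_succ]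
    push_cast
    ring

theorem norm_le_integral_norm_fourier (f : 𝓢(E, ℂ)) (x : E) : ‖f x‖ ≤ ∫ ξ, ‖𝓕 f ξ‖ := by
  have h1 : f = 𝓕⁻ (𝓕 f) := (FourierTransform.fourierInv_fourier_eq f).symm
  have h2 := SchwartzMap.norm_fourier_apply_le_toLp_one (𝓕 f) (-x)
  rw [SchwartzMap.norm_toLp_one] at h2
  have h3 : 𝓕⁻ (𝓕 f) x = 𝓕 (𝓕 f) (-x) := by
    rw [SchwartzMap.fourierInv_apply_eq]; rfl
  rw [← h3, ← h1] at h2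
  exact h2

-- A Sobolev inequality. Fourier inversion bounds `|f x|` by the integral of `|𝓕 f|`; inserting `(1
-- + ‖ξ‖ ^ 2) ^ K` and its inverse, Cauchy–Schwarz and Plancherel give the `L²` norm of `besselOp b
-- ^ K` applied to `f`. The choice `K = dim E + 1` makes the inverse weight square integrable.
variable (b) in
omit [DecidableEq ι] in
theorem exists_norm_le_toLp : ∃ (K : ℕ) (C : ℝ), ∀ (f : 𝓢(E, ℂ)) (x : E),
    ‖f x‖ ≤ C * ‖((besselOp b ^ K) f).toLp 2 volume‖ := by
  set K := Module.finrank ℝ E + 1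
  let w : E → ℂ := fun ξ => (((1 + ‖ξ‖ ^ 2) ^ K)⁻¹ : ℝ)
  have hwc : Continuous w := by
    refine Complex.continuous_ofReal.comp (Continuous.inv₀ (by fun_prop) fun ξ => ?_)
    positivity
  have hw : MemLp w (ENNReal.ofReal 2) volume := by
    rw [show ENNReal.ofReal 2 = 2 by simp, memLp_two_iff_integrable_sq_norm hwc.aestronglyMeasurable]
    have h := integrable_rpow_neg_one_add_norm_sq (E := E) (μ := volume) (r := 4 * K)
      (by have : (K : ℝ) = Module.finrank ℝ E + 1 := by simp [K]
          rw [this]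
          have : (0 : ℝ) ≤ Module.finrank ℝ E := Nat.cast_nonneg _
          linarith)
    refine h.congr (Filter.Eventually.of_forall fun ξ => ?_)
    dsimp only [w]
    have h0 : (0 : ℝ) < 1 + ‖ξ‖ ^ 2 := by positivity
    rw [Complex.norm_real, Real.norm_of_nonneg (by positivity),
      show -(4 * (K : ℝ)) / 2 = -((2 * K : ℕ) : ℝ) by push_cast; ring, Real.rpow_neg h0.le,
      Real.rpow_natCast, inv_pow, ← pow_mul, mul_comm K 2]
  refine ⟨K, (∫ ξ : E, ‖w ξ‖ ^ (2 : ℝ)) ^ (1 / (2 : ℝ)), fun f x => ?_⟩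
  refine (norm_le_integral_norm_fourier f x).trans ?_
  have hg : MemLp (𝓕 ((besselOp b ^ K) f) : 𝓢(E, ℂ)) (ENNReal.ofReal 2) volume :=
    SchwartzMap.memLp _ _ volume
  have h := integral_mul_norm_le_Lp_mul_Lq (p := 2) (q := 2)
    ((Real.holderConjugate_iff).2 ⟨by norm_num, by norm_num⟩) hw hg
  have h1 : ∀ ξ, ‖w ξ‖ * ‖𝓕 ((besselOp b ^ K) f) ξ‖ = ‖𝓕 f ξ‖ := by
    intro ξ
    have h0 : (0 : ℝ) < (1 + ‖ξ‖ ^ 2) ^ K := by positivity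
    rw [fourier_besselOp_pow, norm_mul, ← mul_assoc, ← norm_mul]
    simp only [w]
    rw [← Complex.ofReal_mul, inv_mul_cancel₀ h0.ne', Complex.ofReal_one, norm_one, one_mul]
  simp only [h1] at h
  rw [← SchwartzMap.norm_fourier_toL2_eq, SchwartzMap.norm_toLp' (by simp) (by simp)]
  simpa using h

end Growth

/-! ### The Hermite basis of the Schwartz space -/

section HermiteBasis

open LineDeriv

/-- Expanding each argument in the basis reduces norms of iterated derivatives to derivatives along
basis vectors, which are tame operators. -/
theorem norm_multilinear_le_sum {E : Type*} [NormedAddCommGroup E] [InnerProductSpace ℝ E]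
    {ι : Type*} [Fintype ι] (b : OrthonormalBasis ι ℝ E) {m : ℕ}
    (A : ContinuousMultilinearMap ℝ (fun _ : Fin m => E) ℂ) :
    ‖A‖ ≤ ∑ t : Fin m → ι, ‖A fun i => b (t i)‖ := by
  classical
  refine A.opNorm_le_bound (Finset.sum_nonneg fun _ _ => norm_nonneg _) fun v => ?_
  have h1 : A v = ∑ t : Fin m → ι, (∏ i, inner ℝ (b (t i)) (v i)) • A fun i => b (t i) := by
    have h2 : v = fun i => ∑ k, inner ℝ (b k) (v i) • b k := funext fun i => (b.sum_repr' (v i)).symm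
    conv_lhs => rw [h2]
    refine (A.toMultilinearMap.map_sum _).trans (Finset.sum_congr rfl fun t _ => ?_)
    exact A.toMultilinearMap.map_smul_univ _ _
  rw [h1, Finset.sum_mul]
  refine (norm_sum_le _ _).trans (Finset.sum_le_sum fun t _ => ?_)
  rw [norm_smul, mul_comm, norm_prod]
  refine mul_le_mul_of_nonneg_left (Finset.prod_le_prod (fun _ _ => norm_nonneg _) fun i _ => ?_)
    (norm_nonneg _)
  refine (norm_inner_le_norm _ _).trans ?_
  rw [b.norm_eq_one, one_mul]

/-- Every finite set of multi-indices lies in a box, and a sum over a box factorizes. -/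
theorem summable_prod_apply {ι : Type*} [Fintype ι] [DecidableEq ι] {f : ℕ → ℝ} (hf : ∀ k, 0 ≤ f k)
    (hs : Summable f) : Summable fun j : ι → ℕ => ∏ i, f (j i) := by
  refine summable_of_sum_le (c := ∏ _i : ι, ∑' k, f k)
    (fun j => Finset.prod_nonneg fun i _ => hf _) fun u => ?_
  have hsub : u ⊆ Fintype.piFinset fun i => u.image fun j => j i := fun j hj =>
    Fintype.mem_piFinset.2 fun i => Finset.mem_image_of_mem _ hj
  refine (Finset.sum_le_sum_of_subset_of_nonneg hsub fun j _ _ =>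
    Finset.prod_nonneg fun i _ => hf _).trans ?_
  rw [← Finset.prod_univ_sum (fun i => u.image fun j => j i) fun _ k => f k]
  exact Finset.prod_le_prod (fun i _ => Finset.sum_nonneg fun k _ => hf k) fun i _ =>
    hs.sum_le_tsum _ fun k _ => hf k

variable {E : Type} [NormedAddCommGroup E] [InnerProductSpace ℝ E] [FiniteDimensional ℝ E]
  [MeasurableSpace E] [BorelSpace E] {ι : Type} [Fintype ι] [DecidableEq ι]
  (b : OrthonormalBasis ι ℝ E) (μ : Measure E) [μ.IsAddHaarMeasure]

theorem exists_summable_multiWeight :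
    ∃ D : ℕ, Summable fun j : ι → ℕ => (multiWeight j ^ D)⁻¹ := by
  -- Two powers per coordinate: the weight dominates each `j i + 1`, so the inverse power is at most
  -- `∏ i, (j i + 1)⁻²`.
  refine ⟨2 * Fintype.card ι, ?_⟩
  have h1 : Summable fun k : ℕ => (((k : ℝ) + 1) ^ 2)⁻¹ := by
    have := (summable_nat_add_iff 1).2 (Real.summable_nat_pow_inv.2 (by norm_num : 1 < 2))
    exact_mod_cast this
  refine Summable.of_nonneg_of_le
    (fun j => inv_nonneg.2 (pow_nonneg (zero_le_one.trans (one_le_multiWeight j)) _)) (fun j => ?_)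
    (summable_prod_apply (ι := ι) (fun k => by positivity) h1)
  rw [Finset.prod_inv_distrib]
  refine inv_anti₀ (Finset.prod_pos fun i _ => by positivity) ?_
  rw [pow_mul, ← Finset.card_univ, ← Finset.prod_const]
  refine Finset.prod_le_prod (fun i _ => by positivity) fun i _ => ?_
  have := apply_le_multiWeight j i
  gcongr

/-- The `L²(μ)` norm as a seminorm on the Schwartz space. -/
def l2Seminorm : Seminorm ℂ 𝓢(E, ℂ) :=
  (normSeminorm ℂ (Lp ℂ 2 μ)).comp (SchwartzMap.toLpCLM ℂ ℂ 2 μ).toLinearMap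

theorem continuous_l2Seminorm : Continuous (l2Seminorm μ) :=
  continuous_norm.comp (SchwartzMap.toLpCLM ℂ ℂ 2 μ).continuous

theorem l2Seminorm_apply (f : 𝓢(E, ℂ)) : l2Seminorm μ f = ‖f.toLp 2 μ‖ := rfl

theorem polyOnHermite_l2Seminorm : PolyOnHermite b μ (l2Seminorm μ) :=
  ⟨1, 0, zero_le_one, fun j => by rw [l2Seminorm_apply, norm_toLp_hermite]; simp⟩

theorem tame_besselOp : Tame b μ (besselOp b) :=
  Tame.id.add ((Tame.sum _ fun i => (tame_derOp i).comp (tame_derOp i)).smul _)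

/-- By the Sobolev inequality the sup norm is controlled by the `L²` norm after a tame operator, and
the `L²` norm equals `1` on every Hermite function. -/
theorem polyOnHermite_sup : PolyOnHermite b μ (SchwartzMap.seminorm ℂ 0 0) := by
  obtain ⟨K, C, h⟩ := exists_norm_le_toLp b
  obtain ⟨C', h'⟩ := exists_toLp_volume_le (μ := μ)
  refine ((tame_besselOp b μ).pow K _ (polyOnHermite_l2Seminorm b μ)).of_le (|C| * |C'|) fun f => ?_
  have h0 : ∀ g : 𝓢(E, ℂ), 0 ≤ ‖g.toLp 2 μ‖ := fun g => norm_nonneg _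
  have h1 : ‖((besselOp b ^ K) f).toLp 2 volume‖ ≤ |C'| * ‖((besselOp b ^ K) f).toLp 2 μ‖ :=
    (h' _).trans (mul_le_mul_of_nonneg_right (le_abs_self C') (norm_nonneg _))
  refine SchwartzMap.seminorm_le_bound ℂ 0 0 f
    (mul_nonneg (mul_nonneg (abs_nonneg _) (abs_nonneg _)) (apply_nonneg _ _)) fun x => ?_
  rw [pow_zero, one_mul, norm_iteratedFDeriv_zero]
  calc ‖f x‖ ≤ C * ‖((besselOp b ^ K) f).toLp 2 volume‖ := h f x
    _ ≤ |C| * ‖((besselOp b ^ K) f).toLp 2 volume‖ :=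
      mul_le_mul_of_nonneg_right (le_abs_self C) (norm_nonneg _)
    _ ≤ |C| * (|C'| * ‖((besselOp b ^ K) f).toLp 2 μ‖) :=
      mul_le_mul_of_nonneg_left h1 (abs_nonneg C)
    _ = |C| * |C'| * ‖((besselOp b ^ K) f).toLp 2 μ‖ := (mul_assoc _ _ _).symm

/-- Multiplication by `1 + ‖x‖²`. -/
def weightOp : 𝓢(E, ℂ) →L[ℂ] 𝓢(E, ℂ) :=
  ContinuousLinearMap.id ℂ _ + ∑ i, posOp (b i) ∘L posOp (b i)

theorem tame_weightOp : Tame b μ (weightOp b) :=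
  Tame.id.add (Tame.sum _ fun i => (tame_posOp i).comp (tame_posOp i))

omit [FiniteDimensional ℝ E] [MeasurableSpace E] [BorelSpace E] [DecidableEq ι] in
theorem weightOp_pow_apply (k : ℕ) (f : 𝓢(E, ℂ)) (x : E) :
    (weightOp b ^ k) f x = ((1 + ‖x‖ ^ 2) ^ k : ℝ) * f x := by
  induction k with
  | zero => simp
  | succ k ih =>
    have h : (weightOp b ^ (k + 1)) f = weightOp b ((weightOp b ^ k) f) := by
      rw [pow_succ']; rfl
    have hw : ∀ g : 𝓢(E, ℂ), weightOp b g x = ((1 + ‖x‖ ^ 2 : ℝ) : ℂ) * g x := fun g => by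
      rw [← b.sum_sq_inner_right x, weightOp]
      simp only [add_apply, _root_.sum_apply, ContinuousLinearMap.id_apply,
        ContinuousLinearMap.comp_apply, posOp_apply]
      push_cast
      rw [add_mul, one_mul, Finset.sum_mul]
      congr 1
      exact Finset.sum_congr rfl fun i _ => by ring
    rw [h, hw, ih, pow_succ]
    push_cast
    ring

theorem tame_iteratedLineDeriv {m : ℕ} (t : Fin m → ι) :
    Tame b μ (iteratedLineDerivOpCLM ℂ 𝓢(E, ℂ) fun i => b (t i)) := by
  induction m with
  | zero => exact Tame.id
  | succ m ih =>
    have h := (tame_derOp (b := b) (μ := μ) (t 0)).comp (ih fun i => t i.succ)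
    have h1 : iteratedLineDerivOpCLM ℂ 𝓢(E, ℂ) (fun i => b (t i)) =
        derOp (b (t 0)) ∘L iteratedLineDerivOpCLM ℂ 𝓢(E, ℂ) fun i => b (t (Fin.succ i)) := by
      ext1 f
      exact iteratedLineDerivOp_succ_left (E := 𝓢(E, ℂ)) (fun i => b (t i)) f
    rwa [h1]

/-- The general Schwartz seminorm is dominated by finitely many sup norms composed with basis
derivatives and powers of `1 + ‖x‖ ^ 2`, all of which are tame. -/
theorem polyOnHermite_seminorm (k m : ℕ) : PolyOnHermite b μ (SchwartzMap.seminorm ℂ k m) := by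
  have h : ∀ t : Fin m → ι, PolyOnHermite b μ ((SchwartzMap.seminorm ℂ 0 0).comp
      ((weightOp b ^ k) ∘L iteratedLineDerivOpCLM ℂ 𝓢(E, ℂ) fun i => b (t i)).toLinearMap) :=
    fun t => ((tame_weightOp b μ).pow k).comp (tame_iteratedLineDeriv b μ t) _
      (polyOnHermite_sup b μ)
  refine (PolyOnHermite.sum Finset.univ h).of_le 1 fun f => ?_
  rw [one_mul]
  refine SchwartzMap.seminorm_le_bound ℂ k m f (apply_nonneg _ _) fun x => ?_
  rw [_root_.sum_apply]
  refine (mul_le_mul_of_nonneg_left (norm_multilinear_le_sum b _) (by positivity)).trans ?_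
  rw [Finset.mul_sum]
  refine Finset.sum_le_sum fun t _ => ?_
  refine le_trans ?_ (SchwartzMap.norm_le_seminorm ℂ _ x)
  change _ ≤ ‖(weightOp b ^ k) (∂^{fun i => b (t i)} f) x‖
  rw [weightOp_pow_apply, SchwartzMap.iteratedLineDerivOp_eq_iteratedFDeriv, norm_mul,
    Complex.norm_real, Real.norm_of_nonneg (by positivity)]
  gcongr
  nlinarith [sq_nonneg (‖x‖ - 1)]

theorem polyOnHermite_of_continuous (p : Seminorm ℂ 𝓢(E, ℂ)) (hp : Continuous p) :
    PolyOnHermite b μ p := by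
  obtain ⟨s, C, -, h⟩ := Seminorm.bound_of_continuous (schwartz_withSeminorms ℂ E ℂ) p hp
  refine (PolyOnHermite.sum s fun i => polyOnHermite_seminorm b μ i.1 i.2).of_le C fun f => ?_
  refine (h f).trans ?_
  rw [smul_apply, NNReal.smul_def, smul_eq_mul]
  exact mul_le_mul_of_nonneg_left (Seminorm.finset_sup_le_sum _ s f) C.coe_nonneg

/-- The number operator, shifted by one. -/
def numberOp : 𝓢(E, ℂ) →L[ℂ] 𝓢(E, ℂ) :=
  ContinuousLinearMap.id ℂ _ +
    (1 / 2 : ℂ) • ∑ i, (posOp (b i) - derOp (b i)) ∘L (posOp (b i) + derOp (b i))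

theorem numberOp_hermite (j : ι → ℕ) :
    numberOp b (hermite b μ j) = (multiWeight j : ℂ) • hermite b μ j := by
  have h : ∀ i, (posOp (b i) - derOp (b i)) ((posOp (b i) + derOp (b i)) (hermite b μ j)) =
      (2 * j i : ℂ) • hermite b μ j := by
    intro i
    rw [hermite, map_smul, map_smul, smul_comm (2 * j i : ℂ)]
    congr 1
    exact (oscillator b).raise_lower_state j i
  simp only [numberOp, add_apply, smul_apply, _root_.sum_apply, ContinuousLinearMap.comp_apply,
    ContinuousLinearMap.id_apply, multiWeight] at h ⊢
  simp only [h, ← Finset.sum_smul, smul_smul]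
  rw [← one_smul ℂ (hermite b μ j), smul_smul, smul_smul, ← add_smul, ← Finset.mul_sum]
  congr 1
  push_cast
  ring

theorem integralMul_numberOp (f g : 𝓢(E, ℂ)) :
    integralMul μ g (numberOp b f) = integralMul μ (numberOp b g) f := by
  have h : ∀ i, integralMul μ g ((oscillator b).raise i ((oscillator b).lower i f)) =
      integralMul μ f ((oscillator b).raise i ((oscillator b).lower i g)) := fun i => by
    rw [integralMul_raise, integralMul_comm, ← integralMul_raise]
  have h1 : ∀ f, numberOp b f = f + (1 / 2 : ℂ) •
      ∑ i, (oscillator b).raise i ((oscillator b).lower i f) := fun f => by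
    simp only [numberOp, add_apply, smul_apply, _root_.sum_apply,
      ContinuousLinearMap.id_apply]
    rfl
  rw [integralMul_comm μ f, h1, h1, map_add, map_add, map_smul, map_smul, map_sum, map_sum,
    integralMul_comm μ g]
  simp only [h]

theorem integralMul_numberOp_pow (N : ℕ) (f g : 𝓢(E, ℂ)) :
    integralMul μ g ((numberOp b ^ N) f) = integralMul μ ((numberOp b ^ N) g) f := by
  induction N generalizing f with
  | zero => rfl
  | succ N ih =>
    have h1 : (numberOp b ^ (N + 1)) f = (numberOp b ^ N) (numberOp b f) := by rw [pow_succ]; rfl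
    have h2 : (numberOp b ^ (N + 1)) g = numberOp b ((numberOp b ^ N) g) := by rw [pow_succ']; rfl
    rw [h1, h2, ih, integralMul_numberOp]

theorem numberOp_pow_hermite (N : ℕ) (j : ι → ℕ) :
    (numberOp b ^ N) (hermite b μ j) = ((multiWeight j ^ N : ℝ) : ℂ) • hermite b μ j := by
  induction N with
  | zero => simp
  | succ N ih =>
    have h1 : (numberOp b ^ (N + 1)) (hermite b μ j) =
      (numberOp b ^ N) (numberOp b (hermite b μ j)) := by rw [pow_succ]; rfl
    rw [h1, numberOp_hermite, map_smul, ih, smul_smul]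
    push_cast
    ring_nf

/-- The weight is the eigenvalue of the symmetric operator `numberOp`, so its powers can be moved
onto `f` before Bessel's bound is applied. -/
theorem integralMul_hermite_decay (N : ℕ) (j : ι → ℕ) (f : 𝓢(E, ℂ)) :
    multiWeight j ^ N * ‖integralMul μ (hermite b μ j) f‖ ≤ ‖((numberOp b ^ N) f).toLp 2 μ‖ := by
  have h := norm_integralMul_hermite_le b μ j ((numberOp b ^ N) f)
  have hw : 0 ≤ multiWeight j := zero_le_one.trans (one_le_multiWeight j)
  rwa [integralMul_numberOp_pow, numberOp_pow_hermite, integralMul_smul, norm_mul,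
    Complex.norm_real, Real.norm_of_nonneg (by positivity)] at h

/-- Multiplication by a coordinate is half the sum of raising and lowering, so it preserves the span
of the Hermite functions. Since the Gaussian lies in that span, so do all its products with powers
of `⟨v, ·⟩`. -/
theorem integralMul_posOp_pow_gaussian {f : 𝓢(E, ℂ)}
    (hf : ∀ j : ι → ℕ, integralMul μ (hermite b μ j) f = 0) (v : E) (k : ℕ) :
    integralMul μ ((posOp v ^ k) (gaussian E)) f = 0 := by
  let W : Submodule ℂ 𝓢(E, ℂ) := Submodule.span ℂ (Set.range (hermite b μ))
  have hpos : ∀ i, ∀ g ∈ W, posOp (b i) g ∈ W := by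
    intro i g hg
    induction hg using Submodule.span_induction with
    | mem g hg =>
      obtain ⟨j, rfl⟩ := hg
      have hr := raise_hermite b μ j i
      have hmem : ∀ l, hermite b μ l ∈ W := fun l => Submodule.subset_span ⟨l, rfl⟩
      have hl : posOp (b i) (hermite b μ j) + derOp (b i) (hermite b μ j) ∈ W := by
        rcases Nat.eq_zero_or_pos (j i) with h0 | h0
        · rw [lower_hermite_of_eq_zero b μ h0]; exact W.zero_mem
        · obtain ⟨j, rfl⟩ : ∃ l, j = l + Pi.single i 1 := ⟨j - Pi.single i 1, by
            ext k
            by_cases hk : k = i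
            · subst hk; simp; omega
            · simp [hk]⟩
          rw [lower_hermite]
          exact W.smul_mem _ (hmem _)
      have hr' : posOp (b i) (hermite b μ j) - derOp (b i) (hermite b μ j) ∈ W := by
        rw [hr]; exact W.smul_mem _ (hmem _)
      have h2 : posOp (b i) (hermite b μ j) = (1 / 2 : ℂ) •
          ((posOp (b i) (hermite b μ j) - derOp (b i) (hermite b μ j)) +
            (posOp (b i) (hermite b μ j) + derOp (b i) (hermite b μ j))) := by
        ext x
        simp
        ring
      rw [h2]
      exact W.smul_mem _ (W.add_mem hr' hl)
    | zero => rw [map_zero]; exact W.zero_mem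
    | add g g' _ _ h h' => rw [map_add]; exact W.add_mem h h'
    | smul c g _ h => rw [map_smul]; exact W.smul_mem _ h
  have hv : posOp v = ∑ i, ((inner ℝ (b i) v : ℝ) : ℂ) • posOp (b i) := by
    ext g x
    simp only [_root_.sum_apply, smul_apply, posOp_apply, smul_eq_mul, ← mul_assoc]
    rw [← Finset.sum_mul]
    congr 1
    rw [← b.sum_inner_mul_inner v x]
    push_cast
    exact Finset.sum_congr rfl fun i _ => by rw [real_inner_comm]
  have hW : ∀ k, (posOp v ^ k) (gaussian E) ∈ W := by
    intro k
    induction k with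
    | zero =>
      change gaussian E ∈ W
      rw [← hermiteState_zero b, hermiteState_eq b μ]
      exact W.smul_mem _ (Submodule.subset_span ⟨0, rfl⟩)
    | succ k ih =>
      have h : (posOp v ^ (k + 1)) (gaussian E) = posOp v ((posOp v ^ k) (gaussian E)) := by
        rw [pow_succ']; rfl
      rw [h, hv]
      simp only [_root_.sum_apply, smul_apply]
      exact W.sum_mem fun i _ => W.smul_mem _ (hpos i _ (by rw [← hv]; exact ih))
  have hle : W ≤ LinearMap.ker (integralMul μ f).toLinearMap := by
    rw [Submodule.span_le]
    rintro _ ⟨j, rfl⟩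
    change integralMul μ f (hermite b μ j) = 0
    rw [integralMul_comm, hf]
  rw [integralMul_comm]
  exact hle (hW k)

end HermiteBasis

/-! ### Totality of the Hermite functions. -/

section HermiteBasis

variable {E : Type} [NormedAddCommGroup E] [InnerProductSpace ℝ E] [FiniteDimensional ℝ E]
  [MeasurableSpace E] [BorelSpace E] {ι : Type} [Fintype ι] [DecidableEq ι]
  (b : OrthonormalBasis ι ℝ E) (μ : Measure E) [μ.IsAddHaarMeasure]

omit [FiniteDimensional ℝ E] [MeasurableSpace E] [BorelSpace E] in
theorem posOp_pow_apply (v : E) (k : ℕ) (f : 𝓢(E, ℂ)) (x : E) :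
    (posOp v ^ k) f x = ((inner ℝ v x : ℝ) : ℂ) ^ k * f x := by
  induction k with
  | zero => simp
  | succ k ih =>
    have h : (posOp v ^ (k + 1)) f = posOp v ((posOp v ^ k) f) := by rw [pow_succ']; rfl
    rw [h, posOp_apply, ih, pow_succ]
    ring

/-- Expand the exponential and integrate term by term; every term is a moment that already vanishes.
-/
theorem integral_exp_inner_mul_gaussian_eq_zero {f : 𝓢(E, ℂ)}
    (hf : ∀ j : ι → ℕ, integralMul μ (hermite b μ j) f = 0) (c : ℂ) (v : E) :
    ∫ x, Complex.exp (c * (inner ℝ v x : ℝ)) * (gaussian E x * f x) ∂μ = 0 := by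
  let F : ℕ → E → ℂ := fun k x =>
    (c * (inner ℝ v x : ℝ)) ^ k / (k.factorial : ℂ) * (gaussian E x * f x)
  have hF : ∀ k, ∫ x, F k x ∂μ = 0 := fun k => by
    have h := integralMul_posOp_pow_gaussian b μ hf v k
    rw [integralMul_comm, integralMul_apply] at h
    have h2 : F k = fun x => (c ^ k / (k.factorial : ℂ)) * ((posOp v ^ k) (gaussian E) x * f x) := by
      funext x
      simp only [F, posOp_pow_apply]
      ring
    rw [h2, integral_const_mul, h, mul_zero]
  have hsum : ∀ z : ℂ, HasSum (fun k : ℕ => z ^ k / (k.factorial : ℂ)) (Complex.exp z) := fun z => by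
    rw [Complex.exp_eq_exp_ℂ]
    exact NormedSpace.expSeries_div_hasSum_exp z
  have hsum' : ∀ t : ℝ, HasSum (fun k : ℕ => t ^ k / (k.factorial : ℝ)) (Real.exp t) := fun t => by
    rw [Real.exp_eq_exp_ℝ]
    exact NormedSpace.expSeries_div_hasSum_exp t
  have hnorm : ∀ x, HasSum (fun k => ‖F k x‖)
      (Real.exp ‖c * (inner ℝ v x : ℝ)‖ * ‖gaussian E x * f x‖) := fun x => by
    have := (hsum' ‖c * (inner ℝ v x : ℝ)‖).mul_right ‖gaussian E x * f x‖
    simpa [F, norm_mul, norm_div, norm_pow] using this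
  have h := hasSum_integral_of_dominated_convergence (μ := μ) (F := F)
    (f := fun x => Complex.exp (c * (inner ℝ v x : ℝ)) * (gaussian E x * f x))
    (fun k x => ‖F k x‖) (fun k => by
      refine Continuous.aestronglyMeasurable ?_
      have h1 := (gaussian E).continuous
      have h2 := f.continuous
      fun_prop) (fun k => Filter.Eventually.of_forall fun x => le_rfl)
    (Filter.Eventually.of_forall fun x => (hnorm x).summable) ?_
    (Filter.Eventually.of_forall fun x => (hsum _).mul_right _)
  · simp only [hF] at h
    exact h.unique hasSum_zero
  · simp only [(hnorm _).tsum_eq]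
    -- The Gaussian absorbs the exponential: `‖c‖ * ‖v‖ * ‖x‖ - ‖x‖ ^ 2 / 2 ≤ (‖c‖ * ‖v‖) ^ 2 / 2`.
    refine ((f.integrable (μ := μ)).norm.const_mul (Real.exp ((‖c‖ * ‖v‖) ^ 2 / 2))).mono' ?_
      (Filter.Eventually.of_forall fun x => ?_)
    · refine Continuous.aestronglyMeasurable ?_
      have h1 := (gaussian E).continuous
      have h2 := f.continuous
      fun_prop
    · rw [norm_mul, norm_norm, norm_mul (gaussian E x), ← mul_assoc, Real.norm_of_nonneg (Real.exp_pos _).le,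
        gaussian_apply, Complex.norm_real, Real.norm_of_nonneg (Real.exp_pos _).le, ← Real.exp_add]
      refine mul_le_mul_of_nonneg_right (Real.exp_le_exp.2 ?_) (norm_nonneg _)
      have h1 : ‖c * (inner ℝ v x : ℝ)‖ ≤ ‖c‖ * ‖v‖ * ‖x‖ := by
        rw [norm_mul, mul_assoc, Complex.norm_real]
        exact mul_le_mul_of_nonneg_left (norm_inner_le_norm _ _) (norm_nonneg _)
      nlinarith [sq_nonneg (‖c‖ * ‖v‖ - ‖x‖)]

/-- With the imaginary constant `-2πi`, the vanishing integrals say that the Fourier transform of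
Gaussian times `f` is zero. Fourier inversion applies, and the Gaussian has no zeros. -/
theorem eq_zero_of_integralMul_hermite {f : 𝓢(E, ℂ)}
    (hf : ∀ j : ι → ℕ, integralMul μ (hermite b μ j) f = 0) : f = 0 := by
  let φ : 𝓢(E, ℂ) := SchwartzMap.pairing (ContinuousLinearMap.mul ℂ ℂ) (gaussian E) f
  have hφ : ∀ x, φ x = gaussian E x * f x := fun x => rfl
  have hc := Measure.isAddLeftInvariant_eq_smul (volume : Measure E) μ
  have h1 : 𝓕 φ = 0 := by
    ext ξ
    rw [SchwartzMap.fourier_coe, Real.fourier_eq', hc, integral_smul_nnreal_measure]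
    have h := integral_exp_inner_mul_gaussian_eq_zero b μ hf (-(2 * Real.pi) * Complex.I) ξ
    have h2 : (fun x => Complex.exp (-(2 * Real.pi) * Complex.I * (inner ℝ ξ x : ℝ)) *
        (gaussian E x * f x)) =
        fun x => Complex.exp (↑(-2 * Real.pi * inner ℝ x ξ) * Complex.I) • φ x := by
      funext x
      rw [hφ, smul_eq_mul, real_inner_comm]
      congr 2
      push_cast
      ring
    rw [h2] at h
    rw [h, smul_zero]
    rfl
  have h2 : φ = 0 := by
    rw [← FourierTransform.fourierInv_fourier_eq (F := 𝓢(E, ℂ)) φ, h1]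
    exact map_zero (FourierTransform.fourierInvCLM ℂ 𝓢(E, ℂ))
  ext x
  have h3 : gaussian E x * f x = 0 := by rw [← hφ, h2]; rfl
  refine (mul_eq_zero.1 h3).resolve_left ?_
  rw [gaussian_apply]
  exact_mod_cast (Real.exp_pos _).ne'

/-- The Hermite functions form a rapid basis of the Schwartz space. -/
def hermiteBasis : RapidBasis E (ι → ℕ) where
  e := hermite b μ
  coeff j := integralMul μ (hermite b μ j)
  wt := multiWeight
  one_le_wt := one_le_multiWeight
  exists_summable := exists_summable_multiWeight
  coeff_self := integralMul_hermite_self b μ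
  coeff_ne i j h := integralMul_hermite_ne b μ h.symm
  total f hf := eq_zero_of_integralMul_hermite b μ hf
  decay N := ⟨(l2Seminorm μ).comp (numberOp b ^ N).toLinearMap,
    (continuous_l2Seminorm μ).comp (numberOp b ^ N).continuous,
    fun j v => integralMul_hermite_decay b μ N j v⟩
  growth p hp := by
    obtain ⟨C, M, hC, h⟩ := polyOnHermite_of_continuous b μ p hp
    exact ⟨C, M, hC, h⟩

end HermiteBasis

/-! ### Hermite functions on `Ξ` and on `Ξ × Ξ` -/

namespace RapidBasis

section Transport

variable {E E' : Type*} [NormedAddCommGroup E] [NormedSpace ℝ E] [NormedAddCommGroup E']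
  [NormedSpace ℝ E'] {J J' : Type*}

/-- Transport of a rapid basis along a linear equivalence and a relabelling. -/
def transport (B : RapidBasis E J) (Φ : E ≃L[ℝ] E') (σ : J' ≃ J) : RapidBasis E' J' where
  e j := SchwartzMap.compCLMOfContinuousLinearEquiv ℂ Φ.symm (B.e (σ j))
  coeff j := B.coeff (σ j) ∘L SchwartzMap.compCLMOfContinuousLinearEquiv ℂ Φ
  wt j := B.wt (σ j)
  one_le_wt j := B.one_le_wt _
  exists_summable := by
    obtain ⟨D, hD⟩ := B.exists_summable
    exact ⟨D, hD.comp_injective σ.injective⟩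
  coeff_self j := by
    rw [← B.coeff_self (σ j), ContinuousLinearMap.comp_apply]
    congr 1
    ext x
    simp
  coeff_ne i j h := by
    rw [← B.coeff_ne _ _ (σ.injective.ne h), ContinuousLinearMap.comp_apply]
    congr 1
    ext x
    simp
  total v hv := by
    have h := B.total (SchwartzMap.compCLMOfContinuousLinearEquiv ℂ Φ v) fun j => by
      simpa using hv (σ.symm j)
    ext x
    have h1 := DFunLike.congr_fun h (Φ.symm x)
    simpa using h1
  decay N := by
    obtain ⟨p, hp, h⟩ := B.decay N
    exact ⟨p.comp (SchwartzMap.compCLMOfContinuousLinearEquiv ℂ Φ).toLinearMap,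
      hp.comp (SchwartzMap.compCLMOfContinuousLinearEquiv ℂ Φ).continuous, fun j v => h _ _⟩
  growth p hp := by
    obtain ⟨C, M, hC, h⟩ := B.growth
      (p.comp (SchwartzMap.compCLMOfContinuousLinearEquiv ℂ Φ.symm).toLinearMap)
      (hp.comp (SchwartzMap.compCLMOfContinuousLinearEquiv ℂ Φ.symm).continuous)
    exact ⟨C, M, hC, fun j => h _⟩

end Transport

end RapidBasis

section DoublePhaseSpace

variable (n : ℕ)

/-- The multi-indices of the Hermite functions on `Ξ`. -/
abbrev HermiteIndex : Type := Fin n ⊕ Fin n → ℕ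

/-- The Hermite basis of `𝓢(Ξ)`. -/
def phaseBasis : RapidBasis (PhaseSpace n) (HermiteIndex n) :=
  hermiteBasis (EuclideanSpace.basisFun (Fin n ⊕ Fin n) ℝ) (phaseMeasure n)

/-- `Ξ × Ξ` with its Euclidean norm. -/
abbrev DoubleSpace : Type := WithLp 2 (PhaseSpace n × PhaseSpace n)

/-- The identity map from `Ξ × Ξ` with the Euclidean norm to `Ξ × Ξ` with the maximum norm. -/
abbrev doubleEquiv : DoubleSpace n ≃L[ℝ] PhaseSpace n × PhaseSpace n :=
  WithLp.prodContinuousLinearEquiv 2 ℝ _ _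

/-- The Haar measure of `DoubleSpace n`. -/
def doubleMeasure : Measure (DoubleSpace n) :=
  ((phaseMeasure n).prod (phaseMeasure n)).map (doubleEquiv n).symm

instance : (doubleMeasure n).IsAddHaarMeasure :=
  (doubleEquiv n).symm.isAddHaarMeasure_map _

variable {n}

theorem integral_doubleMeasure (f : DoubleSpace n → ℂ) :
    ∫ x, f x ∂(doubleMeasure n) =
      ∫ p, f ((doubleEquiv n).symm p) ∂((phaseMeasure n).prod (phaseMeasure n)) :=
  integral_map_equiv (doubleEquiv n).symm.toHomeomorph.toMeasurableEquiv f

/-- The elementary tensor on `DoubleSpace n`. -/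
def doubleTensor (f g : 𝓢(PhaseSpace n, ℂ)) : 𝓢(DoubleSpace n, ℂ) :=
  SchwartzMap.compCLMOfContinuousLinearEquiv ℂ (doubleEquiv n) (tensor f g)

theorem doubleTensor_apply (f g : 𝓢(PhaseSpace n, ℂ)) (x : DoubleSpace n) :
    doubleTensor f g x = f x.fst * g x.snd := rfl

theorem integral_doubleTensor_mul (f g f' g' : 𝓢(PhaseSpace n, ℂ)) :
    integralMul (doubleMeasure n) (doubleTensor f g) (doubleTensor f' g') =
      integralMul (phaseMeasure n) f f' * integralMul (phaseMeasure n) g g' := by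
  rw [integralMul_apply, integralMul_apply, integralMul_apply, integral_doubleMeasure,
    ← integral_prod_mul]
  refine integral_congr_ae (Filter.Eventually.of_forall fun p => ?_)
  simp only [doubleTensor_apply]
  change f' p.1 * g' p.2 * (f p.1 * g p.2) = _
  ring

variable (n) in
/-- The standard basis of `DoubleSpace n`. -/
abbrev doubleONB : OrthonormalBasis ((Fin n ⊕ Fin n) ⊕ (Fin n ⊕ Fin n)) ℝ (DoubleSpace n) :=
  (EuclideanSpace.basisFun _ ℝ).prod (EuclideanSpace.basisFun _ ℝ)

theorem posOp_inl_doubleTensor (v : PhaseSpace n) (f g : 𝓢(PhaseSpace n, ℂ)) :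
    posOp (WithLp.toLp 2 (v, 0)) (doubleTensor f g) = doubleTensor (posOp v f) g := by
  ext x
  simp only [posOp_apply, doubleTensor_apply, WithLp.prod_inner_apply, inner_zero_left, add_zero,
    mul_assoc]
  rfl

theorem posOp_inr_doubleTensor (v : PhaseSpace n) (f g : 𝓢(PhaseSpace n, ℂ)) :
    posOp (WithLp.toLp 2 (0, v)) (doubleTensor f g) = doubleTensor f (posOp v g) := by
  ext x
  simp only [posOp_apply, doubleTensor_apply, WithLp.prod_inner_apply, inner_zero_left, zero_add]
  rw [mul_left_comm]
  rfl

theorem derOp_of_eq_mul {H E : Type} [NormedAddCommGroup H] [InnerProductSpace ℝ H]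
    [NormedAddCommGroup E] [InnerProductSpace ℝ E] (L₁ L₂ : H →L[ℝ] E) {φ : 𝓢(H, ℂ)}
    {f g : 𝓢(E, ℂ)} (h : ∀ x, φ x = f (L₁ x) * g (L₂ x)) (v x : H) :
    derOp v φ x = f (L₁ x) * derOp (L₂ v) g (L₂ x) + g (L₂ x) * derOp (L₁ v) f (L₁ x) := by
  have h1 : HasFDerivAt φ (f (L₁ x) • (fderiv ℝ g (L₂ x)).comp L₂ +
      g (L₂ x) • (fderiv ℝ f (L₁ x)).comp L₁) x := by
    rw [show (φ : H → ℂ) = fun x => f (L₁ x) * g (L₂ x) from funext h]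
    exact ((f.hasFDerivAt (L₁ x)).comp x L₁.hasFDerivAt).mul
      ((g.hasFDerivAt (L₂ x)).comp x L₂.hasFDerivAt)
  rw [derOp_apply, h1.fderiv]
  rfl

theorem derOp_doubleTensor (v : DoubleSpace n) (f g : 𝓢(PhaseSpace n, ℂ)) (x : DoubleSpace n) :
    derOp v (doubleTensor f g) x =
      f x.fst * derOp v.snd g x.snd + g x.snd * derOp v.fst f x.fst :=
  derOp_of_eq_mul (WithLp.fstL 2 ℝ (PhaseSpace n) (PhaseSpace n))
    (WithLp.sndL 2 ℝ (PhaseSpace n) (PhaseSpace n)) (doubleTensor_apply f g) v x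

theorem derOp_inl_doubleTensor (v : PhaseSpace n) (f g : 𝓢(PhaseSpace n, ℂ)) :
    derOp (WithLp.toLp 2 (v, 0)) (doubleTensor f g) = doubleTensor (derOp v f) g := by
  ext x
  rw [derOp_doubleTensor, doubleTensor_apply, derOp_apply, derOp_apply]
  simp [mul_comm, derOp_apply]

theorem derOp_inr_doubleTensor (v : PhaseSpace n) (f g : 𝓢(PhaseSpace n, ℂ)) :
    derOp (WithLp.toLp 2 (0, v)) (doubleTensor f g) = doubleTensor f (derOp v g) := by
  ext x
  rw [derOp_doubleTensor, doubleTensor_apply, derOp_apply, derOp_apply]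
  simp [derOp_apply]

theorem doubleTensor_sub_left (f f' g : 𝓢(PhaseSpace n, ℂ)) :
    doubleTensor (f - f') g = doubleTensor f g - doubleTensor f' g := by
  ext x
  simp [doubleTensor_apply, sub_mul]

theorem doubleTensor_sub_right (f g g' : 𝓢(PhaseSpace n, ℂ)) :
    doubleTensor f (g - g') = doubleTensor f g - doubleTensor f g' := by
  ext x
  simp [doubleTensor_apply, mul_sub]

/-- The Gaussian factorizes for the Euclidean norm on the product, and each raising operator acts on
one tensor factor only. -/
theorem hermiteState_double (j : (Fin n ⊕ Fin n) ⊕ (Fin n ⊕ Fin n) → ℕ) :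
    hermiteState (doubleONB n) j =
      doubleTensor (hermiteState (EuclideanSpace.basisFun _ ℝ) (j ∘ Sum.inl))
        (hermiteState (EuclideanSpace.basisFun _ ℝ) (j ∘ Sum.inr)) := by
  induction j using LadderSystem.induction_multiIndex with
  | h0 =>
    change hermiteState _ 0 = doubleTensor (hermiteState _ 0) (hermiteState _ 0)
    rw [hermiteState_zero, hermiteState_zero]
    ext x
    rw [doubleTensor_apply, gaussian_apply, gaussian_apply, gaussian_apply,
      ← Complex.ofReal_mul, ← Real.exp_add, WithLp.prod_norm_sq_eq_of_L2]
    congr 2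
    ring
  | h1 j i ih =>
    rw [hermiteState_add_single, ih]
    rcases i with i | i
    · have h1 : (j + Pi.single (Sum.inl i) 1) ∘ Sum.inl = j ∘ Sum.inl + Pi.single i 1 := by
        ext k
        by_cases hk : k = i
        · subst hk; simp
        · simp [hk]
      have h2 : (j + Pi.single (Sum.inl i) 1) ∘ Sum.inr = j ∘ Sum.inr := by
        ext k; simp
      have h3 : doubleONB n (Sum.inl i) =
        WithLp.toLp 2 (EuclideanSpace.basisFun (Fin n ⊕ Fin n) ℝ i, 0) := by
        rw [OrthonormalBasis.prod_apply]; rfl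
      rw [h1, h2, hermiteState_add_single, h3, posOp_inl_doubleTensor, derOp_inl_doubleTensor,
        doubleTensor_sub_left]
    · have h1 : (j + Pi.single (Sum.inr i) 1) ∘ Sum.inr = j ∘ Sum.inr + Pi.single i 1 := by
        ext k
        by_cases hk : k = i
        · subst hk; simp
        · simp [hk]
      have h2 : (j + Pi.single (Sum.inr i) 1) ∘ Sum.inl = j ∘ Sum.inl := by
        ext k; simp
      have h3 : doubleONB n (Sum.inr i) =
        WithLp.toLp 2 (0, EuclideanSpace.basisFun (Fin n ⊕ Fin n) ℝ i) := by
        rw [OrthonormalBasis.prod_apply]; rfl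
      rw [h1, h2, hermiteState_add_single, h3, posOp_inr_doubleTensor, derOp_inr_doubleTensor,
        doubleTensor_sub_right]

theorem hermite_double (j : (Fin n ⊕ Fin n) ⊕ (Fin n ⊕ Fin n) → ℕ) :
    hermite (doubleONB n) (doubleMeasure n) j =
      doubleTensor ((phaseBasis n).e (j ∘ Sum.inl)) ((phaseBasis n).e (j ∘ Sum.inr)) := by
  have h1 : hermiteNormSq (doubleONB n) (doubleMeasure n) j =
      hermiteNormSq (EuclideanSpace.basisFun _ ℝ) (phaseMeasure n) (j ∘ Sum.inl) *
        hermiteNormSq (EuclideanSpace.basisFun _ ℝ) (phaseMeasure n) (j ∘ Sum.inr) := by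
    have h := integralMul_hermiteState_self (doubleONB n) (doubleMeasure n) j
    rw [hermiteState_double, integral_doubleTensor_mul, integralMul_hermiteState_self,
      integralMul_hermiteState_self] at h
    exact_mod_cast h.symm
  change _ = doubleTensor (hermite _ _ _) (hermite _ _ _)
  ext x
  rw [hermite, hermite, hermite, h1, Real.sqrt_mul (hermiteNormSq_pos _ _ _).le,
    hermiteState_double]
  simp only [smul_apply, doubleTensor_apply, smul_eq_mul]
  push_cast
  rw [mul_inv]
  ring

variable (n) in
/-- The basis `e_j ⊗ e_l` of `𝓢(Ξ × Ξ)`. -/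
def tensorBasis : RapidBasis (PhaseSpace n × PhaseSpace n) (HermiteIndex n × HermiteIndex n) :=
  (hermiteBasis (doubleONB n) (doubleMeasure n)).transport (doubleEquiv n)
    (Equiv.sumArrowEquivProdArrow _ _ _).symm

theorem tensorBasis_e (j l : HermiteIndex n) :
    (tensorBasis n).e (j, l) = tensor ((phaseBasis n).e j) ((phaseBasis n).e l) := by
  change SchwartzMap.compCLMOfContinuousLinearEquiv ℂ (doubleEquiv n).symm
    (hermite (doubleONB n) (doubleMeasure n) _) = _
  rw [hermite_double]
  rfl

/-- The bilinear pairing of Schwartz functions on `Ξ × Ξ`. -/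
def doublePairing (F : 𝓢(PhaseSpace n × PhaseSpace n, ℂ)) :
    𝓢(PhaseSpace n × PhaseSpace n, ℂ) →L[ℂ] ℂ :=
  SchwartzMap.toTemperedDistributionCLM (PhaseSpace n × PhaseSpace n) ℂ
        ((phaseMeasure n).prod (phaseMeasure n)) F

theorem doublePairing_apply (F G : 𝓢(PhaseSpace n × PhaseSpace n, ℂ)) :
    doublePairing F G = ∫ p, G p * F p ∂((phaseMeasure n).prod (phaseMeasure n)) :=
  SchwartzMap.toTemperedDistributionCLM_apply_apply _ F G

theorem doublePairing_comm (F G : 𝓢(PhaseSpace n × PhaseSpace n, ℂ)) :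
    doublePairing F G = doublePairing G F := by
  simp only [doublePairing_apply, mul_comm]

theorem phaseBasis_coeff (j : HermiteIndex n) (g : 𝓢(PhaseSpace n, ℂ)) :
    (phaseBasis n).coeff j g = ∫ X, g X * (phaseBasis n).e j X ∂(phaseMeasure n) :=
  integralMul_apply _ _ _

theorem tensorBasis_coeff (j l : HermiteIndex n) (G : 𝓢(PhaseSpace n × PhaseSpace n, ℂ)) :
    (tensorBasis n).coeff (j, l) G =
      doublePairing (tensor ((phaseBasis n).e j) ((phaseBasis n).e l)) G := by
  change integralMul (doubleMeasure n) (hermite (doubleONB n) (doubleMeasure n) _)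
    (SchwartzMap.compCLMOfContinuousLinearEquiv ℂ (doubleEquiv n) G) = _
  rw [hermite_double, integralMul_apply, integral_doubleMeasure, doublePairing_apply]
  rfl

theorem doublePairing_tensor (f g f' g' : 𝓢(PhaseSpace n, ℂ)) :
    doublePairing (tensor f g) (tensor f' g') =
      (∫ X, f' X * f X ∂(phaseMeasure n)) * ∫ X, g' X * g X ∂(phaseMeasure n) := by
  rw [doublePairing_apply, ← integral_prod_mul]
  refine integral_congr_ae (Filter.Eventually.of_forall fun p => ?_)
  change f' p.1 * g' p.2 * (f p.1 * g p.2) = _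
  ring

theorem tensorBasis_coeff_tensor (j l : HermiteIndex n) (f g : 𝓢(PhaseSpace n, ℂ)) :
    (tensorBasis n).coeff (j, l) (tensor f g) =
      (phaseBasis n).coeff j f * (phaseBasis n).coeff l g := by
  rw [tensorBasis_coeff, doublePairing_tensor, phaseBasis_coeff, phaseBasis_coeff]

theorem tensorBasis_wt (j l : HermiteIndex n) :
    (tensorBasis n).wt (j, l) = (phaseBasis n).wt j + (phaseBasis n).wt l - 1 := by
  change multiWeight _ = multiWeight j + multiWeight l - 1
  simp only [multiWeight, Fintype.sum_sum_type]
  simp only [Equiv.sumArrowEquivProdArrow, Equiv.coe_fn_symm_mk, Sum.elim_inl, Sum.elim_inr]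
  ring

theorem wt_le_tensorBasis_wt_left (j l : HermiteIndex n) :
    (phaseBasis n).wt j ≤ (tensorBasis n).wt (j, l) := by
  rw [tensorBasis_wt]
  linarith [(phaseBasis n).one_le_wt l]

theorem wt_le_tensorBasis_wt_right (j l : HermiteIndex n) :
    (phaseBasis n).wt l ≤ (tensorBasis n).wt (j, l) := by
  rw [tensorBasis_wt]
  linarith [(phaseBasis n).one_le_wt j]

/-- This is `(w_j - 1) * (w_l - 1) ≥ 0`. With the two previous comparisons, polynomial bounds in the
joint weight and in the pair of weights are interchangeable. -/
theorem tensorBasis_wt_le (j l : HermiteIndex n) :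
    (tensorBasis n).wt (j, l) ≤ (phaseBasis n).wt j * (phaseBasis n).wt l := by
  rw [tensorBasis_wt]
  nlinarith [(phaseBasis n).one_le_wt j, (phaseBasis n).one_le_wt l]

theorem tensorBasis_wt_pow_le (j l : HermiteIndex n) (N : ℕ) :
    (tensorBasis n).wt (j, l) ^ N ≤ (phaseBasis n).wt j ^ N * (phaseBasis n).wt l ^ N := by
  rw [← mul_pow]
  exact pow_le_pow_left₀ ((tensorBasis n).wt_pos _).le (tensorBasis_wt_le j l) N

/-! ### Bounded bilinear maps -/

section Bounded

variable {E' : Type*} [NormedAddCommGroup E'] [NormedSpace ℝ E']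

/-- Joint continuity of a bilinear map on `𝓢(Ξ) × 𝓢(Ξ)`, in terms of seminorms. -/
def BoundedBilin (b : 𝓢(PhaseSpace n, ℂ) →ₗ[ℂ] 𝓢(PhaseSpace n, ℂ) →ₗ[ℂ] 𝓢(E', ℂ)) : Prop :=
  ∀ p : Seminorm ℂ 𝓢(E', ℂ), Continuous p → ∃ q q' : Seminorm ℂ 𝓢(PhaseSpace n, ℂ),
    Continuous q ∧ Continuous q' ∧ ∀ f g, p (b f g) ≤ q f * q' g

theorem BoundedBilin.continuous_right
    {b : 𝓢(PhaseSpace n, ℂ) →ₗ[ℂ] 𝓢(PhaseSpace n, ℂ) →ₗ[ℂ] 𝓢(E', ℂ)} (hb : BoundedBilin b)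
    (f : 𝓢(PhaseSpace n, ℂ)) : Continuous (b f) := by
  refine continuous_of_seminorm_comp _ fun p hp => ?_
  obtain ⟨q, q', -, hq', h⟩ := hb p hp
  refine ⟨(q f).toNNReal • q', hq'.const_smul _, fun g => ?_⟩
  rw [smul_apply, NNReal.smul_def, Real.coe_toNNReal _ (apply_nonneg q f)]
  exact h f g

theorem BoundedBilin.flip
    {b : 𝓢(PhaseSpace n, ℂ) →ₗ[ℂ] 𝓢(PhaseSpace n, ℂ) →ₗ[ℂ] 𝓢(E', ℂ)} (hb : BoundedBilin b) :
    BoundedBilin b.flip := fun p hp =>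
  let ⟨q, q', hq, hq', h⟩ := hb p hp
  ⟨q', q, hq', hq, fun f g => (h g f).trans_eq (mul_comm _ _)⟩

theorem BoundedBilin.comp
    {b : 𝓢(PhaseSpace n, ℂ) →ₗ[ℂ] 𝓢(PhaseSpace n, ℂ) →ₗ[ℂ] 𝓢(E', ℂ)} (hb : BoundedBilin b)
    (T₁ T₂ : 𝓢(PhaseSpace n, ℂ) →L[ℂ] 𝓢(PhaseSpace n, ℂ)) :
    BoundedBilin (b.compl₁₂ T₁.toLinearMap T₂.toLinearMap) := fun p hp =>
  let ⟨q, q', hq, hq', h⟩ := hb p hp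
  ⟨q.comp T₁.toLinearMap, q'.comp T₂.toLinearMap, hq.comp T₁.continuous, hq'.comp T₂.continuous,
    fun _ _ => h _ _⟩

variable (n) in
/-- The bilinear map `(f, g) ↦ f ⊗ g`. -/
def tensorBilin :
    𝓢(PhaseSpace n, ℂ) →ₗ[ℂ] 𝓢(PhaseSpace n, ℂ) →ₗ[ℂ] 𝓢(PhaseSpace n × PhaseSpace n, ℂ) :=
  LinearMap.mk₂ ℂ tensor (fun _ _ _ => by ext p; exact add_mul _ _ _)
    (fun _ _ _ => by ext p; exact mul_assoc _ _ _) (fun _ _ _ => by ext p; exact mul_add _ _ _)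
    (fun _ _ _ => by ext p; exact mul_left_comm _ _ _)

/-- Coefficients of a tensor are products of coefficients and the joint weight is at most the
product of weights, so the decay estimates multiply. -/
theorem boundedBilin_tensorBilin : BoundedBilin (tensorBilin n) := by
  intro p hp
  obtain ⟨N, K, hK, h⟩ := (tensorBasis n).seminorm_le_of_coeff hp
  obtain ⟨q, hq, hd⟩ := (phaseBasis n).decay N
  refine ⟨K.toNNReal • q, q, hq.const_smul _, hq, fun f g => ?_⟩
  rw [smul_apply, NNReal.smul_def, Real.coe_toNNReal _ hK, smul_eq_mul, mul_assoc]
  refine h _ _ fun ⟨j, l⟩ => ?_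
  change _ * ‖(tensorBasis n).coeff (j, l) (tensor f g)‖ ≤ _
  rw [tensorBasis_coeff_tensor, norm_mul]
  calc _ ≤ (phaseBasis n).wt j ^ N * (phaseBasis n).wt l ^ N *
        (‖(phaseBasis n).coeff j f‖ * ‖(phaseBasis n).coeff l g‖) :=
        mul_le_mul_of_nonneg_right (tensorBasis_wt_pow_le j l N) (by positivity)
    _ = ((phaseBasis n).wt j ^ N * ‖(phaseBasis n).coeff j f‖) *
        ((phaseBasis n).wt l ^ N * ‖(phaseBasis n).coeff l g‖) := by ring
    _ ≤ _ := mul_le_mul (hd j f) (hd l g)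
        (mul_nonneg (pow_nonneg ((phaseBasis n).wt_pos l).le _) (norm_nonneg _))
        (apply_nonneg _ _)

variable (n) in
/-- `g ↦ f ⊗ g` as a continuous linear map. -/
def tensorLeft (f : 𝓢(PhaseSpace n, ℂ)) :
    𝓢(PhaseSpace n, ℂ) →L[ℂ] 𝓢(PhaseSpace n × PhaseSpace n, ℂ) :=
  ⟨tensorBilin n f, boundedBilin_tensorBilin.continuous_right f⟩

variable (n) in
/-- `f ↦ f ⊗ g` as a continuous linear map. -/
def tensorFlip (g : 𝓢(PhaseSpace n, ℂ)) :
    𝓢(PhaseSpace n, ℂ) →L[ℂ] 𝓢(PhaseSpace n × PhaseSpace n, ℂ) :=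
  ⟨(tensorBilin n).flip g, boundedBilin_tensorBilin.flip.continuous_right g⟩

/-- Expand one argument at a time in the basis; joint continuity is never needed. -/
theorem eq_of_separatelyContinuous {W : Type*} [AddCommGroup W] [Module ℂ W] [TopologicalSpace W]
    [T2Space W] {b b' : 𝓢(PhaseSpace n, ℂ) →ₗ[ℂ] 𝓢(PhaseSpace n, ℂ) →ₗ[ℂ] W}
    (h1 : ∀ f, Continuous fun g => b f g) (h2 : ∀ g, Continuous fun f => b f g)
    (h1' : ∀ f, Continuous fun g => b' f g) (h2' : ∀ g, Continuous fun f => b' f g)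
    (h : ∀ j l, b ((phaseBasis n).e j) ((phaseBasis n).e l) =
      b' ((phaseBasis n).e j) ((phaseBasis n).e l)) (f g : 𝓢(PhaseSpace n, ℂ)) :
    b f g = b' f g := by
  have h3 : ∀ j g, b ((phaseBasis n).e j) g = b' ((phaseBasis n).e j) g := fun j g =>
    DFunLike.congr_fun ((phaseBasis n).hom_ext (T₁ := ⟨b ((phaseBasis n).e j), h1 _⟩)
      (T₂ := ⟨b' ((phaseBasis n).e j), h1' _⟩) fun l => h j l) g
  exact DFunLike.congr_fun ((phaseBasis n).hom_ext (T₁ := ⟨b.flip g, h2 g⟩)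
      (T₂ := ⟨b'.flip g, h2' g⟩) fun j => h3 j g) f

/-- Every jointly continuous bilinear map factors through the tensor product. -/
theorem BoundedBilin.exists_lift
    {b : 𝓢(PhaseSpace n, ℂ) →ₗ[ℂ] 𝓢(PhaseSpace n, ℂ) →ₗ[ℂ] 𝓢(E', ℂ)} (hb : BoundedBilin b) :
    ∃ T : 𝓢(PhaseSpace n × PhaseSpace n, ℂ) →L[ℂ] 𝓢(E', ℂ), ∀ f g, T (tensor f g) = b f g := by
  obtain ⟨T, hT⟩ := (tensorBasis n).exists_extension
    (f := fun j => b ((phaseBasis n).e j.1) ((phaseBasis n).e j.2)) fun p hp => by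
      obtain ⟨q, q', hq, hq', h⟩ := hb p hp
      obtain ⟨C, M, hC, h1⟩ := (phaseBasis n).growth q hq
      obtain ⟨C', M', hC', h2⟩ := (phaseBasis n).growth q' hq'
      refine ⟨C * C', M + M', mul_nonneg hC hC', fun ⟨j, l⟩ => ?_⟩
      have hw := (phaseBasis n).wt_pos
      calc _ ≤ q ((phaseBasis n).e j) * q' ((phaseBasis n).e l) := h _ _
        _ ≤ (C * (phaseBasis n).wt j ^ M) * (C' * (phaseBasis n).wt l ^ M') :=
          mul_le_mul (h1 j) (h2 l) (apply_nonneg _ _)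
            (mul_nonneg hC (pow_nonneg (hw j).le _))
        _ ≤ (C * (tensorBasis n).wt (j, l) ^ M) * (C' * (tensorBasis n).wt (j, l) ^ M') := by
          have h3 := pow_le_pow_left₀ (hw j).le (wt_le_tensorBasis_wt_left j l) M
          have h4 := pow_le_pow_left₀ (hw l).le (wt_le_tensorBasis_wt_right j l) M'
          have h5 := pow_nonneg (hw l).le M'
          have h6 := pow_nonneg ((tensorBasis n).wt_pos (j, l)).le M
          gcongr
        _ = _ := by rw [pow_add]; ring
  refine ⟨T, eq_of_separatelyContinuous (b := (tensorBilin n).compr₂ T.toLinearMap) (b' := b)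
    (fun f => T.continuous.comp (tensorLeft n f).continuous)
    (fun g => T.continuous.comp (tensorFlip n g).continuous) hb.continuous_right
    hb.flip.continuous_right fun j l => ?_⟩
  rw [← hT (j, l), tensorBasis_e]
  rfl

/-- A continuous linear map on `𝓢(Ξ × Ξ)` is determined by its values on elementary tensors. -/
theorem tensor_hom_ext {W : Type*} [AddCommGroup W] [Module ℂ W] [TopologicalSpace W] [T2Space W]
    {T₁ T₂ : 𝓢(PhaseSpace n × PhaseSpace n, ℂ) →L[ℂ] W}
    (h : ∀ f g, T₁ (tensor f g) = T₂ (tensor f g)) : T₁ = T₂ :=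
  (tensorBasis n).hom_ext fun ⟨j, l⟩ => by rw [tensorBasis_e, h]

end Bounded

end DoublePhaseSpace

/-! ### Uniform boundedness for bilinear forms on Schwartz spaces -/

section UniformBoundedness

variable {E E' : Type*} [NormedAddCommGroup E] [NormedSpace ℝ E] [NormedAddCommGroup E']
  [NormedSpace ℝ E']

/-- Banach–Steinhaus on a barrelled space. -/
theorem exists_seminorm_bound {σ : Type*} (u : σ → 𝓢(E, ℂ) →L[ℂ] ℂ)
    (h : ∀ f, ∃ C, ∀ s, ‖u s f‖ ≤ C) :
    ∃ q : Seminorm ℂ 𝓢(E, ℂ), Continuous q ∧ ∀ s f, ‖u s f‖ ≤ q f := by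
  have hw := norm_withSeminorms ℂ ℂ
  have h1 : UniformEquicontinuous (DFunLike.coe ∘ u) := hw.banach_steinhaus fun _ f => by
    obtain ⟨C, hC⟩ := h f
    exact ⟨C, by rintro _ ⟨s, rfl⟩; exact hC s⟩
  obtain ⟨q, hq, h2⟩ := (hw.uniformEquicontinuous_iff_exists_continuous_seminorm
    fun s => (u s).toLinearMap).1 h1 0
  exact ⟨q, hq, fun s f => h2 s f⟩

/-- A fundamental sequence of seminorms on the Schwartz space. -/
def seqSeminorm (E : Type*) [NormedAddCommGroup E] [NormedSpace ℝ E] (m : ℕ) :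
    Seminorm ℂ 𝓢(E, ℂ) :=
  (m : NNReal) • (Finset.Iic (m, m)).sup (schwartzSeminormFamily ℂ E ℂ)

theorem continuous_seqSeminorm (m : ℕ) : Continuous (seqSeminorm E m) :=
  (continuous_finsetSup _).const_smul _

theorem exists_le_seqSeminorm {q : Seminorm ℂ 𝓢(E, ℂ)} (hq : Continuous q) :
    ∃ m, ∀ f, q f ≤ seqSeminorm E m f := by
  obtain ⟨s, C, -, h⟩ := Seminorm.bound_of_continuous (schwartz_withSeminorms ℂ E ℂ) q hq
  -- The index has to dominate the constant as well as the orders, since `seqSeminorm` also carries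
  -- `m` as a factor.
  obtain ⟨m₁, h₁⟩ := exists_nat_ge C
  let m₂ := s.sup fun i => max i.1 i.2
  have hs : s ⊆ Finset.Iic (max m₁ m₂, max m₁ m₂) := fun i hi => by
    have h2 : max i.1 i.2 ≤ m₂ := Finset.le_sup (f := fun i : ℕ × ℕ => max i.1 i.2) hi
    exact Finset.mem_Iic.2 ⟨by simp; omega, by simp; omega⟩
  refine ⟨max m₁ m₂, fun f => (h f).trans ?_⟩
  rw [seqSeminorm, smul_apply, smul_apply, NNReal.smul_def, NNReal.smul_def, smul_eq_mul,
    smul_eq_mul]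
  have h3 : s.sup (schwartzSeminormFamily ℂ E ℂ) ≤ _ := Finset.sup_mono hs
  refine mul_le_mul (NNReal.coe_le_coe.2 (h₁.trans ?_)) (h3 f) (apply_nonneg _ _)
    (NNReal.coe_nonneg _)
  exact_mod_cast le_max_left m₁ m₂

theorem norm_le_of_ball {u : 𝓢(E, ℂ) →ₗ[ℂ] ℂ} {q : Seminorm ℂ 𝓢(E, ℂ)} {r K : ℝ} (hr : 0 < r)
    (hK : 0 ≤ K) (h : ∀ f, q f < r → ‖u f‖ ≤ K) (f : 𝓢(E, ℂ)) : ‖u f‖ ≤ K / r * q f := by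
  -- Rescaling by `r / c` with `c` strictly above `q f` avoids dividing by `q f`, which may vanish.
  have h1 : ∀ c, q f < c → ‖u f‖ ≤ K / r * c := fun c hc => by
    have hc0 : 0 < c := (apply_nonneg q f).trans_lt hc
    have h2 := h (((r / c : ℝ) : ℂ) • f) (by
      rw [map_smul_eq_mul, Complex.norm_real, Real.norm_of_nonneg (by positivity), div_mul_eq_mul_div,
        div_lt_iff₀ hc0]
      exact mul_lt_mul_of_pos_left hc hr)
    rw [map_smul, norm_smul, Complex.norm_real, Real.norm_of_nonneg (by positivity),
      div_mul_eq_mul_div, div_le_iff₀ hc0] at h2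
    rw [div_mul_eq_mul_div, le_div_iff₀ hr]
    linarith
  refine le_of_forall_pos_le_add fun ε hε => ?_
  have h3 := h1 (q f + ε / (K / r + 1)) (lt_add_of_pos_right _ (by positivity))
  refine h3.trans ?_
  rw [mul_add]
  gcongr
  rw [mul_div_assoc', div_le_iff₀ (by positivity)]
  nlinarith

/-- A Baire argument. The sets of `f` for which the `m`-th seminorm bounds all `β s f` are closed by
continuity in `f` and cover the space by Banach–Steinhaus in `g`. Some set contains a ball around a
point `f₀`; subtracting the value at `f₀` moves the ball to the origin and costs the factor `2`. -/
theorem exists_seminorm_bound_bilin {σ : Type*} (β : σ → 𝓢(E, ℂ) →ₗ[ℂ] 𝓢(E', ℂ) →ₗ[ℂ] ℂ)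
    (hr : ∀ s f, Continuous fun g => β s f g) (hl : ∀ s g, Continuous fun f => β s f g)
    (hb : ∀ f g, ∃ C, ∀ s, ‖β s f g‖ ≤ C) :
    ∃ (q : Seminorm ℂ 𝓢(E, ℂ)) (q' : Seminorm ℂ 𝓢(E', ℂ)), Continuous q ∧ Continuous q' ∧
      ∀ s f g, ‖β s f g‖ ≤ q f * q' g := by
  let A : ℕ → Set 𝓢(E, ℂ) := fun m => {f | ∀ s g, ‖β s f g‖ ≤ seqSeminorm E' m g}
  have hA : ∀ m, IsClosed (A m) := fun m => by
    simp only [A, Set.ofPred_forall]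
    exact isClosed_iInter fun s => isClosed_iInter fun g =>
      isClosed_le (hl s g).norm continuous_const
  have hU : ⋃ m, A m = Set.univ := by
    refine Set.eq_univ_of_forall fun f => ?_
    obtain ⟨q, hq, h⟩ := exists_seminorm_bound (fun s => (⟨β s f, hr s f⟩ : 𝓢(E', ℂ) →L[ℂ] ℂ))
      (hb f)
    obtain ⟨m, hm⟩ := exists_le_seqSeminorm hq
    exact Set.mem_iUnion.2 ⟨m, fun s g => (h s g).trans (hm g)⟩
  obtain ⟨m, f₀, hf₀⟩ := nonempty_interior_of_iUnion_of_closed hA hU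
  obtain ⟨s, r, hr0, hball⟩ := ((schwartz_withSeminorms ℂ E ℂ).isOpen_iff_mem_balls _).1
    isOpen_interior f₀ hf₀
  set q := s.sup (schwartzSeminormFamily ℂ E ℂ)
  refine ⟨(2 / r).toNNReal • q, seqSeminorm E' m, (continuous_finsetSup s).const_smul _,
    continuous_seqSeminorm m, fun t f g => ?_⟩
  rw [smul_apply, NNReal.smul_def, Real.coe_toNNReal _ (by positivity), smul_eq_mul]
  have h0 := interior_subset hf₀ t g
  refine (norm_le_of_ball (u := (β t).flip g) hr0
    (by positivity : 0 ≤ 2 * seqSeminorm E' m g) (fun f hf => ?_) f).trans_eq (by ring)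
  have h1 : f₀ + f ∈ A m := interior_subset (hball (by
    rw [Seminorm.mem_ball, add_sub_cancel_left]; exact hf))
  have h2 := h1 t g
  have h3 : (β t).flip g f = β t (f₀ + f) g - β t f₀ g := by
    rw [map_add, LinearMap.add_apply, add_sub_cancel_left]; rfl
  rw [h3]
  exact (norm_sub_le _ _).trans (by linarith)

end UniformBoundedness

/-! ### Functionals with polynomially bounded coefficients. -/

namespace RapidBasis

variable {E J : Type*} [NormedAddCommGroup E] [NormedSpace ℝ E] (B : RapidBasis E J)

variable {B} in
theorem RapidDecay.summable {a : J → ℂ} (ha : B.RapidDecay a) (N : ℕ) :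
    Summable fun j => B.wt j ^ N * ‖a j‖ := by
  obtain ⟨D, hD⟩ := B.exists_summable
  obtain ⟨A, hA⟩ := ha (N + D)
  refine Summable.of_nonneg_of_le
    (fun j => mul_nonneg (pow_nonneg (B.wt_pos j).le _) (norm_nonneg _)) (fun j => ?_)
    (hD.mul_left A)
  have hw := B.wt_pos j
  rw [← div_eq_mul_inv, le_div_iff₀ (by positivity)]
  refine le_trans (le_of_eq ?_) (hA j)
  rw [pow_add]
  ring

/-- The functional with polynomially bounded coefficients `β`. -/
theorem exists_functional {β : J → ℂ} {C : ℝ} {N : ℕ} (hβ : ∀ j, ‖β j‖ ≤ C * B.wt j ^ N) :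
    ∃ u : 𝓢(E, ℂ) →L[ℂ] ℂ, ∀ v, HasSum (fun j => β j * B.coeff j v) (u v) := by
  obtain ⟨D, hD⟩ := B.exists_summable
  obtain ⟨p, hp, hd⟩ := B.decay (N + D)
  have hle : ∀ v j, ‖β j * B.coeff j v‖ ≤ |C| * p v * (B.wt j ^ D)⁻¹ := fun v j => by
    have hw := B.wt_pos j
    rw [norm_mul, ← div_eq_mul_inv, le_div_iff₀ (by positivity)]
    calc _ ≤ |C| * B.wt j ^ N * ‖B.coeff j v‖ * B.wt j ^ D := by
          have := (hβ j).trans (mul_le_mul_of_nonneg_right (le_abs_self C) (by positivity))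
          gcongr
      _ = |C| * (B.wt j ^ (N + D) * ‖B.coeff j v‖) := by rw [pow_add]; ring
      _ ≤ _ := mul_le_mul_of_nonneg_left (hd j v) (abs_nonneg C)
  have hs : ∀ v, Summable fun j => β j * B.coeff j v := fun v =>
    Summable.of_norm_bounded (hD.mul_left _) (hle v)
  let u : 𝓢(E, ℂ) →ₗ[ℂ] ℂ :=
    { toFun := fun v => ∑' j, β j * B.coeff j v
      map_add' := fun v w => by
        rw [← (hs v).tsum_add (hs w)]
        simp only [map_add, mul_add]
      map_smul' := fun c v => by
        simp only [map_smul, smul_eq_mul, RingHom.id_apply, mul_left_comm _ c, tsum_mul_left] }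
  have hu : Continuous u := by
    refine ((norm_withSeminorms ℂ ℂ).continuous_iff_continuous_comp u).2 fun _ => ?_
    refine Seminorm.continuous_of_le
      (q := (|C| * ∑' j, (B.wt j ^ D)⁻¹).toNNReal • p) (hp.const_smul _) fun v => ?_
    have h0 : 0 ≤ ∑' j, (B.wt j ^ D)⁻¹ :=
      tsum_nonneg fun j => inv_nonneg.2 (pow_nonneg (B.wt_pos j).le _)
    rw [smul_apply, NNReal.smul_def, Real.coe_toNNReal _ (by positivity), smul_eq_mul,
      mul_right_comm, ← tsum_mul_left]
    exact (norm_tsum_le_tsum_norm (hs v).norm).trans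
      ((hs v).norm.tsum_le_tsum (hle v) (hD.mul_left _))
  exact ⟨⟨u, hu⟩, fun v => (hs v).hasSum⟩

end RapidBasis

/-! ### The kernel operator of a composition law -/

namespace CompositionLaw

variable {n : ℕ} (S : CompositionLaw n)

variable (n) in
/-- The integral over phase space. -/
def trace : 𝓢(PhaseSpace n, ℂ) →L[ℂ] ℂ := SchwartzMap.integralCLM ℂ (phaseMeasure n)

theorem trace_mul (f g : 𝓢(PhaseSpace n, ℂ)) :
    trace n (S.mul f g) = ∫ X, f X * g X ∂(phaseMeasure n) := S.integral_mul f g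

theorem trace_mul_comm (f g : 𝓢(PhaseSpace n, ℂ)) : trace n (S.mul f g) = trace n (S.mul g f) := by
  simp only [trace_mul, mul_comm]

/-- `∫ a # b # c # d`. -/
def quad (a b c d : 𝓢(PhaseSpace n, ℂ)) : ℂ := trace n (S.mul a (S.mul b (S.mul c d)))

/-- The integral is a trace for `#`, because `∫ f # g = ∫ f g` is symmetric in `f` and `g`. -/
theorem quad_rotate (a b c d : 𝓢(PhaseSpace n, ℂ)) : S.quad a b c d = S.quad b c d a := by
  rw [quad, trace_mul_comm, S.assoc, S.assoc]
  rfl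

theorem quad_basis (a b c : 𝓢(PhaseSpace n, ℂ)) (l : HermiteIndex n) :
    S.quad a b c ((phaseBasis n).e l) =
      (phaseBasis n).coeff l (S.mul (S.mul a b) c) := by
  rw [phaseBasis_coeff, ← S.trace_mul, S.assoc, S.assoc]
  rfl

theorem quad_eq_integral (a b c d : 𝓢(PhaseSpace n, ℂ)) :
    S.quad a b c d = ∫ X, S.mul a b X * S.mul c d X ∂(phaseMeasure n) := by
  rw [← S.trace_mul, S.assoc]
  rfl

/-- `(a, c) ↦ ∫ a # b # c # d`. -/
def quadForm (b d : 𝓢(PhaseSpace n, ℂ)) :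
    𝓢(PhaseSpace n, ℂ) →ₗ[ℂ] 𝓢(PhaseSpace n, ℂ) →ₗ[ℂ] ℂ :=
  LinearMap.mk₂ ℂ (fun a c => S.quad a b c d)
    (fun _ _ _ => by simp [quad]) (fun _ _ _ => by simp [quad])
    (fun _ _ _ => by simp [quad]) (fun _ _ _ => by simp [quad])

theorem quadForm_apply (a b c d : 𝓢(PhaseSpace n, ℂ)) : S.quadForm b d a c = S.quad a b c d := rfl

theorem continuous_quadForm_right (a b d : 𝓢(PhaseSpace n, ℂ)) :
    Continuous fun c => S.quadForm b d a c :=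
  (trace n).continuous.comp ((S.continuous_left a).comp ((S.continuous_left b).comp
    (S.continuous_right d)))

theorem continuous_quadForm_left (b c d : 𝓢(PhaseSpace n, ℂ)) :
    Continuous fun a => S.quadForm b d a c :=
  (trace n).continuous.comp (S.continuous_right _)

theorem quadForm_swap (a b c d : 𝓢(PhaseSpace n, ℂ)) : S.quadForm b d a c = S.quadForm c a b d :=
  S.quad_rotate a b c d

/-! ### Matrix elements and kernels under the sandwich property. -/

variable {S}

theorem integral_mul_sandwich (hB : S.SandwichProperty) (f : 𝓢(PhaseSpace n, ℂ))
    (u : 𝓢'(PhaseSpace n, ℂ)) (g φ : 𝓢(PhaseSpace n, ℂ)) :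
    ∫ X, φ X * hB.sandwich f u g X ∂(phaseMeasure n) = u (S.mul (S.mul g φ) f) := by
  have h : SchwartzMap.toTemperedDistributionCLM (PhaseSpace n) ℂ (phaseMeasure n)
      (hB.sandwich f u g) = S.distMul (S.mulDist f u) g := (hB f u g).choose_spec
  have h1 := DFunLike.congr_fun h φ
  exact (SchwartzMap.toTemperedDistributionCLM_apply_apply (phaseMeasure n) _ φ).symm.trans h1

theorem coeff_sandwich (hB : S.SandwichProperty) (f : 𝓢(PhaseSpace n, ℂ))
    (u : 𝓢'(PhaseSpace n, ℂ)) (g : 𝓢(PhaseSpace n, ℂ)) (j : HermiteIndex n) :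
    (phaseBasis n).coeff j (hB.sandwich f u g) =
      u (S.mul (S.mul g ((phaseBasis n).e j)) f) := by
  rw [phaseBasis_coeff, ← integral_mul_sandwich hB]
  simp only [mul_comm]

/-- The weighted matrix elements `∫ a # e_j # b # e_l`. -/
def weightedQuad (S : CompositionLaw n) (N : ℕ) (a b : 𝓢(PhaseSpace n, ℂ))
    (s : HermiteIndex n × HermiteIndex n) : ℂ :=
  (((phaseBasis n).wt s.1 ^ N * (phaseBasis n).wt s.2 ^ N : ℝ) : ℂ) *
    S.quad a ((phaseBasis n).e s.1) b ((phaseBasis n).e s.2)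

theorem norm_weightedQuad (N : ℕ) (a b : 𝓢(PhaseSpace n, ℂ))
    (s : HermiteIndex n × HermiteIndex n) : ‖weightedQuad S N a b s‖ =
      (phaseBasis n).wt s.1 ^ N * (phaseBasis n).wt s.2 ^ N *
        ‖S.quad a ((phaseBasis n).e s.1) b ((phaseBasis n).e s.2)‖ := by
  have h1 := (phaseBasis n).wt_pos s.1
  have h2 := (phaseBasis n).wt_pos s.2
  rw [weightedQuad, norm_mul, Complex.norm_real, Real.norm_of_nonneg (by positivity)]

theorem summable_weightedQuad (N : ℕ) (a b : 𝓢(PhaseSpace n, ℂ)) (j : HermiteIndex n) :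
    Summable fun l => ‖weightedQuad S N a b (j, l)‖ := by
  have h := (((phaseBasis n).rapidDecay_coeff
    (S.mul (S.mul a ((phaseBasis n).e j)) b)).summable N).mul_left ((phaseBasis n).wt j ^ N)
  refine h.congr fun l => ?_
  rw [norm_weightedQuad, quad_basis, mul_assoc]

open BoundedContinuousFunction in
-- Here the sandwich property becomes a quantitative estimate. For a bounded sequence `α`, the
-- coefficients `α l * wt l ^ N` define a tempered distribution `u`, and `b # u # a` is Schwartz.
-- Its `j`-th coefficient is the row sum `∑ l, α l * wt l ^ N * ∫ a # e_j # b # e_l`, which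
-- therefore decays rapidly in `j`. Uniform boundedness over `α` turns this into one bound for all
-- pairs `(j, l)`.
theorem exists_norm_weightedQuad_le (hB : S.SandwichProperty) (N : ℕ) (a b : 𝓢(PhaseSpace n, ℂ)) :
    ∃ C, ∀ s, ‖weightedQuad S N a b s‖ ≤ C := by
  classical
  have hs : ∀ (α : HermiteIndex n →ᵇ ℂ) j,
      Summable fun l => ‖α l * weightedQuad S N a b (j, l)‖ := fun α j => by
    refine ((summable_weightedQuad (S := S) N a b j).mul_left ‖α‖).of_nonneg_of_le
      (fun l => norm_nonneg _) fun l => ?_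
    rw [norm_mul]
    exact mul_le_mul_of_nonneg_right (α.norm_coe_le_norm l) (norm_nonneg _)
  -- Each row is absolutely summable, hence a bounded functional on bounded sequences; only the
  -- uniformity in `j` is at stake.
  let Λ : HermiteIndex n → (HermiteIndex n →ᵇ ℂ) →L[ℂ] ℂ := fun j =>
    LinearMap.mkContinuous
      { toFun := fun α => ∑' l, α l * weightedQuad S N a b (j, l)
        map_add' := fun α α' => by
          rw [← (hs α j).of_norm.tsum_add (hs α' j).of_norm]
          simp only [BoundedContinuousFunction.add_apply, add_mul]
        map_smul' := fun c α => by
          simp only [BoundedContinuousFunction.smul_apply, smul_eq_mul, RingHom.id_apply,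
            mul_assoc, tsum_mul_left] }
      (∑' l, ‖weightedQuad S N a b (j, l)‖) fun α => by
        refine (norm_tsum_le_tsum_norm (hs α j)).trans ?_
        rw [mul_comm, ← tsum_mul_left]
        refine (hs α j).tsum_le_tsum (fun l => ?_) ((summable_weightedQuad (S := S) N a b j).mul_left ‖α‖)
        rw [norm_mul]
        exact mul_le_mul_of_nonneg_right (α.norm_coe_le_norm l) (norm_nonneg _)
  have hΛ : ∀ α j, Λ j α = ∑' l, α l * weightedQuad S N a b (j, l) := fun α j => rfl
  obtain ⟨C, hC⟩ := banach_steinhaus (g := Λ) fun α => by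
    obtain ⟨u, hu⟩ := (phaseBasis n).exists_functional
      (β := fun l => α l * ((phaseBasis n).wt l ^ N : ℝ)) (C := ‖α‖) (N := N) fun l => by
        have h1 := (phaseBasis n).wt_pos l
        rw [norm_mul, Complex.norm_real, Real.norm_of_nonneg (by positivity)]
        exact mul_le_mul_of_nonneg_right (α.norm_coe_le_norm l) (by positivity)
    let W := hB.sandwich b (u : 𝓢'(PhaseSpace n, ℂ)) a
    obtain ⟨p, -, hp⟩ := (phaseBasis n).decay N
    refine ⟨p W, fun j => ?_⟩
    have hW : (phaseBasis n).coeff j W = u (S.mul (S.mul a ((phaseBasis n).e j)) b) :=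
      coeff_sandwich hB _ _ _ _
    have h1 : Λ j α = (((phaseBasis n).wt j ^ N : ℝ) : ℂ) * (phaseBasis n).coeff j W := by
      rw [hΛ, hW, ← (hu _).tsum_eq, ← tsum_mul_left]
      refine tsum_congr fun l => ?_
      rw [weightedQuad, quad_basis]
      push_cast
      ring
    rw [h1, norm_mul, Complex.norm_real,
      Real.norm_of_nonneg (pow_nonneg ((phaseBasis n).wt_pos j).le _)]
    exact hp j W
  refine ⟨C, fun ⟨j, l⟩ => ?_⟩
  -- Testing on unit sequences recovers the individual entries.
  let δ : HermiteIndex n →ᵇ ℂ := BoundedContinuousFunction.ofNormedAddCommGroupDiscrete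
    (fun k => if k = l then 1 else 0) 1 fun k => by split_ifs <;> simp
  have hδ : ‖δ‖ ≤ 1 := (BoundedContinuousFunction.norm_le zero_le_one).2 fun k => by
    change ‖if k = l then (1 : ℂ) else 0‖ ≤ 1
    split_ifs <;> simp
  have h1 : Λ j δ = weightedQuad S N a b (j, l) := by
    rw [hΛ, tsum_eq_single l]
    · change (if l = l then (1 : ℂ) else 0) * _ = _
      simp
    · intro k hk
      change (if k = l then (1 : ℂ) else 0) * _ = _
      simp [hk]
  rw [← h1]
  refine ((Λ j).le_opNorm δ).trans ?_
  calc _ ≤ C * 1 := mul_le_mul (hC j) hδ (norm_nonneg _) ((norm_nonneg _).trans (hC j))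
    _ = C := mul_one C

/-- The bound for fixed `a` and `b` becomes jointly continuous in them by the bilinear Baire
argument, since `#` is separately continuous. -/
theorem exists_weightedQuad_bound (hB : S.SandwichProperty) (N : ℕ) :
    ∃ q q' : Seminorm ℂ 𝓢(PhaseSpace n, ℂ), Continuous q ∧ Continuous q' ∧
      ∀ s a b, ‖weightedQuad S N a b s‖ ≤ q a * q' b :=
  exists_seminorm_bound_bilin
    (fun s : HermiteIndex n × HermiteIndex n =>
      (((phaseBasis n).wt s.1 ^ N * (phaseBasis n).wt s.2 ^ N : ℝ) : ℂ) •
        S.quadForm ((phaseBasis n).e s.1) ((phaseBasis n).e s.2))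
    (fun _ _ => (S.continuous_quadForm_right _ _ _).const_smul _)
    (fun _ _ => (S.continuous_quadForm_left _ _ _).const_smul _)
    (exists_norm_weightedQuad_le hB N)

theorem rapidDecay_quad (hB : S.SandwichProperty) (a b : 𝓢(PhaseSpace n, ℂ)) :
    (tensorBasis n).RapidDecay fun s =>
      S.quad a ((phaseBasis n).e s.1) b ((phaseBasis n).e s.2) := fun N => by
  obtain ⟨C, hC⟩ := exists_norm_weightedQuad_le hB N a b
  refine ⟨C, fun ⟨j, l⟩ => le_trans ?_ (hC (j, l))⟩
  rw [norm_weightedQuad]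
  exact mul_le_mul_of_nonneg_right (tensorBasis_wt_pow_le j l N) (norm_nonneg _)

/-- The Schwartz kernel of `(f, g) ↦ ∫ a # f # b # g`. -/
def kernel (hB : S.SandwichProperty) (a b : 𝓢(PhaseSpace n, ℂ)) :
    𝓢(PhaseSpace n × PhaseSpace n, ℂ) :=
  (RapidBasis.exists_of_rapidDecay (rapidDecay_quad hB a b)).choose

theorem coeff_kernel (hB : S.SandwichProperty) (a b : 𝓢(PhaseSpace n, ℂ)) (j l : HermiteIndex n) :
    (tensorBasis n).coeff (j, l) (kernel hB a b) =
      S.quad a ((phaseBasis n).e j) b ((phaseBasis n).e l) :=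
  (RapidBasis.exists_of_rapidDecay (rapidDecay_quad hB a b)).choose_spec (j, l)

/-- The kernel depends bilinearly on `a` and `b`. -/
def kernelBilin (hB : S.SandwichProperty) :
    𝓢(PhaseSpace n, ℂ) →ₗ[ℂ] 𝓢(PhaseSpace n, ℂ) →ₗ[ℂ] 𝓢(PhaseSpace n × PhaseSpace n, ℂ) :=
  LinearMap.mk₂ ℂ (kernel hB)
    (fun _ _ _ => (tensorBasis n).ext fun ⟨_, _⟩ => by
      simp only [map_add, coeff_kernel, ← quadForm_apply, LinearMap.add_apply])
    (fun _ _ _ => (tensorBasis n).ext fun ⟨_, _⟩ => by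
      simp only [map_smul, coeff_kernel, ← quadForm_apply, LinearMap.smul_apply])
    (fun _ _ _ => (tensorBasis n).ext fun ⟨_, _⟩ => by
      simp only [map_add, coeff_kernel, ← quadForm_apply])
    (fun _ _ _ => (tensorBasis n).ext fun ⟨_, _⟩ => by
      simp only [map_smul, coeff_kernel, ← quadForm_apply])

theorem boundedBilin_kernelBilin (hB : S.SandwichProperty) : BoundedBilin (kernelBilin hB) := by
  intro p hp
  obtain ⟨N, K, hK, h⟩ := (tensorBasis n).seminorm_le_of_coeff hp
  obtain ⟨q, q', hq, hq', hb⟩ := exists_weightedQuad_bound hB N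
  refine ⟨K.toNNReal • q, q', hq.const_smul _, hq', fun a b => ?_⟩
  rw [smul_apply, NNReal.smul_def, Real.coe_toNNReal _ hK, smul_eq_mul, mul_assoc]
  refine h _ _ fun ⟨j, l⟩ => le_trans ?_ (hb (j, l) a b)
  change _ * ‖(tensorBasis n).coeff (j, l) (kernel hB a b)‖ ≤ _
  rw [coeff_kernel, norm_weightedQuad]
  exact mul_le_mul_of_nonneg_right (tensorBasis_wt_pow_le j l N) (norm_nonneg _)

/-- The operator on `𝓢(Ξ × Ξ)` which maps `a ⊗ b` to the kernel of `(f, g) ↦ ∫ a # f # b # g`. -/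
def kernelOp (hB : S.SandwichProperty) :
    𝓢(PhaseSpace n × PhaseSpace n, ℂ) →L[ℂ] 𝓢(PhaseSpace n × PhaseSpace n, ℂ) :=
  (boundedBilin_kernelBilin hB).exists_lift.choose

theorem kernelOp_tensor (hB : S.SandwichProperty) (a b : 𝓢(PhaseSpace n, ℂ)) :
    kernelOp hB (tensor a b) = kernel hB a b :=
  (boundedBilin_kernelBilin hB).exists_lift.choose_spec a b

/-- The kernel was prescribed only through its coefficients; separate continuity extends the
identity from basis functions to all `f` and `g`. -/
theorem doublePairing_kernel (hB : S.SandwichProperty) (a b f g : 𝓢(PhaseSpace n, ℂ)) :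
    doublePairing (tensor f g) (kernel hB a b) = S.quad a f b g := by
  have h := eq_of_separatelyContinuous
    (b := (tensorBilin n).compr₂ (doublePairing (kernel hB a b)).toLinearMap)
    (b' := S.quadForm b a)
    (fun f => (doublePairing (kernel hB a b)).continuous.comp (tensorLeft n f).continuous)
    (fun g => (doublePairing (kernel hB a b)).continuous.comp (tensorFlip n g).continuous)
    (fun f => S.continuous_quadForm_right f b a) (fun g => S.continuous_quadForm_left b g a)
    (fun j l => by
      rw [← quadForm_swap, quadForm_apply, ← coeff_kernel hB, tensorBasis_coeff,
        doublePairing_comm]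
      rfl) f g
  rw [doublePairing_comm]
  exact h.trans (S.quadForm_swap _ _ _ _).symm

end CompositionLaw

/-! ### The symplectic Fourier transform -/

section SymplecticFourier

variable {n : ℕ}

theorem two_pi_mul_inner (Y Z : PhaseSpace n) :
    2 * Real.pi * inner ℝ Z (symplecticEquiv n Y) = symplecticForm Y Z := by
  have hsym : ∀ a, symplecticEquiv n Y a = Sum.elim (fun i => (2 * Real.pi)⁻¹ * Y (Sum.inr i))
      (fun i => -((2 * Real.pi)⁻¹ * Y (Sum.inl i))) a := fun a => rfl
  rw [PiLp.inner_apply, Fintype.sum_sum_type, mul_add, Finset.mul_sum, Finset.mul_sum,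
    symplecticForm, sub_eq_add_neg, ← Finset.sum_neg_distrib]
  congr 1 <;> refine Finset.sum_congr rfl fun i _ => ?_ <;> simp [hsym] <;> field_simp

theorem symplecticForm_swap (Y Z : PhaseSpace n) : symplecticForm Y Z = -symplecticForm Z Y := by
  simp [symplecticForm, mul_comm]

theorem symplecticForm_neg_left (Y Z : PhaseSpace n) :
    symplecticForm (-Y) Z = -symplecticForm Y Z := by
  rw [← two_pi_mul_inner, ← two_pi_mul_inner, map_neg, inner_neg_right, mul_neg]

theorem continuous_symplecticForm :
    Continuous fun p : PhaseSpace n × PhaseSpace n => symplecticForm p.1 p.2 := by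
  simp only [← two_pi_mul_inner]
  have := (symplecticEquiv n).continuous
  fun_prop

variable (n) in
/-- The isometry `(y, η) ↦ (η, -y)` of `Ξ`. -/
def symplecticIsometry : PhaseSpace n →ₗᵢ[ℝ] PhaseSpace n where
  toLinearMap := (2 * Real.pi) • (symplecticEquiv n).toLinearEquiv.toLinearMap
  norm_map' Y := by
    have hsym : ∀ a, ((2 * Real.pi) • symplecticEquiv n Y) a =
        Sum.elim (fun i => Y (Sum.inr i)) (fun i => -(Y (Sum.inl i))) a := fun a => by
      have h : symplecticEquiv n Y a = Sum.elim (fun i => (2 * Real.pi)⁻¹ * Y (Sum.inr i))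
        (fun i => -((2 * Real.pi)⁻¹ * Y (Sum.inl i))) a := rfl
      rw [PiLp.smul_apply, h]
      rcases a with a | a <;> simp <;> field_simp
    change ‖(2 * Real.pi) • symplecticEquiv n Y‖ = ‖Y‖
    rw [EuclideanSpace.norm_eq, EuclideanSpace.norm_eq, Fintype.sum_sum_type, Fintype.sum_sum_type,
      add_comm]
    simp only [hsym, Sum.elim_inl, Sum.elim_inr, norm_neg]

/-- The map is an isometry divided by `2π` in dimension `2n`. -/
theorem integral_comp_symplecticEquiv (G : PhaseSpace n → ℂ) :
    ∫ Z, G (symplecticEquiv n Z) = ((2 * Real.pi) ^ n * (2 * Real.pi) ^ n : ℝ) • ∫ Z, G Z := by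
  have h1 : ∀ Z, symplecticEquiv n Z =
      (2 * Real.pi)⁻¹ • (symplecticIsometry n).toLinearIsometryEquiv rfl Z := fun Z => by
    change _ = (2 * Real.pi)⁻¹ • (2 * Real.pi) • symplecticEquiv n Z
    rw [smul_smul, inv_mul_cancel₀ (by positivity), one_smul]
  simp only [h1]
  rw [((symplecticIsometry n).toLinearIsometryEquiv rfl).measurePreserving.integral_comp
    ((symplecticIsometry n).toLinearIsometryEquiv rfl).toHomeomorph.measurableEmbedding
    fun W => G ((2 * Real.pi)⁻¹ • W), Measure.integral_comp_smul]
  congr 1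
  rw [finrank_euclideanSpace, Fintype.card_sum, Fintype.card_fin, pow_add, ← mul_pow, ← mul_inv,
    inv_pow, inv_inv, abs_of_pos (by positivity), mul_pow]

/-- Antisymmetry of `σ` makes the second transform an inverse Fourier transform after the
substitution by `symplecticEquiv`, and the Jacobian cancels the two factors `(2π)⁻ⁿ`. -/
theorem symplecticFourier_symplecticFourier (f : 𝓢(PhaseSpace n, ℂ)) :
    symplecticFourier n (symplecticFourier n f) = f := by
  ext Y
  have h1 : ∀ Z, symplecticFourier n f Z =
      (((2 * Real.pi) ^ n)⁻¹ : ℂ) * 𝓕 (f : PhaseSpace n → ℂ) (symplecticEquiv n Z) := fun Z => rfl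
  let G : PhaseSpace n → ℂ := fun W =>
    Complex.exp (↑(2 * Real.pi * inner ℝ W Y) * Complex.I) • 𝓕 (f : PhaseSpace n → ℂ) W
  have hG : ∫ W, G W = f Y := by
    rw [← Real.fourierInv_eq', ← SchwartzMap.fourier_coe, ← SchwartzMap.fourierInv_coe,
      FourierTransform.fourierInv_fourier_eq]
  rw [symplecticFourier_apply, phaseMeasure, integral_smul_measure,
    ENNReal.toReal_ofReal (by positivity), Complex.real_smul]
  have h2 : ∀ Z, Complex.exp (-(Complex.I * (symplecticForm Y Z : ℂ))) * symplecticFourier n f Z =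
      (((2 * Real.pi) ^ n)⁻¹ : ℂ) * G (symplecticEquiv n Z) := fun Z => by
    simp only [G]
    rw [h1, symplecticForm_swap, real_inner_comm, two_pi_mul_inner, smul_eq_mul, mul_left_comm]
    congr 3
    push_cast
    ring
  simp only [h2]
  rw [integral_const_mul, integral_comp_symplecticEquiv, hG, Complex.real_smul]
  have h3 : ((2 * Real.pi : ℂ)) ^ n ≠ 0 := pow_ne_zero _ (by simp [Real.pi_ne_zero])
  push_cast
  field_simp

/-- Fubini; antisymmetry of `σ` produces the reflection `-Z`. -/
theorem integral_mul_symplecticFourier (a b : 𝓢(PhaseSpace n, ℂ)) :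
    ∫ Y, a Y * symplecticFourier n b Y ∂(phaseMeasure n) =
      ∫ Z, symplecticFourier n a (-Z) * b Z ∂(phaseMeasure n) := by
  have hint : Integrable (Function.uncurry fun Y Z : PhaseSpace n =>
      Complex.exp (-(Complex.I * (symplecticForm Y Z : ℂ))) * (a Y * b Z))
      ((phaseMeasure n).prod (phaseMeasure n)) := by
    refine ((a.integrable (μ := phaseMeasure n)).mul_prod
      (b.integrable (μ := phaseMeasure n))).norm.mono' ?_ (Filter.Eventually.of_forall fun p => ?_)
    · refine Continuous.aestronglyMeasurable ?_
      have h1 := continuous_symplecticForm (n := n)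
      have h2 := a.continuous
      have h3 := b.continuous
      simp only [Function.uncurry_def]
      fun_prop
    · simp only [Function.uncurry_def, norm_mul]
      rw [Complex.norm_exp]
      simp
  calc _ = ∫ Y, ∫ Z, Complex.exp (-(Complex.I * (symplecticForm Y Z : ℂ))) * (a Y * b Z)
        ∂(phaseMeasure n) ∂(phaseMeasure n) := by
        refine integral_congr_ae (Filter.Eventually.of_forall fun Y => ?_)
        simp only
        rw [symplecticFourier_apply, ← integral_const_mul]
        congr 1; ext Z; ring
    _ = ∫ Z, ∫ Y, Complex.exp (-(Complex.I * (symplecticForm Y Z : ℂ))) * (a Y * b Z)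
        ∂(phaseMeasure n) ∂(phaseMeasure n) := integral_integral_swap hint
    _ = _ := by
        refine integral_congr_ae (Filter.Eventually.of_forall fun Z => ?_)
        simp only
        rw [symplecticFourier_apply, ← integral_mul_const]
        congr 1; ext Y
        rw [symplecticForm_neg_left, symplecticForm_swap Y Z]
        ring

theorem integral_symplecticFourier_mul (a b : 𝓢(PhaseSpace n, ℂ)) :
    ∫ Z, symplecticFourier n a (-Z) * symplecticFourier n b Z ∂(phaseMeasure n) =
      ∫ Y, a Y * b Y ∂(phaseMeasure n) := by
  rw [← integral_mul_symplecticFourier, symplecticFourier_symplecticFourier]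

end SymplecticFourier

/-! ### The trace formula -/

namespace CompositionLaw

variable {n : ℕ} {S : CompositionLaw n}

/-- Matrix elements decay jointly in both indices: `N` powers in the second index control `p`, and
`M` powers in the first give the asserted decay. The exponent `N + M` covers both. -/
theorem exists_seminorm_sandwich_le (hB : S.SandwichProperty) (a b : 𝓢(PhaseSpace n, ℂ))
    {p : Seminorm ℂ 𝓢(PhaseSpace n, ℂ)} (hp : Continuous p) (M : ℕ) :
    ∃ A, ∀ i, (phaseBasis n).wt i ^ M * p (S.mul (S.mul a ((phaseBasis n).e i)) b) ≤ A := by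
  obtain ⟨N, K, hK, h⟩ := (phaseBasis n).seminorm_le_of_coeff hp
  obtain ⟨C, hC⟩ := exists_norm_weightedQuad_le hB (N + M) a b
  have hw := (phaseBasis n).wt_pos
  have h1 := (phaseBasis n).one_le_wt
  refine ⟨K * C, fun i => ?_⟩
  have h2 : p (S.mul (S.mul a ((phaseBasis n).e i)) b) ≤ K * (C / (phaseBasis n).wt i ^ M) := by
    refine h _ _ fun l => ?_
    have hwi := hw i
    have hwl := hw l
    rw [le_div_iff₀ (by positivity), ← quad_basis]
    refine le_trans ?_ (hC (i, l))
    rw [norm_weightedQuad]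
    have h3 : (phaseBasis n).wt i ^ M ≤ (phaseBasis n).wt i ^ (N + M) :=
      pow_le_pow_right₀ (h1 i) (Nat.le_add_left _ _)
    have h4 : (phaseBasis n).wt l ^ N ≤ (phaseBasis n).wt l ^ (N + M) :=
      pow_le_pow_right₀ (h1 l) (Nat.le_add_right _ _)
    calc _ = (phaseBasis n).wt i ^ M * (phaseBasis n).wt l ^ N *
          ‖S.quad a ((phaseBasis n).e i) b ((phaseBasis n).e l)‖ := by ring
      _ ≤ _ := by gcongr
  have hwi := hw i
  calc _ ≤ (phaseBasis n).wt i ^ M * (K * (C / (phaseBasis n).wt i ^ M)) := by gcongr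
    _ = K * C := by field_simp

theorem integral_norm_eq_norm_toLp (f : 𝓢(PhaseSpace n, ℂ)) :
    ∫ X, ‖f X‖ ∂(phaseMeasure n) = ‖f.toLp 1 (phaseMeasure n)‖ := by
  rw [L1.norm_eq_integral_norm]
  refine integral_congr_ae ?_
  filter_upwards [f.coeFn_toLp 1 (phaseMeasure n)] with x hx
  rw [hx]

/-- The trace formula which is the content of the orthogonality property. -/
theorem hasSum_quad {hB : S.SandwichProperty} (hC : OrthogonalityProperty hB)
    (f g : 𝓢(PhaseSpace n, ℂ)) :
    HasSum (fun i => S.quad g ((phaseBasis n).e i) f ((phaseBasis n).e i))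
      (trace n f * trace n g) := by
  let a : HermiteIndex n → 𝓢(PhaseSpace n, ℂ) := fun i =>
    S.mul (S.mul g ((phaseBasis n).e i)) f
  -- The factors are `e_Z` evaluated at `g # e_i # f`, which is the `i`-th coefficient of `f # e_Z #
  -- g`, and `e_{-Z}` evaluated at `e_i`. Summing over `i` expands `⟨e_{-Z} # f # e_Z, g⟩`.
  let F : HermiteIndex n → PhaseSpace n → ℂ := fun i Z =>
    symplecticFourier n (a i) (-Z) * symplecticFourier n ((phaseBasis n).e i) Z
  let p : Seminorm ℂ 𝓢(PhaseSpace n, ℂ) :=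
    (SchwartzMap.seminorm ℂ 0 0).comp (symplecticFourier n).toLinearMap
  have hp : Continuous p :=
    (continuous_schwartzSeminorm 0 0).comp (symplecticFourier n).continuous
  let q : Seminorm ℂ 𝓢(PhaseSpace n, ℂ) := (normSeminorm ℂ (Lp ℂ 1 (phaseMeasure n))).comp
    (SchwartzMap.toLpCLM ℂ ℂ 1 (phaseMeasure n) ∘L symplecticFourier n).toLinearMap
  have hq : Continuous q := continuous_norm.comp
    (SchwartzMap.toLpCLM ℂ ℂ 1 (phaseMeasure n) ∘L symplecticFourier n).continuous
  have hqe : ∀ f, q f = ∫ X, ‖symplecticFourier n f X‖ ∂(phaseMeasure n) := fun f =>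
    (integral_norm_eq_norm_toLp _).symm
  have hF : ∀ i Z, ‖F i Z‖ ≤ p (a i) * ‖symplecticFourier n ((phaseBasis n).e i) Z‖ := fun i Z => by
    rw [norm_mul]
    exact mul_le_mul_of_nonneg_right (SchwartzMap.norm_le_seminorm ℂ _ _) (norm_nonneg _)
  have hint : ∀ i, Integrable (fun Z => ‖symplecticFourier n ((phaseBasis n).e i) Z‖)
      (phaseMeasure n) := fun i => (SchwartzMap.integrable _).norm
  have hFint : ∀ i, Integrable (F i) (phaseMeasure n) := fun i => by
    refine ((hint i).const_mul (p (a i))).mono' (Continuous.aestronglyMeasurable ?_)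
      (Filter.Eventually.of_forall (hF i))
    have h1 := (symplecticFourier n (a i)).continuous
    have h2 := (symplecticFourier n ((phaseBasis n).e i)).continuous
    fun_prop
  -- The sup norm of the first factor decays faster than any power of the weight, while the `L¹`
  -- norm of the second grows polynomially. This justifies exchanging the sum over `i` with the
  -- integral over `Z`.
  have hFsum : Summable fun i => ∫ Z, ‖F i Z‖ ∂(phaseMeasure n) := by
    obtain ⟨D, hD⟩ := (phaseBasis n).exists_summable
    obtain ⟨C, M, hC0, hM⟩ := (phaseBasis n).growth q hq
    obtain ⟨A, hA⟩ := exists_seminorm_sandwich_le hB g f hp (M + D)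
    refine Summable.of_nonneg_of_le (fun i => integral_nonneg fun Z => norm_nonneg _) (fun i => ?_)
      (hD.mul_left (A * C))
    have hw := (phaseBasis n).wt_pos i
    calc _ ≤ ∫ Z, p (a i) * ‖symplecticFourier n ((phaseBasis n).e i) Z‖ ∂(phaseMeasure n) :=
          integral_mono (hFint i).norm ((hint i).const_mul _) (hF i)
      _ = p (a i) * q ((phaseBasis n).e i) := by rw [integral_const_mul, hqe]
      _ ≤ p (a i) * (C * (phaseBasis n).wt i ^ M) :=
          mul_le_mul_of_nonneg_left (hM i) (apply_nonneg _ _)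
      _ = ((phaseBasis n).wt i ^ (M + D) * p (a i)) * C * ((phaseBasis n).wt i ^ D)⁻¹ := by
          rw [pow_add]; field_simp
      _ ≤ _ := by
          have := hA i
          gcongr
  have h := hasSum_integral_of_summable_integral_norm hFint hFsum
  have h1 : ∀ Z, ∑' i, F i Z = hB.pairing (expDist (-Z)) f (expDist Z) g := fun Z => by
    have h2 := ((phaseBasis n).hasSum (hB.sandwich f (expDist Z) g)).mapL
      (expDist (-Z) : 𝓢(PhaseSpace n, ℂ) →L[ℂ] ℂ)
    refine (tsum_congr fun i => ?_).trans h2.tsum_eq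
    have h3 : expDist (-Z) ((phaseBasis n).e i) =
        symplecticFourier n ((phaseBasis n).e i) (- -Z) := rfl
    have h4 : (expDist (-Z) : 𝓢(PhaseSpace n, ℂ) →L[ℂ] ℂ)
        ((phaseBasis n).coeff i (hB.sandwich f (expDist Z) g) • (phaseBasis n).e i) =
        (phaseBasis n).coeff i (hB.sandwich f (expDist Z) g) *
          expDist (-Z) ((phaseBasis n).e i) :=
      ContinuousLinearMap.map_smul (M₁ := 𝓢(PhaseSpace n, ℂ)) (expDist (-Z)) _ _
    refine Eq.trans ?_ h4.symm
    rw [coeff_sandwich, h3, neg_neg]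
    rfl
  simp only [h1] at h
  rw [hC f g] at h
  -- Parseval evaluates the integral over `Z` of the `i`-th term as `∫ (g # e_i # f) e_i`.
  refine h.congr_fun fun i => ?_
  rw [integral_symplecticFourier_mul, quad_basis, phaseBasis_coeff]

/-- The `(j, l)` coefficient is the sum over `(i, m)` of `∫ a # e_i # b # e_m` times `∫ e_i # e_j #
e_m # e_l`. The sum over `m` is the expansion of `a # e_i # b`. Cyclic rotation then leaves the
trace formula for `e_j # a` and `b # e_l`, whose value is the product of the coefficients of `a` and
`b`. -/
theorem kernelOp_kernel {hB : S.SandwichProperty} (hC : OrthogonalityProperty hB)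
    (a b : 𝓢(PhaseSpace n, ℂ)) : kernelOp hB (kernel hB a b) = tensor a b := by
  refine (tensorBasis n).ext fun ⟨j, l⟩ => ?_
  have h1 := ((tensorBasis n).hasSum (kernel hB a b)).mapL
    ((tensorBasis n).coeff (j, l) ∘L kernelOp hB)
  have h2 : ∀ i, HasSum (fun m => ((tensorBasis n).coeff (j, l) ∘L kernelOp hB)
      ((tensorBasis n).coeff (i, m) (kernel hB a b) • (tensorBasis n).e (i, m)))
      (S.quad (S.mul ((phaseBasis n).e j) a) ((phaseBasis n).e i)
        (S.mul b ((phaseBasis n).e l)) ((phaseBasis n).e i)) := fun i => by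
    have h3 := ((phaseBasis n).hasSum (S.mul (S.mul a ((phaseBasis n).e i)) b)).mapL
      (⟨S.quadForm ((phaseBasis n).e j) ((phaseBasis n).e l) ((phaseBasis n).e i),
        S.continuous_quadForm_right _ _ _⟩ : 𝓢(PhaseSpace n, ℂ) →L[ℂ] ℂ)
    have h4 : S.quad (S.mul ((phaseBasis n).e j) a) ((phaseBasis n).e i)
        (S.mul b ((phaseBasis n).e l)) ((phaseBasis n).e i) =
        S.quad ((phaseBasis n).e i) ((phaseBasis n).e j)
          (S.mul (S.mul a ((phaseBasis n).e i)) b) ((phaseBasis n).e l) := by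
      rw [← S.quad_rotate]
      simp only [quad, S.assoc]
    rw [h4]
    refine h3.congr_fun fun m => ?_
    rw [map_smul, map_smul, coeff_kernel, quad_basis, ContinuousLinearMap.comp_apply,
      tensorBasis_e, kernelOp_tensor, coeff_kernel]
    rfl
  refine (h1.prod_fiberwise h2).unique ?_
  have h5 := hasSum_quad hC (S.mul b ((phaseBasis n).e l)) (S.mul ((phaseBasis n).e j) a)
  convert h5 using 1
  rw [tensorBasis_coeff_tensor, trace_mul, trace_mul, phaseBasis_coeff, phaseBasis_coeff]
  simp only [mul_comm]

theorem kernelOp_kernelOp {hB : S.SandwichProperty} (hC : OrthogonalityProperty hB)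
    (G : 𝓢(PhaseSpace n × PhaseSpace n, ℂ)) : kernelOp hB (kernelOp hB G) = G :=
  DFunLike.congr_fun (tensor_hom_ext (T₁ := kernelOp hB ∘L kernelOp hB)
    (T₂ := ContinuousLinearMap.id ℂ _) fun f g => by
      rw [ContinuousLinearMap.comp_apply, kernelOp_tensor, kernelOp_kernel hC]
      rfl) G

end CompositionLaw

/-! ### The map `𝐍` and its left inverse -/

section

variable {n : ℕ}

theorem exists_doubleFourier :
    ∃ T : 𝓢(PhaseSpace n × PhaseSpace n, ℂ) →L[ℂ] 𝓢(PhaseSpace n × PhaseSpace n, ℂ), ∀ f g,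
      T (tensor f g) = tensor (symplecticFourier n f) (symplecticFourier n g) :=
  (boundedBilin_tensorBilin.comp (symplecticFourier n) (symplecticFourier n)).exists_lift

variable (n) in
/-- The symplectic Fourier transform on `𝓢(Ξ × Ξ)`, in both variables. -/
def doubleFourier :
    𝓢(PhaseSpace n × PhaseSpace n, ℂ) →L[ℂ] 𝓢(PhaseSpace n × PhaseSpace n, ℂ) :=
  exists_doubleFourier.choose

theorem doubleFourier_tensor (f g : 𝓢(PhaseSpace n, ℂ)) :
    doubleFourier n (tensor f g) = tensor (symplecticFourier n f) (symplecticFourier n g) :=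
  exists_doubleFourier.choose_spec f g

theorem doubleFourier_doubleFourier (G : 𝓢(PhaseSpace n × PhaseSpace n, ℂ)) :
    doubleFourier n (doubleFourier n G) = G :=
  DFunLike.congr_fun (tensor_hom_ext (T₁ := doubleFourier n ∘L doubleFourier n)
    (T₂ := ContinuousLinearMap.id ℂ _) fun f g => by
      rw [ContinuousLinearMap.comp_apply, doubleFourier_tensor, doubleFourier_tensor,
        symplecticFourier_symplecticFourier, symplecticFourier_symplecticFourier]
      rfl) G

/-- Expansion of a tempered distribution on `Ξ × Ξ` in the functions `e_j ⊗ e_l`. -/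
theorem hasSum_distribution (u : 𝓢'(PhaseSpace n × PhaseSpace n, ℂ)) :
    HasSum (fun s => u ((tensorBasis n).e s) •
      SchwartzMap.toTemperedDistributionCLM (PhaseSpace n × PhaseSpace n) ℂ
        ((phaseMeasure n).prod (phaseMeasure n)) ((tensorBasis n).e s)) u := by
  refine PointwiseConvergenceCLM.tendsto_iff_forall_tendsto.2 fun G => ?_
  have h := ((tensorBasis n).hasSum G).mapL
    (u : 𝓢(PhaseSpace n × PhaseSpace n, ℂ) →L[ℂ] ℂ)
  refine Filter.Tendsto.congr (fun s => ?_) h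
  have h1 := map_sum (PointwiseConvergenceCLM.evalCLM (RingHom.id ℂ) ℂ G)
    (fun s => u ((tensorBasis n).e s) •
      SchwartzMap.toTemperedDistributionCLM (PhaseSpace n × PhaseSpace n) ℂ
        ((phaseMeasure n).prod (phaseMeasure n)) ((tensorBasis n).e s)) s
  refine Eq.trans ?_ h1.symm
  refine Finset.sum_congr rfl fun ⟨j, l⟩ _ => ?_
  refine (ContinuousLinearMap.map_smul (M₁ := 𝓢(PhaseSpace n × PhaseSpace n, ℂ)) u _ _).trans ?_
  rw [tensorBasis_coeff, ← tensorBasis_e, smul_eq_mul, mul_comm]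
  rfl

end

namespace CompositionLaw

variable {n : ℕ} {S : CompositionLaw n}

/-- The map `𝐍` is the transpose of `G ↦ kernelOp (doubleFourier G)`. -/
theorem isNMap_precomp (hB : S.SandwichProperty) :
    S.IsNMap (PointwiseConvergenceCLM.precomp ℂ (kernelOp hB ∘L doubleFourier n)) := by
  intro f₁ f₂ g₁ g₂
  change doublePairing (tensor f₁ f₂) (kernelOp hB (doubleFourier n (tensor g₁ g₂))) = _
  rw [doubleFourier_tensor, kernelOp_tensor, doublePairing_kernel, quad_eq_integral]

/-- Every distribution is the sum of its expansion in the tensors `e_j ⊗ e_l`, so a continuous map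
is determined there; the resulting distributions are in turn determined by elementary tensors. -/
theorem IsNMap.unique {T T' : 𝓢'(PhaseSpace n × PhaseSpace n, ℂ) →L[ℂ]
    𝓢'(PhaseSpace n × PhaseSpace n, ℂ)} (hT : S.IsNMap T) (hT' : S.IsNMap T') : T = T' := by
  have h : ∀ j l, T (SchwartzMap.toTemperedDistributionCLM (PhaseSpace n × PhaseSpace n) ℂ
      ((phaseMeasure n).prod (phaseMeasure n)) ((tensorBasis n).e (j, l))) =
      T' (SchwartzMap.toTemperedDistributionCLM (PhaseSpace n × PhaseSpace n) ℂ
      ((phaseMeasure n).prod (phaseMeasure n)) ((tensorBasis n).e (j, l))) := fun j l => by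
    rw [tensorBasis_e]
    exact tensor_hom_ext (W := ℂ) fun f g => (hT _ _ f g).trans (hT' _ _ f g).symm
  ext1 u
  have h1 := (hasSum_distribution u).mapL T
  have h2 := (hasSum_distribution u).mapL T'
  refine h1.unique (h2.congr_fun fun ⟨j, l⟩ => ?_)
  rw [map_smul, map_smul, h]

theorem nMap_eq (hB : S.SandwichProperty) :
    S.nMap = PointwiseConvergenceCLM.precomp ℂ (kernelOp hB ∘L doubleFourier n) := by
  have H : ∃ T, S.IsNMap T := ⟨_, isNMap_precomp hB⟩
  rw [nMap, dif_pos H]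
  exact H.choose_spec.unique (isNMap_precomp hB)

/-- `𝐍` is the transpose of a product of two involutions, so the transpose of the product in the
opposite order undoes it. -/
theorem nMap_leftInverse {hB : S.SandwichProperty} (hC : OrthogonalityProperty hB)
    (u : 𝓢'(PhaseSpace n × PhaseSpace n, ℂ)) :
    PointwiseConvergenceCLM.precomp ℂ (doubleFourier n ∘L kernelOp hB) (S.nMap u) = u := by
  rw [nMap_eq hB]
  refine ContinuousLinearMap.ext fun G => ?_
  change u (kernelOp hB (doubleFourier n (doubleFourier n (kernelOp hB G)))) = u G
  rw [doubleFourier_doubleFourier, kernelOp_kernelOp hC]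

theorem changeVarDist_leftInverse (u : 𝓢'(PhaseSpace n × PhaseSpace n, ℂ)) :
    PointwiseConvergenceCLM.precomp ℂ
      (SchwartzMap.compCLMOfContinuousLinearEquiv ℂ (changeVar n)) (changeVarDist n u) = u := by
  refine ContinuousLinearMap.ext fun G => ?_
  change u (SchwartzMap.compCLMOfContinuousLinearEquiv ℂ (changeVar n).symm
    (SchwartzMap.compCLMOfContinuousLinearEquiv ℂ (changeVar n) G)) = u G
  congr 1
  ext p
  simp

theorem exists_tensorRight_leftInverse {h : 𝓢(PhaseSpace n, ℂ)} (hh : h ≠ 0) :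
    ∃ R : 𝓢'(PhaseSpace n × PhaseSpace n, ℂ) →L[ℂ] 𝓢'(PhaseSpace n, ℂ),
      ∀ u, R (tensorRight h u) = u := by
  obtain ⟨j, hj⟩ : ∃ j, (phaseBasis n).coeff j h ≠ 0 := by
    by_contra! hz
    exact hh ((phaseBasis n).total h hz)
  -- A basis function that sees `h`, scaled so that `∫ h κ = 1`; totality of the basis provides it
  -- because `h ≠ 0`.
  let κ := ((phaseBasis n).coeff j h)⁻¹ • (phaseBasis n).e j
  have hκ : ∫ Y, h Y * κ Y ∂(phaseMeasure n) = 1 := by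
    have h1 : ∀ Y, h Y * κ Y =
        ((phaseBasis n).coeff j h)⁻¹ * (h Y * (phaseBasis n).e j Y) := fun Y => mul_left_comm _ _ _
    simp only [h1]
    rw [integral_const_mul, ← phaseBasis_coeff, inv_mul_cancel₀ hj]
  refine ⟨PointwiseConvergenceCLM.precomp ℂ (tensorFlip n κ), fun u => ?_⟩
  refine ContinuousLinearMap.ext fun g => ?_
  change u (partialPairing h (tensor g κ)) = u g
  congr 1
  ext X
  rw [partialPairing_apply]
  have h1 : ∀ Y, h Y * tensor g κ (X, Y) = g X * (h Y * κ Y) := fun Y => mul_left_comm _ _ _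
  simp only [h1]
  rw [integral_const_mul, hκ, mul_one]

theorem exists_windowedMap_leftInverse {hB : S.SandwichProperty} (hC : OrthogonalityProperty hB)
    {h : 𝓢(PhaseSpace n, ℂ)} (hh : h ≠ 0) :
    ∃ R : 𝓢'(PhaseSpace n × PhaseSpace n, ℂ) →L[ℂ] 𝓢'(PhaseSpace n, ℂ),
      ∀ u, R (S.windowedMap h u) = u := by
  obtain ⟨R, hR⟩ := exists_tensorRight_leftInverse hh
  refine ⟨R ∘L PointwiseConvergenceCLM.precomp ℂ (doubleFourier n ∘L kernelOp hB) ∘L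
    PointwiseConvergenceCLM.precomp ℂ
      (SchwartzMap.compCLMOfContinuousLinearEquiv ℂ (changeVar n)), fun u => ?_⟩
  change R (PointwiseConvergenceCLM.precomp ℂ (doubleFourier n ∘L kernelOp hB)
    (PointwiseConvergenceCLM.precomp ℂ
      (SchwartzMap.compCLMOfContinuousLinearEquiv ℂ (changeVar n))
      (changeVarDist n (S.nMap (tensorRight h u))))) = u
  rw [changeVarDist_leftInverse, nMap_leftInverse hC, hR]

/-! ### The induced spaces -/

section Induced

variable {𝔏 : Type*} [NormedAddCommGroup 𝔏] [NormedSpace ℂ 𝔏] {h : 𝓢(PhaseSpace n, ℂ)}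
  {ι : 𝔏 →L[ℂ] 𝓢'(PhaseSpace n × PhaseSpace n, ℂ)}

/-- The map `f ↦ 𝐌_h f` from `𝔏^𝐌_h` to `𝔏`. -/
def InducedSpace.imageHom (hι : Function.Injective ι) : S.InducedSpace h ι →ₗ[ℂ] 𝔏 where
  toFun := InducedSpace.image
  map_add' f g := hι (by
    rw [map_add, f.image_spec, g.image_spec, (f + g).image_spec]
    exact map_add (S.windowedMap h) f.1 g.1)
  map_smul' c f := hι (by
    rw [RingHom.id_apply, map_smul, f.image_spec, (c • f).image_spec]
    exact map_smul (S.windowedMap h) c f.1)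

theorem InducedSpace.norm_eq_imageHom (hι : Function.Injective ι) (f : S.InducedSpace h ι) :
    ‖f‖ = ‖InducedSpace.imageHom hι f‖ := rfl

theorem InducedSpace.imageHom_eq_zero_iff {hB : S.SandwichProperty}
    (hC : OrthogonalityProperty hB) (hι : Function.Injective ι) (hh : h ≠ 0)
    (f : S.InducedSpace h ι) : InducedSpace.imageHom hι f = 0 ↔ f = 0 := by
  refine ⟨fun h0 => ?_, fun h0 => by rw [h0, map_zero]⟩
  obtain ⟨R, hR⟩ := exists_windowedMap_leftInverse hC hh
  have h1 : S.windowedMap h f.1 = 0 := by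
    rw [← f.image_spec, show f.image = 0 from h0, map_zero]
  refine Subtype.ext ?_
  rw [← hR f.1, h1, map_zero]
  rfl

theorem inducedCore {hB : S.SandwichProperty} (hC : OrthogonalityProperty hB)
    (hι : Function.Injective ι) (hh : h ≠ 0) : NormedSpace.Core ℂ (S.InducedSpace h ι) where
  norm_nonneg f := norm_nonneg (InducedSpace.imageHom hι f)
  norm_smul c f := by
    rw [InducedSpace.norm_eq_imageHom hι, InducedSpace.norm_eq_imageHom hι, map_smul, norm_smul]
  norm_triangle f g := by
    rw [InducedSpace.norm_eq_imageHom hι, map_add]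
    exact norm_add_le _ _
  norm_eq_zero_iff f := by
    rw [InducedSpace.norm_eq_imageHom hι, norm_eq_zero, InducedSpace.imageHom_eq_zero_iff hC hι hh]

/-- `F` lies in the range exactly when `𝐌_h (R (ι F)) = ι F`, the preimage then being `R (ι F)`.
This is an equation between continuous maps on `𝔏`. -/
theorem isClosed_range_imageHom {hB : S.SandwichProperty} (hC : OrthogonalityProperty hB)
    (hι : Function.Injective ι) (hh : h ≠ 0) :
    IsClosed (Set.range (InducedSpace.imageHom (S := S) (h := h) hι)) := by
  obtain ⟨R, hR⟩ := exists_windowedMap_leftInverse hC hh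
  have h1 : Set.range (InducedSpace.imageHom (S := S) (h := h) hι) =
      {F | S.windowedMap h (R (ι F)) = ι F} := by
    ext F
    refine ⟨?_, fun hF => ?_⟩
    · rintro ⟨f, rfl⟩
      change S.windowedMap h (R (ι f.image)) = ι f.image
      rw [f.image_spec, hR]
    · let f : S.InducedSpace h ι := ⟨R (ι F), F, hF.symm⟩
      exact ⟨f, hι (f.image_spec.trans hF)⟩
  rw [h1]
  exact isClosed_eq ((S.windowedMap h).continuous.comp (R.continuous.comp ι.continuous))
    ι.continuous

end Induced

end CompositionLaw

end AbstractModulation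

end

theorem mainTheorem6 {n : ℕ} (S : AbstractModulation.CompositionLaw n)
    (hB : S.SandwichProperty) (hC : AbstractModulation.CompositionLaw.OrthogonalityProperty hB)
    {𝔏 : Type*} [NormedAddCommGroup 𝔏] [NormedSpace ℂ 𝔏]
    (ι : 𝔏 →L[ℂ] 𝓢'(AbstractModulation.PhaseSpace n × AbstractModulation.PhaseSpace n, ℂ))
    (hι : Function.Injective ι)
    (h : 𝓢(AbstractModulation.PhaseSpace n, ℂ)) (hh : h ≠ 0) :
    ∃ core : NormedSpace.Core ℂ (S.InducedSpace h ι),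
      CompleteSpace 𝔏 →
        letI : NormedAddCommGroup (S.InducedSpace h ι) := NormedAddCommGroup.ofCore core
        CompleteSpace (S.InducedSpace h ι) := by
  refine ⟨AbstractModulation.CompositionLaw.inducedCore hC hι hh, fun h𝔏 => ?_⟩
  let : NormedAddCommGroup (S.InducedSpace h ι) :=
    NormedAddCommGroup.ofCore (AbstractModulation.CompositionLaw.inducedCore hC hι hh)
  -- The norm was defined as that of the image, so the embedding preserves norms by definition; a
  -- closed range in a complete space then gives completeness.
  have hiso : Isometry (AbstractModulation.CompositionLaw.InducedSpace.imageHom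
      (S := S) (h := h) hι) :=
    AddMonoidHomClass.isometry_of_norm _ fun _ => rfl
  exact hiso.isUniformInducing.completeSpace
    (AbstractModulation.CompositionLaw.isClosed_range_imageHom hC hι hh).isComplete
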